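/- For $N\ge 1$ and $\omega>0$ let $\nu_{N,\omega}$ be the uniform probability measure on the sphere $\{\eta\in\mathbb R^N:\sum_{i}\eta_i^2=\omega\}$. For $i\ne j$ let $R^{ij}_\theta$ be the clockwise rotation by the angle $\theta$ in the plane $(\eta_i,\eta_j)$, and let $R^{ii}_\theta=\mathrm{Id}$. Let $\rho$ be a probability density on the circle: $\rho\ge 0$ almost everywhere on $(-\pi,\pi]$, $\rho$ is integrable, and $\int_{-\pi}^{\pi}\rho(\theta)\,d\theta=1$. Put $$\mathcal L f(\eta)=\frac1{2N}\sum_{i,j=1}^N\int_{-\pi}^{\pi}[f(R^{ij}_\theta\eta)-f(\eta)]\,\rho(\theta)\,d\theta ,$$ and let $\mathcal L^{*}$ be the same operator with $\rho$ replaced by the constant $\frac1{2\pi}$. For $d\ge 1$, let $\Lambda_N=\{1,\dots,N\}^d$ and $\|x-y\|=\sum_{k=1}^d|x_k-y_k|$. For functions of $\eta=(\eta_x)_{x\in\Lambda_N}\in\mathbb R^{\Lambda_N}$, put $$\mathcal L^{loc} f(\eta)=\frac12\sum_{x\in\Lambda_N}\ \sum_{y\in\Lambda_N,\ \|x-y\|=1}\int_{-\pi}^{\pi}[f(R^{xy}_\theta\eta)-f(\eta)]\,\rho(\theta)\,d\theta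 ,$$ and let $\mathcal L^{*,loc}$ be the same operator with $\rho$ replaced by $\frac1{2\pi}$. For an operator $A$ and a probability measure $\nu$, let $$\mathrm{gap}(A,\nu)=\inf\Big\{\frac{\nu(f(-A)f)}{\nu(f^2)}\ :\ f\in L^2(\nu),\ \nu(f)=0,\ \nu(f^2)\ne 0\Big\}.$$ Define $\lambda(N)=\inf_{\omega>0}\mathrm{gap}(\mathcal L,\nu_{N,\omega})$ and $\lambda^{*}(N)=\inf_{\omega>0}\mathrm{gap}(\mathcal L^{*},\nu_{N,\omega})$, and, with $\nu_{\Lambda_N,\omega}$ the uniform probability measure on $\{\eta\in\mathbb R^{\Lambda_N}:\sum_{x}\eta_x^2=\omega\}$, define $\lambda^{loc}(N)=\inf_{\omega>0}\mathrm{gap}(\mathcal L^{loc},\nu_{\Lambda_N,\omega})$ and $\lambda^{*,loc}(N)=\inf_{\omega>0}\mathrm{gap}(\mathcal L^{*,loc},\nu_{\Lambda_N,\omega})$. Then for every such $\rho$, all $d\ge 1$ and all $N\ge 1$, $$\lambda(N)\ \ge\ 2\,\lambda(2)\,\lambda^{*}(N),\qquad \lambda^{loc}(N)\ \ge\ 2\,\lambda(2)\,\lambda^{*,loc}(N).$$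 Moreover, for all $d\ge 1$ and all $N\ge 2$, $$\lambda(N)\ \ge\ \lambda(2)\,\frac{N+2}{2N},\qquad \lambda^{loc}(N)\ \ge\ \frac{\lambda(2)}{192\,d\,N^2}.$$ -/

import Mathlib

noncomputable section

namespace KacWalk

open MeasureTheory

/-- The uniform probability measure `ν` on the sphere `∑ i, η i ^ 2 = ω` of radius `√ω`, viewed as
a measure on the ambient Euclidean space: the normalised surface measure of the unit sphere,
pushed forward by the dilation of ratio `√ω`. -/
def sphereMeasure (ι : Type) [Fintype ι] (ω : ℝ) : Measure (EuclideanSpace ℝ ι) :=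
  (((volume : Measure (EuclideanSpace ℝ ι)).toSphere Set.univ)⁻¹ •
    (volume : Measure (EuclideanSpace ℝ ι)).toSphere).map
      (fun x : Metric.sphere (0 : EuclideanSpace ℝ ι) 1 => Real.sqrt ω • (x : EuclideanSpace ℝ ι))

/-- The clockwise rotation `R^{ij}_θ` of angle `θ` in the plane `(η i, η j)`, with the convention
that `R^{ii}_θ` is the identity. -/
def rot {ι : Type} [DecidableEq ι] (i j : ι) (θ : ℝ) (η : EuclideanSpace ℝ ι) :
    EuclideanSpace ℝ ι :=
  WithLp.toLp 2 fun k =>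
    if i = j then η k
    else if k = i then Real.cos θ * η i + Real.sin θ * η j
    else if k = j then -Real.sin θ * η i + Real.cos θ * η j
    else η k

/-- `ρ` is a probability density on the circle, parametrised by `(-π, π]`. -/
structure IsCircleDensity (ρ : ℝ → ℝ) : Prop where
  intervalIntegrable : IntervalIntegrable ρ volume (-Real.pi) Real.pi
  nonneg : ∀ᵐ θ ∂(volume.restrict (Set.Ioc (-Real.pi) Real.pi)), 0 ≤ ρ θ
  integral_eq_one : ∫ θ in (-Real.pi)..Real.pi, ρ θ = 1

section Generators

variable {ι : Type} [DecidableEq ι]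

/-- The simple average collision operator
`D_{i,j} f (η) = (1 / 2π) ∫_{-π}^{π} (f (R^{ij}_θ η) - f η) dθ`. -/
def avgCollision (i j : ι) (f : EuclideanSpace ℝ ι → ℝ) (η : EuclideanSpace ℝ ι) : ℝ :=
  1 / (2 * Real.pi) * ∫ θ in (-Real.pi)..Real.pi, (f (rot i j θ η) - f η)

/-- The collision operator `∫_{-π}^{π} (f (R^{ij}_θ η) - f η) ρ(θ) dθ`. -/
def collision (ρ : ℝ → ℝ) (i j : ι) (f : EuclideanSpace ℝ ι → ℝ) (η : EuclideanSpace ℝ ι) : ℝ :=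
  ∫ θ in (-Real.pi)..Real.pi, (f (rot i j θ η) - f η) * ρ θ

end Generators

/-- The generator `L^*` of the Kac walk with `N` particles. -/
def genStar (N : ℕ) (f : EuclideanSpace ℝ (Fin N) → ℝ) (η : EuclideanSpace ℝ (Fin N)) : ℝ :=
  1 / (2 * (N : ℝ)) * ∑ i, ∑ j, avgCollision i j f η

/-- The generator `L` of the generalized Kac walk with `N` particles and rotation density `ρ`. -/
def gen (ρ : ℝ → ℝ) (N : ℕ) (f : EuclideanSpace ℝ (Fin N) → ℝ)
    (η : EuclideanSpace ℝ (Fin N)) : ℝ :=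
  1 / (2 * (N : ℝ)) * ∑ i, ∑ j, collision ρ i j f η

/-- The `d`-dimensional cube of linear size `N`. -/
abbrev Cube (d N : ℕ) : Type := Fin d → Fin N

/-- The distance `∑ k, |x k - y k|` on the cube. -/
def cubeDist {d N : ℕ} (x y : Cube d N) : ℤ := ∑ k, |((x k : ℕ) : ℤ) - ((y k : ℕ) : ℤ)|

/-- The generator `L^{*,loc}` of the local Kac walk on the cube. -/
def genStarLoc (d N : ℕ) (f : EuclideanSpace ℝ (Cube d N) → ℝ)
    (η : EuclideanSpace ℝ (Cube d N)) : ℝ :=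
  1 / 2 * ∑ x : Cube d N, ∑ y : Cube d N with cubeDist x y = 1, avgCollision x y f η

/-- The generator `L^{loc}` of the local generalized Kac walk on the cube. -/
def genLoc (ρ : ℝ → ℝ) (d N : ℕ) (f : EuclideanSpace ℝ (Cube d N) → ℝ)
    (η : EuclideanSpace ℝ (Cube d N)) : ℝ :=
  1 / 2 * ∑ x : Cube d N, ∑ y : Cube d N with cubeDist x y = 1, collision ρ x y f η

/-- The spectral gap of `-A` in `L²(ν)`: the infimum of `ν(f (-A) f) / ν(f²)` over all
`f ∈ L²(ν)` with `ν(f) = 0` and `f` not almost everywhere zero. -/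
def spectralGap {E : Type} [MeasurableSpace E] (ν : Measure E) (A : (E → ℝ) → E → ℝ) : ℝ :=
  sInf {r : ℝ | ∃ f : E → ℝ, MemLp f 2 ν ∧ ∫ η, f η ∂ν = 0 ∧ ∫ η, f η ^ 2 ∂ν ≠ 0 ∧
    r = (∫ η, f η * (-A f η) ∂ν) / ∫ η, f η ^ 2 ∂ν}

/-- `λ^*(N) = inf_{ω > 0} λ^*(N, ω)`. -/
def gapStar (N : ℕ) : ℝ :=
  ⨅ ω : Set.Ioi (0 : ℝ), spectralGap (sphereMeasure (Fin N) ω) (genStar N)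

/-- `λ(N) = inf_{ω > 0} λ(N, ω)`. -/
def gap (ρ : ℝ → ℝ) (N : ℕ) : ℝ :=
  ⨅ ω : Set.Ioi (0 : ℝ), spectralGap (sphereMeasure (Fin N) ω) (gen ρ N)

/-- `λ^{*,loc}(N) = inf_{ω > 0} λ^{*,loc}(N, ω)` on the `d`-dimensional cube. -/
def gapStarLoc (d N : ℕ) : ℝ :=
  ⨅ ω : Set.Ioi (0 : ℝ), spectralGap (sphereMeasure (Cube d N) ω) (genStarLoc d N)

/-- `λ^{loc}(N) = inf_{ω > 0} λ^{loc}(N, ω)` on the `d`-dimensional cube. -/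
def gapLoc (ρ : ℝ → ℝ) (d N : ℕ) : ℝ :=
  ⨅ ω : Set.Ioi (0 : ℝ), spectralGap (sphereMeasure (Cube d N) ω) (genLoc ρ d N)

end KacWalk

end

noncomputable section

namespace KacWalk

open MeasureTheory Real

/-! The proof has three ingredients: a plane-by-plane comparison of `ρ` with the uniform density, a
spectral gap for the uniform walk, and a path argument for the local walk.

Comparison. Rotations preserve the sphere measure, so the quadratic form of the generator is a sum
over pairs of mean square increments of `f` under the rotations, averaged over `ρ`; no symmetry of
`ρ` is needed. Along an orbit of the circle action, `f` becomes a function of one angle, and its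
increments are those of the two-particle problem. There the uniform form is a multiple of the
variance, so λ(2) bounds the form of `ρ` below by 2λ(2) times the uniform one (`circle_gap`,
`IsCircleFlow.energy_comparison`). Summing over any set of pairs gives both comparison inequalities.

Uniform walk. Let P_ij be the average over rotations in the plane (i, j), an orthogonal projection,
D_ij = 1 - P_ij and T = ∑ D_ij over ordered pairs. The kernel of T consists of the constants, so a
gap c follows from T² ≥ cT. In T², disjoint pairs commute and contribute nonnegatively, while pairs
sharing an index are grouped into triangles (`pair_sum_lower_bound`). What remains is a
three-particle bound: the nonzero eigenvalues of D_ij + D_jk + D_ik are at least 5/4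
(`triple_eigenvalue`). With the other coordinates frozen, an eigenfunction with eigenvalue μ ≠ 3 is
a sum of three functions of one coordinate each. Its equation then reduces to the Kac operator g ↦
E[g(η₂) | η₁ = t] on a two-dimensional sphere, whose eigenvalues are 0 and (-1)^m E[cos^{2m}], that
is 1, -1/2, 3/8, … (`kac_eigenvalue`). All this takes place in finite-dimensional rotation-invariant
spaces of polynomials, and `kac_gap` passes to L² by density.

Local walk. Quarter turns carry a particle along a lattice path, so a rotation in a distant plane is
a conjugate of rotations between neighbours (`sphereRot_conj`). The triangle inequality,
Cauchy–Schwarz and a count of paths compare the sum over all pairs with the sum over edges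
(`sum_pairEnergy_le`). -/

/-- The measure `ρ(θ) dθ` on `(-π, π]`. -/
def angleMeasure (ρ : ℝ → ℝ) : Measure ℝ :=
  (volume.restrict (Set.Ioc (-π) π)).withDensity fun θ => ENNReal.ofReal (ρ θ)

/-- The uniform density on the circle. -/
def uniformDensity : ℝ → ℝ := fun _ => 1 / (2 * π)

lemma isCircleDensity_uniform : IsCircleDensity uniformDensity where
  intervalIntegrable := intervalIntegrable_const
  nonneg := Filter.Eventually.of_forall fun _ => by simp only [uniformDensity]; positivity
  integral_eq_one := by
    have := pi_pos
    simp only [uniformDensity, intervalIntegral.integral_const, smul_eq_mul]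
    field_simp
    ring

/-! ### Circle densities as probability measures on angles -/

section angleMeasure

variable {ρ : ℝ → ℝ} (hρ : IsCircleDensity ρ)

lemma neg_pi_le_pi : -π ≤ π := by linarith [pi_pos]

include hρ

lemma IsCircleDensity.integrable : Integrable ρ (volume.restrict (Set.Ioc (-π) π)) :=
  (intervalIntegrable_iff_integrableOn_Ioc_of_le neg_pi_le_pi).1 hρ.intervalIntegrable

lemma integral_angleMeasure (g : ℝ → ℝ) :
    ∫ θ, g θ ∂(angleMeasure ρ) = ∫ θ in (-π)..π, g θ * ρ θ := by
  rw [angleMeasure, integral_withDensity_eq_integral_toReal_smul₀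
    hρ.integrable.aemeasurable.ennreal_ofReal (by simp),
    intervalIntegral.integral_of_le neg_pi_le_pi]
  refine integral_congr_ae ?_
  filter_upwards [hρ.nonneg] with θ hθ
  simp [ENNReal.toReal_ofReal hθ, mul_comm]

lemma isProbabilityMeasure_angleMeasure : IsProbabilityMeasure (angleMeasure ρ) := by
  refine ⟨?_⟩
  rw [angleMeasure, withDensity_apply _ MeasurableSet.univ, setLIntegral_univ,
    ← ofReal_integral_eq_lintegral_ofReal hρ.integrable hρ.nonneg,
    ← intervalIntegral.integral_of_le neg_pi_le_pi, hρ.integral_eq_one, ENNReal.ofReal_one]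

end angleMeasure

lemma integral_angleMeasure_uniform (g : ℝ → ℝ) :
    ∫ θ, g θ ∂(angleMeasure uniformDensity) = 1 / (2 * π) * ∫ θ in (-π)..π, g θ := by
  rw [integral_angleMeasure isCircleDensity_uniform]
  simp [uniformDensity, mul_comm]

instance : IsProbabilityMeasure (angleMeasure uniformDensity) :=
  isProbabilityMeasure_angleMeasure isCircleDensity_uniform

lemma integrable_angleMeasure_uniform {g : ℝ → ℝ} :
    Integrable g (angleMeasure uniformDensity) ↔ IntervalIntegrable g volume (-π) π := by
  have : (0 : ℝ) < 1 / (2 * π) := by positivity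
  rw [intervalIntegrable_iff_integrableOn_Ioc_of_le neg_pi_le_pi, angleMeasure]
  simp only [uniformDensity, withDensity_const]
  rw [integrable_smul_measure (by simpa using this) (by simp), IntegrableOn]

lemma integral_uniform_add_of_periodic {g : ℝ → ℝ} (hg : Function.Periodic g (2 * π)) (a : ℝ) :
    ∫ θ, g (θ + a) ∂(angleMeasure uniformDensity) = ∫ θ, g θ ∂(angleMeasure uniformDensity) := by
  rw [integral_angleMeasure_uniform, integral_angleMeasure_uniform,
    intervalIntegral.integral_comp_add_right]
  have := hg.intervalIntegral_add_eq (-π + a) (-π)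
  rw [show -π + a + 2 * π = π + a by ring, show -π + 2 * π = π by ring] at this
  rw [this]

lemma integral_uniform_neg (g : ℝ → ℝ) :
    ∫ θ, g (-θ) ∂(angleMeasure uniformDensity) = ∫ θ, g θ ∂(angleMeasure uniformDensity) := by
  rw [integral_angleMeasure_uniform, integral_angleMeasure_uniform,
    intervalIntegral.integral_comp_neg, neg_neg]

/-! ### Measure-preserving circle actions and their Dirichlet forms -/

section Flow

variable {X : Type*} [MeasurableSpace X]

/-- A jointly measurable action of the circle `ℝ / 2πℤ` preserving the measure `ν`. -/
structure IsCircleFlow (T : ℝ → X → X) (ν : Measure X) : Prop where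
  measurable : Measurable fun p : ℝ × X => T p.1 p.2
  mp : ∀ θ, MeasurePreserving (T θ) ν ν
  add : ∀ a b x, T (a + b) x = T a (T b x)
  zero : ∀ x, T 0 x = x
  periodic : ∀ a x, T (a + 2 * π) x = T a x

/-- The mean square increment of `f` under the map `A`. -/
def sqIncr (ν : Measure X) (A : X → X) (f : X → ℝ) : ℝ := ∫ x, (f (A x) - f x) ^ 2 ∂ν

/-- The Dirichlet form of the jump process that follows the flow `T` for a time distributed
according to `m`. -/
def energy (ν : Measure X) (T : ℝ → X → X) (m : Measure ℝ) (f : X → ℝ) : ℝ :=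
  1 / 2 * ∫ θ, sqIncr ν (T θ) f ∂m

variable {ν : Measure X}

lemma sqIncr_nonneg (A : X → X) (f : X → ℝ) : 0 ≤ sqIncr ν A f :=
  integral_nonneg fun _ => sq_nonneg _

lemma energy_nonneg (T : ℝ → X → X) (m : Measure ℝ) (f : X → ℝ) : 0 ≤ energy ν T m f :=
  mul_nonneg (by norm_num) (integral_nonneg fun _ => sqIncr_nonneg _ _)

lemma sqIncr_congr {A : X → X} (hA : MeasurePreserving A ν ν) {f g : X → ℝ} (h : f =ᵐ[ν] g) :
    sqIncr ν A f = sqIncr ν A g := by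
  refine integral_congr_ae ?_
  filter_upwards [h, hA.quasiMeasurePreserving.ae_eq_comp h] with x hx hx'
  simp only [Function.comp] at hx'
  rw [hx, hx']

lemma sqIncr_le {A : X → X} (hA : MeasurePreserving A ν ν) {f : X → ℝ} (hf : MemLp f 2 ν) :
    sqIncr ν A f ≤ 4 * ∫ x, f x ^ 2 ∂ν := by
  have h1 := hf.integrable_sq
  have h2 := (hf.comp_measurePreserving hA).integrable_sq
  simp only [Function.comp] at h2
  have e : ∫ x, f (A x) ^ 2 ∂ν = ∫ x, f x ^ 2 ∂ν := by
    have := integral_map (μ := ν) hA.measurable.aemeasurable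
      (f := fun y => f y ^ 2) (by rw [hA.map_eq]; exact h1.aestronglyMeasurable)
    rw [hA.map_eq] at this
    exact this.symm
  calc sqIncr ν A f ≤ ∫ x, (2 * f (A x) ^ 2 + 2 * f x ^ 2) ∂ν := by
        refine integral_mono_of_nonneg (Filter.Eventually.of_forall fun _ => sq_nonneg _)
          ((h2.const_mul 2).add (h1.const_mul 2)) (Filter.Eventually.of_forall fun x => ?_)
        show (f (A x) - f x) ^ 2 ≤ _
        nlinarith [sq_nonneg (f (A x) + f x)]
    _ = _ := by
        rw [integral_add (h2.const_mul 2) (h1.const_mul 2), integral_const_mul,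
          integral_const_mul, e]
        ring

lemma integrable_sqIncr_fun {A : X → X} (hA : MeasurePreserving A ν ν) {f : X → ℝ}
    (hf : MemLp f 2 ν) : Integrable (fun x => (f (A x) - f x) ^ 2) ν :=
  ((hf.comp_measurePreserving hA).sub hf).integrable_sq

lemma integral_comp_mp {A : X → X} (hA : MeasurePreserving A ν ν) {f : X → ℝ}
    (hf : AEStronglyMeasurable f ν) : ∫ x, f (A x) ∂ν = ∫ x, f x ∂ν := by
  have := integral_map (μ := ν) hA.measurable.aemeasurable
    (f := f) (by rwa [hA.map_eq])
  rw [hA.map_eq] at this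
  exact this.symm

/-- Since `A` preserves `ν`, `f ∘ A` and `f` have the same norm; expanding the square leaves the
cross term. Reversibility of `A` plays no role, so `ρ` need not be even. -/
lemma sqIncr_eq {A : X → X} (hA : MeasurePreserving A ν ν) {f : X → ℝ} (hf : MemLp f 2 ν) :
    sqIncr ν A f = 2 * ∫ x, f x * (f x - f (A x)) ∂ν := by
  have h1 := hf.integrable_sq
  have hA' := hf.comp_measurePreserving hA
  have h2 := hA'.integrable_sq
  have h3 : Integrable (fun x => f x * f (A x)) ν := MemLp.integrable_mul hf hA'
  simp only [Function.comp] at h2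
  have e := integral_comp_mp hA h1.aestronglyMeasurable
  have : ∀ x, (f (A x) - f x) ^ 2 = f (A x) ^ 2 + f x ^ 2 - 2 * (f x * f (A x)) := fun x => by ring
  simp only [sqIncr, this]
  have h4 : ∀ x, f x * (f x - f (A x)) = f x ^ 2 - f x * f (A x) := fun x => by ring
  simp only [h4]
  have h5 := integral_sub (h2.add h1) (h3.const_mul 2)
  simp only [Pi.add_apply] at h5
  rw [h5, integral_add h2 h1, integral_sub h1 h3, e, integral_const_mul]
  ring

variable {T : ℝ → X → X} (hT : IsCircleFlow T ν) [SFinite ν]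

include hT

lemma IsCircleFlow.mp_prod (m : Measure ℝ) [SFinite m] :
    MeasurePreserving (fun p : ℝ × X => (p.1, T p.1 p.2)) (m.prod ν) (m.prod ν) :=
  (MeasurePreserving.id m).skew_product hT.measurable
    (Filter.Eventually.of_forall fun θ => (hT.mp θ).map_eq)

lemma IsCircleFlow.integrable_mul (m : Measure ℝ) [IsFiniteMeasure m] {f : X → ℝ}
    (hf : MemLp f 2 ν) :
    Integrable (fun p : ℝ × X => f p.2 * (f p.2 - f (T p.1 p.2))) (m.prod ν) := by
  have h1 : MemLp (fun p : ℝ × X => f p.2) 2 (m.prod ν) := hf.comp_snd m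
  have h2 := h1.comp_measurePreserving (hT.mp_prod m)
  exact h1.integrable_mul (h1.sub h2)

lemma IsCircleFlow.integrable_sq (m : Measure ℝ) [IsFiniteMeasure m] {f : X → ℝ}
    (hf : MemLp f 2 ν) :
    Integrable (fun p : ℝ × X => (f (T p.1 p.2) - f p.2) ^ 2) (m.prod ν) := by
  have h1 : MemLp (fun p : ℝ × X => f p.2) 2 (m.prod ν) := hf.comp_snd m
  have h2 := h1.comp_measurePreserving (hT.mp_prod m)
  exact (h2.sub h1).integrable_sq

lemma IsCircleFlow.integrable_sqIncr (m : Measure ℝ) [IsFiniteMeasure m] {f : X → ℝ}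
    (hf : MemLp f 2 ν) : Integrable (fun θ => sqIncr ν (T θ) f) m :=
  (hT.integrable_sq m hf).integral_prod_left

lemma IsCircleFlow.integrable_mul_integral (m : Measure ℝ) [IsFiniteMeasure m] {f : X → ℝ}
    (hf : MemLp f 2 ν) : Integrable (fun x => f x * -∫ θ, (f (T θ x) - f x) ∂m) ν := by
  refine ((hT.integrable_mul m hf).integral_prod_right).congr
    (Filter.Eventually.of_forall fun x => ?_)
  simp only
  rw [integral_const_mul, ← integral_neg]
  simp

/-- Fubini, then `sqIncr_eq` at each angle. -/
lemma IsCircleFlow.integral_mul_eq_energy (m : Measure ℝ) [IsFiniteMeasure m] {f : X → ℝ}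
    (hf : MemLp f 2 ν) :
    ∫ x, f x * -∫ θ, (f (T θ x) - f x) ∂m ∂ν = energy ν T m f := by
  have h : ∀ x, f x * -∫ θ, (f (T θ x) - f x) ∂m = ∫ θ, f x * (f x - f (T θ x)) ∂m := fun x => by
    rw [integral_const_mul, ← integral_neg]
    simp
  simp only [h]
  rw [integral_integral_swap (by exact (hT.integrable_mul m hf).swap), energy,
    ← integral_const_mul]
  refine integral_congr_ae (Filter.Eventually.of_forall fun θ => ?_)
  simp only
  rw [sqIncr_eq (hT.mp θ) hf]
  ring

omit [SFinite ν] in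
lemma IsCircleFlow.sqIncr_neg {f : X → ℝ} (hf : MemLp f 2 ν) (θ : ℝ) :
    sqIncr ν (T (-θ)) f = sqIncr ν (T θ) f := by
  have := integral_comp_mp (hT.mp θ) (f := fun x => (f (T (-θ) x) - f x) ^ 2)
    (integrable_sqIncr_fun (hT.mp _) hf).aestronglyMeasurable
  rw [sqIncr, ← this, sqIncr]
  refine integral_congr_ae (Filter.Eventually.of_forall fun x => ?_)
  simp only
  rw [← hT.add, neg_add_cancel, hT.zero]
  ring

end Flow

/-! ### The uniform measure on the sphere and its isometry invariance -/

section Sphere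

variable {ι : Type} [Fintype ι]

/-- The unit sphere of `ℝ^ι`. -/
abbrev USphere (ι : Type) [Fintype ι] : Type := Metric.sphere (0 : EuclideanSpace ℝ ι) 1

/-- The uniform probability measure on the unit sphere. -/
def unitSphereMeasure (ι : Type) [Fintype ι] : Measure (USphere ι) :=
  ((volume : Measure (EuclideanSpace ℝ ι)).toSphere Set.univ)⁻¹ •
    (volume : Measure (EuclideanSpace ℝ ι)).toSphere

lemma sphereMeasure_eq_map (ω : ℝ) : sphereMeasure ι ω =
    (unitSphereMeasure ι).map fun x : USphere ι => √ω • (x : EuclideanSpace ℝ ι) := rfl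

instance [Nonempty ι] : IsProbabilityMeasure (unitSphereMeasure ι) := by
  have : NeZero (volume : Measure (EuclideanSpace ℝ ι)).toSphere :=
    ⟨Measure.toSphere_ne_zero _⟩
  exact isProbabilityMeasureSMul

instance [Nonempty ι] : (unitSphereMeasure ι).IsOpenPosMeasure :=
  ⟨fun U hU hne => by
    simp only [unitSphereMeasure, Measure.smul_apply, smul_eq_mul]
    exact mul_ne_zero (ENNReal.inv_ne_zero.2 (measure_ne_top _ _)) (hU.measure_pos _ hne).ne'⟩

lemma continuous_dilation (ω : ℝ) :
    Continuous fun x : USphere ι => √ω • (x : EuclideanSpace ℝ ι) := by fun_prop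

instance [Nonempty ι] (ω : ℝ) : IsProbabilityMeasure (sphereMeasure ι ω) :=
  Measure.isProbabilityMeasure_map (μ := unitSphereMeasure ι)
    (continuous_dilation ω).measurable.aemeasurable

/-- The action of linear isometries on the unit sphere. -/
def isometryOnSphere (A : EuclideanSpace ℝ ι ≃ₗᵢ[ℝ] EuclideanSpace ℝ ι) (x : USphere ι) :
    USphere ι :=
  ⟨A x, by simp⟩

lemma continuous_isometryOnSphere (A : EuclideanSpace ℝ ι ≃ₗᵢ[ℝ] EuclideanSpace ℝ ι) :
    Continuous (isometryOnSphere A) :=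
  (A.continuous.comp continuous_subtype_val).subtype_mk _

-- The surface measure of a set is, up to a constant, the volume of the cone over it. The cone over
-- a preimage is the preimage of the cone, and `A` preserves volume.
open scoped Pointwise in
lemma measurePreserving_isometryOnSphere (A : EuclideanSpace ℝ ι ≃ₗᵢ[ℝ] EuclideanSpace ℝ ι) :
    MeasurePreserving (isometryOnSphere A) (unitSphereMeasure ι) (unitSphereMeasure ι) := by
  refine ⟨(continuous_isometryOnSphere A).measurable, ?_⟩
  ext s hs
  rw [Measure.map_apply (continuous_isometryOnSphere A).measurable hs]
  simp only [unitSphereMeasure, Measure.smul_apply]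
  congr 1
  rw [Measure.toSphere_apply' _ hs, Measure.toSphere_apply' _
    ((continuous_isometryOnSphere A).measurable hs)]
  congr 1
  have hA : MeasurePreserving A.toMeasurableEquiv volume volume := A.measurePreserving
  rw [← hA.measure_preimage_equiv (Set.Ioo (0 : ℝ) 1 • (Subtype.val '' s))]
  congr 1
  ext x
  simp only [Set.mem_smul, Set.mem_image, Set.mem_preimage]
  constructor
  · rintro ⟨r, hr, _, ⟨u, hu, rfl⟩, rfl⟩
    exact ⟨r, hr, A u, ⟨_, hu, rfl⟩, (A.map_smul r (u : EuclideanSpace ℝ ι)).symm⟩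
  · rintro ⟨r, hr, _, ⟨u, hu, rfl⟩, h⟩
    have hu' : isometryOnSphere A (isometryOnSphere A.symm u) = u :=
      Subtype.ext (by simp [isometryOnSphere])
    refine ⟨r, hr, A.symm u, ⟨isometryOnSphere A.symm u, ?_, rfl⟩, ?_⟩
    · rwa [hu']
    · rw [← map_smul]
      exact (congrArg A.symm h).trans (A.symm_apply_apply x)

lemma measurePreserving_sphereMeasure (A : EuclideanSpace ℝ ι ≃ₗᵢ[ℝ] EuclideanSpace ℝ ι) (ω : ℝ) :
    MeasurePreserving A (sphereMeasure ι ω) (sphereMeasure ι ω) := by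
  refine ⟨A.continuous.measurable, ?_⟩
  rw [sphereMeasure_eq_map, Measure.map_map A.continuous.measurable
    (continuous_dilation ω).measurable]
  conv_rhs => rw [← (measurePreserving_isometryOnSphere A).map_eq,
    Measure.map_map (continuous_dilation ω).measurable (continuous_isometryOnSphere A).measurable]
  congr 1
  ext1 x
  simp [isometryOnSphere]

end Sphere

/-! ### Planar rotations and reduction to the unit sphere -/

section Rot

variable {ι : Type} [DecidableEq ι]

lemma rot_apply (i j : ι) (θ : ℝ) (η : EuclideanSpace ℝ ι) (k : ι) : rot i j θ η k =
    if i = j then η k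
    else if k = i then cos θ * η i + sin θ * η j
    else if k = j then -sin θ * η i + cos θ * η j
    else η k := rfl

@[simp] lemma rot_self (i : ι) (θ : ℝ) (η : EuclideanSpace ℝ ι) : rot i i θ η = η := by
  ext k; simp [rot_apply]

lemma rot_apply_left {i j : ι} (h : i ≠ j) (θ : ℝ) (η : EuclideanSpace ℝ ι) :
    rot i j θ η i = cos θ * η i + sin θ * η j := by
  simp [rot_apply, h]

lemma rot_apply_right {i j : ι} (h : i ≠ j) (θ : ℝ) (η : EuclideanSpace ℝ ι) :
    rot i j θ η j = -sin θ * η i + cos θ * η j := by simp [rot_apply, h, h.symm]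

lemma rot_apply_of_ne {i j k : ι} (hi : k ≠ i) (hj : k ≠ j) (θ : ℝ) (η : EuclideanSpace ℝ ι) :
    rot i j θ η k = η k := by simp [rot_apply, hi, hj]

lemma rot_add (i j : ι) (a b : ℝ) (η : EuclideanSpace ℝ ι) :
    rot i j (a + b) η = rot i j a (rot i j b η) := by
  ext k
  by_cases h : i = j
  · simp [h]
  have h' : ¬ j = i := fun e => h e.symm
  simp only [rot_apply, h, h', if_false, if_true, cos_add, sin_add]
  split_ifs <;> ring

@[simp] lemma rot_zero (i j : ι) (η : EuclideanSpace ℝ ι) : rot i j 0 η = η := by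
  ext k
  simp only [rot_apply, cos_zero, sin_zero]
  split_ifs with h1 h2 h3 <;> simp_all

lemma rot_add_two_pi (i j : ι) (θ : ℝ) (η : EuclideanSpace ℝ ι) :
    rot i j (θ + 2 * π) η = rot i j θ η := by
  ext k
  simp only [rot_apply, cos_add_two_pi, sin_add_two_pi]

lemma rot_swap (i j : ι) (θ : ℝ) (η : EuclideanSpace ℝ ι) : rot j i θ η = rot i j (-θ) η := by
  ext k
  simp only [rot_apply, cos_neg, sin_neg]
  split_ifs with h1 h2 h3 <;> first | rfl | (subst_vars; simp_all; done) | (subst_vars; simp_all; ring)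

variable [Fintype ι]

lemma norm_rot (i j : ι) (θ : ℝ) (η : EuclideanSpace ℝ ι) : ‖rot i j θ η‖ = ‖η‖ := by
  by_cases h : i = j
  · subst h; simp
  rw [← sq_eq_sq₀ (norm_nonneg _) (norm_nonneg _), EuclideanSpace.norm_sq_eq,
    EuclideanSpace.norm_sq_eq]
  have hj : j ∈ Finset.univ.erase i := Finset.mem_erase.2 ⟨fun e => h e.symm, Finset.mem_univ j⟩
  rw [← Finset.add_sum_erase _ _ (Finset.mem_univ i), ← Finset.add_sum_erase _ _ hj,
    ← Finset.add_sum_erase _ (fun k => ‖η k‖ ^ 2) (Finset.mem_univ i),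
    ← Finset.add_sum_erase _ (fun k => ‖η k‖ ^ 2) hj]
  have : ∑ k ∈ (Finset.univ.erase i).erase j, ‖rot i j θ η k‖ ^ 2 =
      ∑ k ∈ (Finset.univ.erase i).erase j, ‖η k‖ ^ 2 := by
    refine Finset.sum_congr rfl fun k hk => ?_
    simp only [Finset.mem_erase] at hk
    rw [rot_apply_of_ne hk.2.1 hk.1]
  rw [this, rot_apply_left h, rot_apply_right h]
  simp only [Real.norm_eq_abs, sq_abs]
  linear_combination (η i ^ 2 + η j ^ 2) * sin_sq_add_cos_sq θ

/-- The rotation `R^{ij}_θ` as a linear isometry. -/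
def rotIsometry (i j : ι) (θ : ℝ) : EuclideanSpace ℝ ι ≃ₗᵢ[ℝ] EuclideanSpace ℝ ι where
  toFun := rot i j θ
  invFun := rot i j (-θ)
  left_inv η := by rw [← rot_add]; simp
  right_inv η := by rw [← rot_add]; simp
  map_add' x y := by
    ext k
    simp only [rot_apply, PiLp.add_apply]
    split_ifs <;> ring
  map_smul' c x := by
    ext k
    simp only [rot_apply, PiLp.smul_apply, smul_eq_mul, RingHom.id_apply]
    split_ifs <;> ring
  norm_map' := norm_rot i j θ

lemma rot_smul (i j : ι) (θ : ℝ) (c : ℝ) (η : EuclideanSpace ℝ ι) :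
    rot i j θ (c • η) = c • rot i j θ η := (rotIsometry i j θ).map_smul c η

omit [Fintype ι] in
lemma continuous_rot (i j : ι) :
    Continuous fun p : ℝ × EuclideanSpace ℝ ι => rot i j p.1 p.2 := by
  refine (PiLp.continuous_toLp 2 _).comp (continuous_pi fun k => ?_)
  by_cases h : i = j
  · simp only [h, if_true]; fun_prop
  by_cases h1 : k = i
  · simp only [h, h1, if_false, if_true]; fun_prop
  by_cases h2 : k = j
  · simp only [h, h2, if_false, if_true, h2 ▸ h1]; fun_prop
  · simp only [h, h1, h2, if_false]; fun_prop

/-- The rotation `R^{ij}_θ` of the unit sphere. -/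
def sphereRot (i j : ι) (θ : ℝ) : USphere ι → USphere ι := isometryOnSphere (rotIsometry i j θ)

@[simp] lemma coe_sphereRot (i j : ι) (θ : ℝ) (u : USphere ι) :
    (sphereRot i j θ u : EuclideanSpace ℝ ι) = rot i j θ u := rfl

lemma continuous_sphereRot (i j : ι) :
    Continuous fun p : ℝ × USphere ι => sphereRot i j p.1 p.2 := by
  have h : Continuous fun p : ℝ × USphere ι => (p.1, (p.2 : EuclideanSpace ℝ ι)) := by fun_prop
  have h := (continuous_rot i j).comp h
  rw [Topology.IsInducing.subtypeVal.continuous_iff]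
  simpa only [Function.comp_def, coe_sphereRot] using h

lemma isCircleFlow_sphereRot (i j : ι) :
    IsCircleFlow (sphereRot i j) (unitSphereMeasure ι) where
  measurable := (continuous_sphereRot i j).measurable
  mp _ := measurePreserving_isometryOnSphere _
  add a b x := Subtype.ext (rot_add i j a b x)
  zero x := Subtype.ext (rot_zero i j x)
  periodic a x := Subtype.ext (rot_add_two_pi i j a x)

lemma isCircleFlow_rot (i j : ι) (ω : ℝ) : IsCircleFlow (rot i j) (sphereMeasure ι ω) where
  measurable := (continuous_rot i j).measurable
  mp θ := measurePreserving_sphereMeasure (rotIsometry i j θ) ω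
  add := rot_add i j
  zero := rot_zero i j
  periodic := rot_add_two_pi i j

lemma sphereRot_swap (i j : ι) (θ : ℝ) (u : USphere ι) :
    sphereRot j i θ u = sphereRot i j (-θ) u := Subtype.ext (rot_swap i j θ u)

@[simp] lemma sphereRot_self (i : ι) (θ : ℝ) (u : USphere ι) : sphereRot i i θ u = u :=
  Subtype.ext (rot_self i θ u)

/-- The pull-back to the unit sphere of a function on the sphere of radius `√ω`. -/
def toUnit (ω : ℝ) (f : EuclideanSpace ℝ ι → ℝ) (u : USphere ι) : ℝ :=
  f (√ω • (u : EuclideanSpace ℝ ι))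

omit [DecidableEq ι] in
lemma measurePreserving_dilation (ω : ℝ) :
    MeasurePreserving (fun x : USphere ι => √ω • (x : EuclideanSpace ℝ ι))
      (unitSphereMeasure ι) (sphereMeasure ι ω) :=
  ⟨(continuous_dilation ω).measurable, rfl⟩

omit [DecidableEq ι] in
lemma memLp_toUnit {ω : ℝ} {f : EuclideanSpace ℝ ι → ℝ} (hf : MemLp f 2 (sphereMeasure ι ω)) :
    MemLp (toUnit ω f) 2 (unitSphereMeasure ι) :=
  hf.comp_measurePreserving (measurePreserving_dilation ω)

omit [DecidableEq ι] in
lemma integral_sphereMeasure {ω : ℝ} {f : EuclideanSpace ℝ ι → ℝ}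
    (hf : AEStronglyMeasurable f (sphereMeasure ι ω)) :
    ∫ η, f η ∂(sphereMeasure ι ω) = ∫ u, toUnit ω f u ∂(unitSphereMeasure ι) :=
  integral_map (continuous_dilation ω).measurable.aemeasurable hf

lemma sqIncr_toUnit {ω : ℝ} {f : EuclideanSpace ℝ ι → ℝ} (hf : MemLp f 2 (sphereMeasure ι ω))
    (i j : ι) (θ : ℝ) : sqIncr (sphereMeasure ι ω) (rot i j θ) f =
      sqIncr (unitSphereMeasure ι) (sphereRot i j θ) (toUnit ω f) := by
  rw [sqIncr, integral_sphereMeasure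
    (integrable_sqIncr_fun ((isCircleFlow_rot i j ω).mp θ) hf).aestronglyMeasurable]
  simp [sqIncr, toUnit, rot_smul]

lemma energy_toUnit {ω : ℝ} {f : EuclideanSpace ℝ ι → ℝ} (hf : MemLp f 2 (sphereMeasure ι ω))
    (i j : ι) (m : Measure ℝ) : energy (sphereMeasure ι ω) (rot i j) m f =
      energy (unitSphereMeasure ι) (sphereRot i j) m (toUnit ω f) := by
  simp only [energy, sqIncr_toUnit hf]

/-- The Dirichlet form of the collision operator. -/
lemma integral_mul_neg_collision [Nonempty ι] {ρ : ℝ → ℝ} (hρ : IsCircleDensity ρ) (i j : ι) {ω : ℝ}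
    {f : EuclideanSpace ℝ ι → ℝ} (hf : MemLp f 2 (sphereMeasure ι ω)) :
    Integrable (fun η => f η * -collision ρ i j f η) (sphereMeasure ι ω) ∧
    ∫ η, f η * -collision ρ i j f η ∂(sphereMeasure ι ω) =
      energy (sphereMeasure ι ω) (rot i j) (angleMeasure ρ) f := by
  have := isProbabilityMeasure_angleMeasure hρ
  have := (isCircleFlow_rot i j ω).integral_mul_eq_energy (angleMeasure ρ) hf
  have h2 := (isCircleFlow_rot i j ω).integrable_mul_integral (angleMeasure ρ) hf
  simp only [integral_angleMeasure hρ] at this h2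
  exact ⟨h2, this⟩

end Rot

lemma avgCollision_eq {ι : Type} [DecidableEq ι] (i j : ι) :
    avgCollision i j = collision uniformDensity i j := by
  ext f η
  simp [avgCollision, collision, uniformDensity, mul_comm]

/-! ### The variational definition of the gap -/

section SpectralGap

variable {E : Type} [MeasurableSpace E] {ν : Measure E} {A : (E → ℝ) → E → ℝ}

/-- The hypothesis `hne` rules out the default value `sInf ∅ = 0`. -/
lemma le_spectralGap {C : ℝ}
    (hne : ∃ f : E → ℝ, MemLp f 2 ν ∧ ∫ η, f η ∂ν = 0 ∧ ∫ η, f η ^ 2 ∂ν ≠ 0)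
    (h : ∀ f : E → ℝ, MemLp f 2 ν → ∫ η, f η ∂ν = 0 →
      C * ∫ η, f η ^ 2 ∂ν ≤ ∫ η, f η * (-A f η) ∂ν) : C ≤ spectralGap ν A := by
  obtain ⟨f, h1, h2, h3⟩ := hne
  refine le_csInf ⟨_, f, h1, h2, h3, rfl⟩ ?_
  rintro r ⟨f, h1, h2, h3, rfl⟩
  have : 0 < ∫ η, f η ^ 2 ∂ν :=
    lt_of_le_of_ne (integral_nonneg fun _ => sq_nonneg _) (Ne.symm h3)
  rw [le_div_iff₀ this]
  exact h f h1 h2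

lemma spectralGap_nonneg (hpos : ∀ f : E → ℝ, MemLp f 2 ν → 0 ≤ ∫ η, f η * (-A f η) ∂ν) :
    0 ≤ spectralGap ν A := by
  refine Real.sInf_nonneg ?_
  rintro r ⟨f, h1, h2, h3, rfl⟩
  exact div_nonneg (hpos f h1) (integral_nonneg fun _ => sq_nonneg _)

lemma spectralGap_mul_le (hpos : ∀ f : E → ℝ, MemLp f 2 ν → 0 ≤ ∫ η, f η * (-A f η) ∂ν)
    {f : E → ℝ} (hf : MemLp f 2 ν) (h0 : ∫ η, f η ∂ν = 0) :
    spectralGap ν A * ∫ η, f η ^ 2 ∂ν ≤ ∫ η, f η * (-A f η) ∂ν := by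
  by_cases h : ∫ η, f η ^ 2 ∂ν = 0
  · rw [h, mul_zero]; exact hpos f hf
  have : 0 < ∫ η, f η ^ 2 ∂ν :=
    lt_of_le_of_ne (integral_nonneg fun _ => sq_nonneg _) (Ne.symm h)
  rw [← le_div_iff₀ this]
  refine csInf_le ⟨0, ?_⟩ ⟨f, hf, h0, h, rfl⟩
  rintro r ⟨f, h1, h2, h3, rfl⟩
  exact div_nonneg (hpos f h1) (integral_nonneg fun _ => sq_nonneg _)

end SpectralGap

/-! ### Dirichlet forms of the generators -/

section Generators

lemma genStar_eq (N : ℕ) : genStar N = gen uniformDensity N := by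
  ext f η
  simp only [genStar, gen, avgCollision_eq]

lemma genStarLoc_eq (d N : ℕ) : genStarLoc d N = genLoc uniformDensity d N := by
  ext f η
  simp only [genStarLoc, genLoc, avgCollision_eq]

lemma gapStar_eq (N : ℕ) : gapStar N = gap uniformDensity N := by
  simp only [gapStar, gap, genStar_eq]

lemma gapStarLoc_eq (d N : ℕ) : gapStarLoc d N = gapLoc uniformDensity d N := by
  simp only [gapStarLoc, gapLoc, genStarLoc_eq]

variable {ρ : ℝ → ℝ} (hρ : IsCircleDensity ρ)

include hρ

lemma integral_mul_neg_gen {N : ℕ} [NeZero N] {ω : ℝ} {f : EuclideanSpace ℝ (Fin N) → ℝ}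
    (hf : MemLp f 2 (sphereMeasure (Fin N) ω)) :
    ∫ η, f η * (-gen ρ N f η) ∂(sphereMeasure (Fin N) ω) =
      1 / (2 * (N : ℝ)) *
        ∑ i, ∑ j, energy (sphereMeasure (Fin N) ω) (rot i j) (angleMeasure ρ) f := by
  have h : ∀ η, f η * (-gen ρ N f η) =
      1 / (2 * (N : ℝ)) * ∑ i, ∑ j, f η * -collision ρ i j f η := fun η => by
    simp only [gen, ← Finset.mul_sum, Finset.sum_neg_distrib]
    ring
  simp only [h]
  rw [integral_const_mul, integral_finsetSum _ fun i _ => integrable_finsetSum _ fun j _ =>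
    (integral_mul_neg_collision hρ i j hf).1]
  congr 1
  refine Finset.sum_congr rfl fun i _ => ?_
  rw [integral_finsetSum _ fun j _ => (integral_mul_neg_collision hρ i j hf).1]
  exact Finset.sum_congr rfl fun j _ => (integral_mul_neg_collision hρ i j hf).2

lemma integral_mul_neg_genLoc {d N : ℕ} [NeZero N] {ω : ℝ} {f : EuclideanSpace ℝ (Cube d N) → ℝ}
    (hf : MemLp f 2 (sphereMeasure (Cube d N) ω)) :
    ∫ η, f η * (-genLoc ρ d N f η) ∂(sphereMeasure (Cube d N) ω) =
      1 / 2 * ∑ x : Cube d N, ∑ y : Cube d N with cubeDist x y = 1,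
        energy (sphereMeasure (Cube d N) ω) (rot x y) (angleMeasure ρ) f := by
  have h : ∀ η, f η * (-genLoc ρ d N f η) = 1 / 2 * ∑ x : Cube d N,
      ∑ y : Cube d N with cubeDist x y = 1, f η * -collision ρ x y f η := fun η => by
    simp only [genLoc, ← Finset.mul_sum, Finset.sum_neg_distrib]
    ring
  simp only [h]
  rw [integral_const_mul, integral_finsetSum _ fun i _ => integrable_finsetSum _ fun j _ =>
    (integral_mul_neg_collision hρ i j hf).1]
  congr 1
  refine Finset.sum_congr rfl fun i _ => ?_
  rw [integral_finsetSum _ fun j _ => (integral_mul_neg_collision hρ i j hf).1]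
  exact Finset.sum_congr rfl fun j _ => (integral_mul_neg_collision hρ i j hf).2

lemma gen_form_nonneg {N : ℕ} [NeZero N] {ω : ℝ} (f : EuclideanSpace ℝ (Fin N) → ℝ)
    (hf : MemLp f 2 (sphereMeasure (Fin N) ω)) :
    0 ≤ ∫ η, f η * (-gen ρ N f η) ∂(sphereMeasure (Fin N) ω) := by
  rw [integral_mul_neg_gen hρ hf]
  exact mul_nonneg (by positivity) (Finset.sum_nonneg fun _ _ => Finset.sum_nonneg fun _ _ =>
    energy_nonneg _ _ _)

lemma genLoc_form_nonneg {d N : ℕ} [NeZero N] {ω : ℝ} (f : EuclideanSpace ℝ (Cube d N) → ℝ)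
    (hf : MemLp f 2 (sphereMeasure (Cube d N) ω)) :
    0 ≤ ∫ η, f η * (-genLoc ρ d N f η) ∂(sphereMeasure (Cube d N) ω) := by
  rw [integral_mul_neg_genLoc hρ hf]
  exact mul_nonneg (by positivity) (Finset.sum_nonneg fun _ _ => Finset.sum_nonneg fun _ _ =>
    energy_nonneg _ _ _)

lemma gap_nonneg (N : ℕ) [NeZero N] : 0 ≤ gap ρ N :=
  Real.iInf_nonneg fun _ => spectralGap_nonneg (gen_form_nonneg hρ)

lemma gap_mul_le {N : ℕ} [NeZero N] {ω : ℝ} (hω : 0 < ω) {f : EuclideanSpace ℝ (Fin N) → ℝ}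
    (hf : MemLp f 2 (sphereMeasure (Fin N) ω)) (h0 : ∫ η, f η ∂(sphereMeasure (Fin N) ω) = 0) :
    gap ρ N * ∫ η, f η ^ 2 ∂(sphereMeasure (Fin N) ω) ≤
      ∫ η, f η * (-gen ρ N f η) ∂(sphereMeasure (Fin N) ω) := by
  refine le_trans (mul_le_mul_of_nonneg_right ?_ (integral_nonneg fun _ => sq_nonneg _))
    (spectralGap_mul_le (gen_form_nonneg hρ) hf h0)
  -- The infimum over `ω` is a genuine lower bound only because the family is bounded below, here by
  -- 0.
  refine ciInf_le (f := fun ω : Set.Ioi (0 : ℝ) =>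
    spectralGap (sphereMeasure (Fin N) ω) (gen ρ N)) ⟨0, ?_⟩ ⟨ω, hω⟩
  rintro _ ⟨ω, rfl⟩
  exact spectralGap_nonneg (gen_form_nonneg hρ)

lemma gapLoc_mul_le {d N : ℕ} [NeZero N] {ω : ℝ} (hω : 0 < ω)
    {f : EuclideanSpace ℝ (Cube d N) → ℝ} (hf : MemLp f 2 (sphereMeasure (Cube d N) ω))
    (h0 : ∫ η, f η ∂(sphereMeasure (Cube d N) ω) = 0) :
    gapLoc ρ d N * ∫ η, f η ^ 2 ∂(sphereMeasure (Cube d N) ω) ≤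
      ∫ η, f η * (-genLoc ρ d N f η) ∂(sphereMeasure (Cube d N) ω) := by
  refine le_trans (mul_le_mul_of_nonneg_right ?_ (integral_nonneg fun _ => sq_nonneg _))
    (spectralGap_mul_le (genLoc_form_nonneg hρ) hf h0)
  refine ciInf_le (f := fun ω : Set.Ioi (0 : ℝ) =>
    spectralGap (sphereMeasure (Cube d N) ω) (genLoc ρ d N)) ⟨0, ?_⟩ ⟨ω, hω⟩
  rintro _ ⟨ω, rfl⟩
  exact spectralGap_nonneg (genLoc_form_nonneg hρ)

end Generators

/-! ### The two-particle problem as a problem on the circle -/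

section Circle

/-- The point of the unit circle obtained from `(1, 0)` by the clockwise rotation of angle `φ`. -/
def circlePoint (φ : ℝ) : EuclideanSpace ℝ (Fin 2) := !₂[cos φ, -sin φ]

lemma rot_circlePoint (θ φ : ℝ) : rot 0 1 θ (circlePoint φ) = circlePoint (φ + θ) := by
  ext k
  fin_cases k
  · simp [rot_apply, circlePoint, cos_add]; ring
  · simp [rot_apply, circlePoint, sin_add]; ring

lemma continuous_circlePoint : Continuous circlePoint := by
  refine (PiLp.continuous_toLp 2 _).comp (continuous_pi fun k => ?_)
  fin_cases k <;> simp <;> fun_prop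

lemma exists_eq_circlePoint (u : USphere (Fin 2)) :
    ∃ α, (u : EuclideanSpace ℝ (Fin 2)) = circlePoint α := by
  have hu : ‖(u : EuclideanSpace ℝ (Fin 2))‖ = 1 := by simp
  have h : (u : EuclideanSpace ℝ (Fin 2)) 0 ^ 2 + (u : EuclideanSpace ℝ (Fin 2)) 1 ^ 2 = 1 := by
    have := EuclideanSpace.norm_sq_eq (u : EuclideanSpace ℝ (Fin 2))
    rw [hu] at this
    simpa using this.symm
  set z : ℂ := ⟨(u : EuclideanSpace ℝ (Fin 2)) 0, -(u : EuclideanSpace ℝ (Fin 2)) 1⟩ with hz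
  have hz1 : ‖z‖ = 1 := by
    rw [← sq_eq_sq₀ (norm_nonneg _) zero_le_one, ← Complex.normSq_eq_norm_sq, Complex.normSq_mk]
    linarith
  refine ⟨z.arg, ?_⟩
  have h1 := Complex.norm_mul_cos_arg z
  have h2 := Complex.norm_mul_sin_arg z
  rw [hz1, one_mul] at h1 h2
  ext k
  fin_cases k
  · simpa [circlePoint, hz] using h1.symm
  · simpa [circlePoint, hz, neg_eq_iff_eq_neg] using congrArg (- ·) h2.symm

/-- Rotation invariance determines the measure: averaging a test function over all rotations does
not change its integral, and on the circle the averaged function is constant. -/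
lemma sphereMeasure_fin_two :
    sphereMeasure (Fin 2) 1 = (angleMeasure uniformDensity).map circlePoint := by
  have : IsProbabilityMeasure ((angleMeasure uniformDensity).map circlePoint) :=
    Measure.isProbabilityMeasure_map continuous_circlePoint.measurable.aemeasurable
  refine ext_of_forall_integral_eq_of_IsFiniteMeasure fun F => ?_
  have hF := F.continuous
  rw [integral_map continuous_circlePoint.measurable.aemeasurable hF.aestronglyMeasurable,
    integral_sphereMeasure hF.aestronglyMeasurable]
  set σ := unitSphereMeasure (Fin 2)
  set m := angleMeasure uniformDensity
  have hfl := isCircleFlow_sphereRot (0 : Fin 2) 1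
  have hc : Continuous (toUnit 1 F) := hF.comp (by fun_prop)
  have h1 : ∀ φ, ∫ u, toUnit 1 F (sphereRot 0 1 φ u) ∂σ = ∫ u, toUnit 1 F u ∂σ := fun φ =>
    integral_comp_mp (hfl.mp φ) hc.aestronglyMeasurable
  have h2 : ∫ u, toUnit 1 F u ∂σ = ∫ φ, ∫ u, toUnit 1 F (sphereRot 0 1 φ u) ∂σ ∂m := by
    simp [h1]
  have hint : Integrable (Function.uncurry fun φ u => toUnit 1 F (sphereRot 0 1 φ u))
      (m.prod σ) := by
    refine Integrable.of_bound (C := ‖F‖)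
      (hc.comp (continuous_sphereRot (0 : Fin 2) 1)).aestronglyMeasurable
      (Filter.Eventually.of_forall fun p => F.norm_coe_le_norm _)
  rw [h2, integral_integral_swap hint]
  have h3 : ∀ u : USphere (Fin 2), ∫ φ, toUnit 1 F (sphereRot 0 1 φ u) ∂m =
      ∫ φ, F (circlePoint φ) ∂m := fun u => by
    obtain ⟨α, hα⟩ := exists_eq_circlePoint u
    have hp : Function.Periodic (fun φ => F (circlePoint φ)) (2 * π) := fun φ => by
      simp [circlePoint]
    rw [← integral_uniform_add_of_periodic hp α]
    refine integral_congr_ae (Filter.Eventually.of_forall fun φ => ?_)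
    simp [toUnit, hα, rot_circlePoint, add_comm]
  simp [h3]

/-- The function on the plane whose value at `circlePoint φ` is `h φ`. -/
def ofAngle (h : ℝ → ℝ) (η : EuclideanSpace ℝ (Fin 2)) : ℝ := h (-Complex.arg ⟨η 0, η 1⟩)

/-- The minus sign in `ofAngle` matches the clockwise parametrisation; the argument recovers `φ`
modulo 2π, which periodicity absorbs. -/
lemma ofAngle_circlePoint {h : ℝ → ℝ} (hp : Function.Periodic h (2 * π)) (φ : ℝ) :
    ofAngle h (circlePoint φ) = h φ := by
  have e : (⟨circlePoint φ 0, circlePoint φ 1⟩ : ℂ) = Complex.exp ((-φ : ℝ) * Complex.I) := by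
    rw [Complex.exp_mul_I, ← Complex.ofReal_cos, ← Complex.ofReal_sin]
    apply Complex.ext <;> simp [circlePoint, -Complex.ofReal_cos, -Complex.ofReal_sin]
  rw [ofAngle, e, Complex.arg_exp_mul_I]
  have h3 := toIocMod_add_toIocDiv_zsmul two_pi_pos (-π) (-φ)
  rw [eq_sub_of_add_eq h3, zsmul_eq_mul, neg_sub, sub_neg_eq_add, add_comm]
  exact hp.int_mul _ φ

lemma measurable_ofAngle {h : ℝ → ℝ} (hm : Measurable h) : Measurable (ofAngle h) := by
  refine hm.comp (Measurable.neg (Complex.measurable_arg.comp ?_))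
  have : (fun η : EuclideanSpace ℝ (Fin 2) => (⟨η 0, η 1⟩ : ℂ)) =
      fun η => (η 0 : ℂ) + (η 1 : ℂ) * Complex.I := by
    ext η; apply Complex.ext <;> simp
  rw [this]
  fun_prop

lemma integral_sphereMeasure_fin_two {F : EuclideanSpace ℝ (Fin 2) → ℝ} (hF : Measurable F) :
    ∫ η, F η ∂(sphereMeasure (Fin 2) 1) = ∫ φ, F (circlePoint φ) ∂(angleMeasure uniformDensity) := by
  rw [sphereMeasure_fin_two, integral_map continuous_circlePoint.measurable.aemeasurable
    hF.aestronglyMeasurable]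

lemma memLp_shift {h : ℝ → ℝ} (hm : Measurable h) (hp : Function.Periodic h (2 * π))
    (hL : MemLp h 2 (angleMeasure uniformDensity)) (a : ℝ) :
    MemLp (fun φ => h (φ + a)) 2 (angleMeasure uniformDensity) := by
  have hma : Measurable fun φ => h (φ + a) := hm.comp (measurable_add_const a)
  rw [memLp_two_iff_integrable_sq hma.aestronglyMeasurable]
  have h1 := hL.integrable_sq
  rw [integrable_angleMeasure_uniform] at h1 ⊢
  have hp2 : Function.Periodic (fun x => h x ^ 2) (2 * π) := fun x => by simp only [hp x]
  have := hp2.intervalIntegrable (t := -π) two_pi_pos.ne' (by convert h1 using 1; ring) (-π + a) (π + a)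
  simpa using this.comp_add_right a

/-- For independent uniform `φ` and `θ`, the angle `φ + θ` is uniform given `φ`, so the cross term
integrates to the squared mean of `h`, which is zero. -/
lemma integral_integral_sq_incr {h : ℝ → ℝ} (hm : Measurable h)
    (hp : Function.Periodic h (2 * π)) (hL : MemLp h 2 (angleMeasure uniformDensity))
    (h0 : ∫ φ, h φ ∂(angleMeasure uniformDensity) = 0) :
    ∫ θ, ∫ φ, (h (φ + θ) - h φ) ^ 2 ∂(angleMeasure uniformDensity) ∂(angleMeasure uniformDensity) =
      2 * ∫ φ, h φ ^ 2 ∂(angleMeasure uniformDensity) := by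
  set m := angleMeasure uniformDensity
  set V := ∫ φ, h φ ^ 2 ∂m with hV
  have hp2 : Function.Periodic (fun x => h x ^ 2) (2 * π) := fun x => by simp only [hp x]
  have h1 : ∀ θ, ∫ φ, (h (φ + θ) - h φ) ^ 2 ∂m = 2 * V - 2 * ∫ φ, h φ * h (φ + θ) ∂m := fun θ => by
    have i1 := (memLp_shift hm hp hL θ).integrable_sq
    have i2 := hL.integrable_sq
    have i3 : Integrable (fun φ => h φ * h (φ + θ)) m := hL.integrable_mul (memLp_shift hm hp hL θ)
    have i4 := integral_uniform_add_of_periodic hp2 θ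
    have e : ∀ φ, (h (φ + θ) - h φ) ^ 2 = h (φ + θ) ^ 2 + h φ ^ 2 - 2 * (h φ * h (φ + θ)) :=
      fun φ => by ring
    have i5 := integral_sub (i1.add i2) (i3.const_mul 2)
    simp only [Pi.add_apply] at i5
    simp only [e]
    rw [i5, integral_add i1 i2, integral_const_mul, i4]
    ring
  have hfl : Measurable fun p : ℝ × ℝ => h (p.2 + p.1) := by fun_prop
  have i1 : MemLp (fun p : ℝ × ℝ => h p.2) 2 (m.prod m) := hL.comp_snd m
  have i2 : MemLp (fun p : ℝ × ℝ => h (p.2 + p.1)) 2 (m.prod m) := by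
    rw [memLp_two_iff_integrable_sq hfl.aestronglyMeasurable,
      integrable_prod_iff (hfl.pow_const 2).aestronglyMeasurable]
    refine ⟨Filter.Eventually.of_forall fun θ => (memLp_shift hm hp hL θ).integrable_sq, ?_⟩
    have : ∀ θ, ∫ φ, h (φ + θ) ^ 2 ∂m = V := fun θ => integral_uniform_add_of_periodic hp2 θ
    simp only [norm_pow, Real.norm_eq_abs, sq_abs, this]
    exact integrable_const _
  have i3 : Integrable (fun p : ℝ × ℝ => h p.2 * h (p.2 + p.1)) (m.prod m) := i1.integrable_mul i2
  have h2 : ∫ θ, ∫ φ, h φ * h (φ + θ) ∂m ∂m = 0 := by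
    rw [integral_integral_swap i3]
    have : ∀ φ, ∫ θ, h φ * h (φ + θ) ∂m = 0 := fun φ => by
      have := integral_uniform_add_of_periodic hp φ
      rw [integral_const_mul]
      simp only [add_comm φ]
      rw [this, h0, mul_zero]
    simp [this]
  have h3 : Integrable (fun θ => ∫ φ, h φ * h (φ + θ) ∂m) m := i3.integral_prod_left
  simp only [h1]
  rw [integral_sub (integrable_const _) (h3.const_mul 2)]
  have : ∫ θ, 2 * ∫ φ, h φ * h (φ + θ) ∂m ∂m = 0 := by rw [integral_const_mul, h2, mul_zero]
  rw [this]
  simp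

/-- The two-particle spectral gap, written as an inequality for functions of the angle. -/
lemma circle_gap {ρ : ℝ → ℝ} (hρ : IsCircleDensity ρ) {h : ℝ → ℝ} (hm : Measurable h)
    (hp : Function.Periodic h (2 * π)) (hL : MemLp h 2 (angleMeasure uniformDensity)) :
    2 * gap ρ 2 * ∫ θ, ∫ φ, (h (φ + θ) - h φ) ^ 2
        ∂(angleMeasure uniformDensity) ∂(angleMeasure uniformDensity) ≤
      ∫ θ, ∫ φ, (h (φ + θ) - h φ) ^ 2 ∂(angleMeasure uniformDensity) ∂(angleMeasure ρ) := by
  set m := angleMeasure uniformDensity with hmdef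
  set c := ∫ φ, h φ ∂m
  set g : ℝ → ℝ := fun φ => h φ - c with hg
  have gm : Measurable g := hm.sub_const c
  have gp : Function.Periodic g (2 * π) := fun x => by simp only [hg, hp x]
  have gL : MemLp g 2 m := hL.sub (memLp_const c)
  have g0 : ∫ φ, g φ ∂m = 0 := by
    rw [integral_sub (hL.integrable one_le_two) (integrable_const c)]
    simp [c]
  have hd : ∀ θ φ, h (φ + θ) - h φ = g (φ + θ) - g φ := fun θ φ => by simp [hg]
  simp only [hd]
  rw [integral_integral_sq_incr gm gp gL g0]
  set f := ofAngle g
  have fm : Measurable f := measurable_ofAngle gm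
  have fL : MemLp f 2 (sphereMeasure (Fin 2) 1) := by
    rw [sphereMeasure_fin_two, memLp_map_measure_iff fm.aestronglyMeasurable
      continuous_circlePoint.measurable.aemeasurable]
    refine gL.congr_norm (fm.comp continuous_circlePoint.measurable).aestronglyMeasurable
      (Filter.Eventually.of_forall fun φ => ?_)
    simp [f, ofAngle_circlePoint gp]
  have f0 : ∫ η, f η ∂(sphereMeasure (Fin 2) 1) = 0 := by
    rw [integral_sphereMeasure_fin_two fm]
    simpa [f, ofAngle_circlePoint gp] using g0
  have f2 : ∫ η, f η ^ 2 ∂(sphereMeasure (Fin 2) 1) = ∫ φ, g φ ^ 2 ∂m := by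
    rw [integral_sphereMeasure_fin_two (F := fun η => f η ^ 2) (by fun_prop)]
    simp [f, ofAngle_circlePoint gp, m]
  have key := gap_mul_le hρ one_pos fL f0
  rw [integral_mul_neg_gen hρ fL, f2] at key
  -- The ordered pairs (0, 1) and (1, 0) contribute equally, since one rotates by the opposite angle
  -- of the other. With the prefactor 1/4 and the 1/2 in `energy`, the form is a quarter of the mean
  -- square increment; the uniform double integral is twice the variance, whence the constant 2.
  have hsw : ∀ θ, sqIncr (sphereMeasure (Fin 2) 1) (rot 1 0 θ) f =
      sqIncr (sphereMeasure (Fin 2) 1) (rot 0 1 θ) f := fun θ => by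
    rw [← (isCircleFlow_rot 0 1 1).sqIncr_neg fL θ]
    congr 1
    ext1 η
    exact rot_swap 0 1 θ η
  have hin : ∀ θ, sqIncr (sphereMeasure (Fin 2) 1) (rot 0 1 θ) f =
      ∫ φ, (g (φ + θ) - g φ) ^ 2 ∂m := fun θ => by
    have hr : Measurable (rot (0 : Fin 2) 1 θ) :=
      ((isCircleFlow_rot (0 : Fin 2) 1 1).mp θ).measurable
    rw [sqIncr, integral_sphereMeasure_fin_two (F := fun η => (f (rot 0 1 θ η) - f η) ^ 2)
      (((fm.comp hr).sub fm).pow_const 2)]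
    simp [f, rot_circlePoint, ofAngle_circlePoint gp, m]
  have hself : ∀ i : Fin 2, energy (sphereMeasure (Fin 2) 1) (rot i i) (angleMeasure ρ) f = 0 :=
    fun i => by simp [energy, sqIncr]
  simp only [Fin.sum_univ_two, hself] at key
  simp only [energy, hsw, hin] at key
  push_cast at key
  linarith

end Circle

/-! ### Comparison of `ρ` with the uniform density along orbits -/

section Comparison

variable {X : Type*} [MeasurableSpace X] {ν : Measure X} [IsFiniteMeasure ν] {T : ℝ → X → X}
  (hT : IsCircleFlow T ν)

include hT

lemma IsCircleFlow.integrable_orbit (m : Measure ℝ) [IsFiniteMeasure m] {f : X → ℝ}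
    (hf : MemLp f 2 ν) :
    Integrable (fun p : (ℝ × ℝ) × X => (f (T (p.1.2 + p.1.1) p.2) - f (T p.1.2 p.2)) ^ 2)
      ((m.prod (angleMeasure uniformDensity)).prod ν) := by
  have h1 : MemLp (fun p : (ℝ × ℝ) × X => f p.2) 2
    ((m.prod (angleMeasure uniformDensity)).prod ν) := hf.comp_snd _
  have mp : ∀ a : ℝ × ℝ → ℝ, Measurable a →
      MeasurePreserving (fun p : (ℝ × ℝ) × X => (p.1, T (a p.1) p.2))
        ((m.prod (angleMeasure uniformDensity)).prod ν)
        ((m.prod (angleMeasure uniformDensity)).prod ν) := fun a ha =>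
    (MeasurePreserving.id _).skew_product (g := fun p x => T (a p) x)
      (hT.measurable.comp (by fun_prop : Measurable fun p : (ℝ × ℝ) × X => (a p.1, p.2)))
      (Filter.Eventually.of_forall fun p : ℝ × ℝ => (hT.mp (a p)).map_eq)
  exact ((h1.comp_measurePreserving (mp (fun p => p.2 + p.1) (by fun_prop))).sub
    (h1.comp_measurePreserving (mp (fun p => p.2) (by fun_prop)))).integrable_sq

/-- As `T φ` preserves `ν`, the increment may be taken at `T φ x` instead of `x` and averaged over
`φ`. After Fubini, the inner integral involves only the orbit of `x`. -/
lemma IsCircleFlow.integral_sqIncr_eq_orbit (m : Measure ℝ) [IsFiniteMeasure m] {f : X → ℝ}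
    (hf : MemLp f 2 ν) :
    Integrable (fun x => ∫ θ, ∫ φ, (f (T (φ + θ) x) - f (T φ x)) ^ 2
      ∂(angleMeasure uniformDensity) ∂m) ν ∧
    ∫ θ, sqIncr ν (T θ) f ∂m = ∫ x, ∫ θ, ∫ φ, (f (T (φ + θ) x) - f (T φ x)) ^ 2
      ∂(angleMeasure uniformDensity) ∂m ∂ν := by
  have hI := hT.integrable_orbit m hf
  have hae : ∀ᵐ x ∂ν, ∫ p : ℝ × ℝ, (f (T (p.2 + p.1) x) - f (T p.2 x)) ^ 2
      ∂(m.prod (angleMeasure uniformDensity)) = ∫ θ, ∫ φ, (f (T (φ + θ) x) - f (T φ x)) ^ 2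
      ∂(angleMeasure uniformDensity) ∂m := by
    filter_upwards [hI.prod_left_ae] with x hx
    exact integral_prod _ hx
  refine ⟨hI.integral_prod_right.congr hae, ?_⟩
  rw [← integral_congr_ae hae, ← integral_prod_symm _ hI, integral_prod _ hI,
    integral_prod _ hI.integral_prod_left]
  refine integral_congr_ae (Filter.Eventually.of_forall fun θ => ?_)
  have : ∀ φ, ∫ x, (f (T (φ + θ) x) - f (T φ x)) ^ 2 ∂ν = sqIncr ν (T θ) f := fun φ => by
    rw [sqIncr, ← integral_comp_mp (hT.mp φ)
      (integrable_sqIncr_fun (hT.mp θ) hf).aestronglyMeasurable]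
    simp only [← hT.add, add_comm θ φ]
  simp [this]

/-- A jump process along a circle action is controlled by its uniform version, with the constant
given by the two-particle spectral gap. -/
lemma IsCircleFlow.energy_comparison {ρ : ℝ → ℝ} (hρ : IsCircleDensity ρ) {f : X → ℝ}
    (hf : MemLp f 2 ν) :
    2 * gap ρ 2 * energy ν T (angleMeasure uniformDensity) f ≤ energy ν T (angleMeasure ρ) f := by
  have := isProbabilityMeasure_angleMeasure hρ
  -- The restriction of `f` to every orbit has to be measurable, so `f` is replaced by a measurable
  -- representative; energies do not see the change.
  wlog hm : Measurable f generalizing f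
  · have hmk := hf.1.ae_eq_mk
    have := this (f := hf.1.mk) ((memLp_congr_ae hmk).1 hf)
      hf.1.stronglyMeasurable_mk.measurable
    have e : ∀ θ, sqIncr ν (T θ) f = sqIncr ν (T θ) hf.1.mk := fun θ => sqIncr_congr (hT.mp θ) hmk
    simpa only [energy, e] using this
  have key : 2 * gap ρ 2 * ∫ θ, sqIncr ν (T θ) f ∂(angleMeasure uniformDensity) ≤
      ∫ θ, sqIncr ν (T θ) f ∂(angleMeasure ρ) := by
    obtain ⟨i1, e1⟩ := hT.integral_sqIncr_eq_orbit (angleMeasure uniformDensity) hf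
    obtain ⟨i2, e2⟩ := hT.integral_sqIncr_eq_orbit (angleMeasure ρ) hf
    rw [e1, e2, ← integral_const_mul]
    refine integral_mono_ae (i1.const_mul _) i2 ?_
    have hfT : Integrable (fun p : ℝ × X => f (T p.1 p.2) ^ 2)
        ((angleMeasure uniformDensity).prod ν) :=
      ((hf.comp_snd (angleMeasure uniformDensity)).comp_measurePreserving
        (hT.mp_prod _)).integrable_sq
    filter_upwards [hfT.prod_left_ae] with x hx
    have hmx : Measurable fun φ => f (T φ x) :=
      hm.comp (hT.measurable.comp (by fun_prop : Measurable fun φ : ℝ => (φ, x)))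
    refine circle_gap hρ (h := fun φ => f (T φ x)) hmx (fun φ => by simp only [hT.periodic]) ?_
    exact (memLp_two_iff_integrable_sq hmx.aestronglyMeasurable).2 hx
  simp only [energy]
  linarith

end Comparison

/-! ### Averages over planar rotations as symmetric projections -/

section RotAvg

variable {ι : Type} [DecidableEq ι] [Fintype ι]

lemma continuous_sphereRot_left (i j : ι) (u : USphere ι) :
    Continuous fun θ => sphereRot i j θ u := by
  have h : Continuous fun θ : ℝ => (θ, u) := by fun_prop
  have h2 := (continuous_sphereRot i j).comp h
  simpa only [Function.comp_def] using h2

lemma continuous_sphereRot_right (i j : ι) (θ : ℝ) : Continuous (sphereRot i j θ) :=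
  continuous_isometryOnSphere _

lemma integrable_comp_sphereRot (f : C(USphere ι, ℝ)) (i j : ι) (u : USphere ι) :
    Integrable (fun θ => f (sphereRot i j θ u)) (angleMeasure uniformDensity) :=
  Integrable.of_bound (C := ‖f‖)
    (f.continuous.comp (continuous_sphereRot_left i j u)).aestronglyMeasurable
    (Filter.Eventually.of_forall fun _ => f.norm_coe_le_norm _)

/-- The average of a continuous function over the rotations in the plane `(i, j)`. -/
def rotAvg (i j : ι) : C(USphere ι, ℝ) →ₗ[ℝ] C(USphere ι, ℝ) where
  toFun f := ⟨fun u => ∫ θ, f (sphereRot i j θ u) ∂(angleMeasure uniformDensity),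
    continuous_of_dominated (bound := fun _ => ‖f‖)
      (fun u => (integrable_comp_sphereRot f i j u).aestronglyMeasurable)
      (fun _ => Filter.Eventually.of_forall fun _ => f.norm_coe_le_norm _) (integrable_const _)
      (Filter.Eventually.of_forall fun θ => f.continuous.comp (continuous_sphereRot_right i j θ))⟩
  map_add' f g := by
    ext u
    exact integral_add (integrable_comp_sphereRot f i j u) (integrable_comp_sphereRot g i j u)
  map_smul' c f := by
    ext u
    exact integral_const_mul c _

lemma rotAvg_apply (i j : ι) (f : C(USphere ι, ℝ)) (u : USphere ι) :
    rotAvg i j f u = ∫ θ, f (sphereRot i j θ u) ∂(angleMeasure uniformDensity) := rfl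

lemma rotAvg_sphereRot (i j : ι) (f : C(USphere ι, ℝ)) (a : ℝ) (u : USphere ι) :
    rotAvg i j f (sphereRot i j a u) = rotAvg i j f u := by
  have hp : Function.Periodic (fun θ => f (sphereRot i j θ u)) (2 * π) := fun θ => by
    simp only [(isCircleFlow_sphereRot i j).periodic]
  rw [rotAvg_apply, rotAvg_apply, ← integral_uniform_add_of_periodic hp a]
  simp only [(isCircleFlow_sphereRot i j).add]

lemma rotAvg_rotAvg (i j : ι) (f : C(USphere ι, ℝ)) : rotAvg i j (rotAvg i j f) = rotAvg i j f := by
  ext u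
  rw [rotAvg_apply]
  simp [rotAvg_sphereRot]

lemma rotAvg_swap (i j : ι) : (rotAvg j i : C(USphere ι, ℝ) →ₗ[ℝ] C(USphere ι, ℝ)) = rotAvg i j := by
  ext f u
  rw [rotAvg_apply, rotAvg_apply, ← integral_uniform_neg]
  simp only [sphereRot_swap i j, neg_neg]

lemma rotAvg_self (i : ι) : (rotAvg i i : C(USphere ι, ℝ) →ₗ[ℝ] C(USphere ι, ℝ)) = LinearMap.id := by
  ext f u
  simp [rotAvg_apply]

lemma sphereRot_comm {i j k l : ι} (hik : i ≠ k) (hil : i ≠ l) (hjk : j ≠ k) (hjl : j ≠ l)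
    (a b : ℝ) (u : USphere ι) :
    sphereRot i j a (sphereRot k l b u) = sphereRot k l b (sphereRot i j a u) := by
  refine Subtype.ext ?_
  simp only [coe_sphereRot]
  ext m
  by_cases hij : i = j
  · subst hij; simp
  by_cases hkl : k = l
  · subst hkl; simp
  by_cases h1 : m = i
  · subst h1
    rw [rot_apply_left hij, rot_apply_of_ne hik hil, rot_apply_of_ne hik hil,
      rot_apply_of_ne hjk hjl, rot_apply_left hij]
  by_cases h2 : m = j
  · subst h2
    rw [rot_apply_right hij, rot_apply_of_ne hik hil, rot_apply_of_ne hjk hjl,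
      rot_apply_of_ne hjk hjl, rot_apply_right hij]
  rw [rot_apply_of_ne h1 h2]
  by_cases h3 : m = k
  · subst h3
    rw [rot_apply_left hkl, rot_apply_left hkl, rot_apply_of_ne h1 h2,
      rot_apply_of_ne hil.symm hjl.symm]
  by_cases h4 : m = l
  · subst h4
    rw [rot_apply_right hkl, rot_apply_right hkl, rot_apply_of_ne h1 h2,
      rot_apply_of_ne hik.symm hjk.symm]
  rw [rot_apply_of_ne h3 h4, rot_apply_of_ne h3 h4, rot_apply_of_ne h1 h2]

lemma rotAvg_comm {i j k l : ι} (hik : i ≠ k) (hil : i ≠ l) (hjk : j ≠ k) (hjl : j ≠ l)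
    (f : C(USphere ι, ℝ)) : rotAvg i j (rotAvg k l f) = rotAvg k l (rotAvg i j f) := by
  ext u
  simp only [rotAvg_apply]
  rw [integral_integral_swap]
  · simp only [sphereRot_comm hik hil hjk hjl]
  · refine Integrable.of_bound (C := ‖f‖) (Continuous.aestronglyMeasurable ?_)
      (Filter.Eventually.of_forall fun _ => f.norm_coe_le_norm _)
    have h1 := continuous_sphereRot_left i j u
    have h : Continuous fun p : ℝ × ℝ => (p.2, sphereRot i j p.1 u) := by fun_prop
    have h2 := (continuous_sphereRot k l).comp h
    simp only [Function.comp_def] at h2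
    exact f.continuous.comp h2

/-- The rotation `R^{ij}_θ` as an endomorphism of the algebra of continuous functions. -/
def rotComp (i j : ι) (θ : ℝ) : C(USphere ι, ℝ) →ₐ[ℝ] C(USphere ι, ℝ) :=
  ContinuousMap.compRightAlgHom ℝ ℝ ⟨sphereRot i j θ, continuous_sphereRot_right i j θ⟩

lemma rotComp_apply (i j : ι) (θ : ℝ) (f : C(USphere ι, ℝ)) (u : USphere ι) :
    rotComp i j θ f u = f (sphereRot i j θ u) := rfl

/-- The average is a vector-valued integral of the rotated functions, and a finite-dimensional
subspace is closed and convex, so it contains averages of its elements. -/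
lemma rotAvg_mem_of_forall_rotComp_mem {V : Submodule ℝ C(USphere ι, ℝ)} [FiniteDimensional ℝ V]
    {i j : ι} {f : C(USphere ι, ℝ)} (h : ∀ θ, rotComp i j θ f ∈ V) : rotAvg i j f ∈ V := by
  let F : C(ℝ × USphere ι, ℝ) := ⟨fun p => f (sphereRot i j p.1 p.2),
    f.continuous.comp (continuous_sphereRot i j)⟩
  have hc : Continuous fun θ => rotComp i j θ f := F.curry.continuous
  have hi : Integrable (fun θ => rotComp i j θ f) (angleMeasure uniformDensity) :=
    Integrable.of_bound (C := ‖f‖) hc.aestronglyMeasurable (Filter.Eventually.of_forall fun θ =>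
      (ContinuousMap.norm_le _ (norm_nonneg f)).2 fun u => f.norm_coe_le_norm _)
  have e : rotAvg i j f = ∫ θ, rotComp i j θ f ∂(angleMeasure uniformDensity) := by
    ext u
    rw [rotAvg_apply]
    exact (ContinuousLinearMap.integral_comp_comm (ContinuousMap.evalCLM ℝ u) hi)
  rw [e]
  exact V.convex.integral_mem V.closed_of_finiteDimensional (Filter.Eventually.of_forall h) hi

variable [Nonempty ι]

omit [DecidableEq ι] in
lemma integrable_continuous (f : C(USphere ι, ℝ)) : Integrable f (unitSphereMeasure ι) :=
  Integrable.of_bound (C := ‖f‖) f.continuous.aestronglyMeasurable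
    (Filter.Eventually.of_forall fun _ => f.norm_coe_le_norm _)

omit [DecidableEq ι] in
lemma memLp_continuous (f : C(USphere ι, ℝ)) : MemLp f 2 (unitSphereMeasure ι) :=
  MemLp.of_bound f.continuous.aestronglyMeasurable ‖f‖
    (Filter.Eventually.of_forall fun _ => f.norm_coe_le_norm _)

/-- The `L²` inner product of continuous functions on the sphere, as a bilinear form. -/
def sphereForm (ι : Type) [DecidableEq ι] [Fintype ι] [Nonempty ι] :
    LinearMap.BilinForm ℝ C(USphere ι, ℝ) :=
  LinearMap.mk₂ ℝ (fun f g => ∫ u, f u * g u ∂(unitSphereMeasure ι))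
    (fun f f' g => by
      simp only [ContinuousMap.add_apply, add_mul]
      exact integral_add (integrable_continuous (f * g)) (integrable_continuous (f' * g)))
    (fun c f g => by
      simp only [ContinuousMap.smul_apply, smul_eq_mul, mul_assoc]
      exact integral_const_mul _ _)
    (fun f g g' => by
      simp only [ContinuousMap.add_apply, mul_add]
      exact integral_add (integrable_continuous (f * g)) (integrable_continuous (f * g')))
    (fun c f g => by
      simp only [ContinuousMap.smul_apply, smul_eq_mul, mul_left_comm]
      exact integral_const_mul _ _)

lemma sphereForm_apply (f g : C(USphere ι, ℝ)) :
    sphereForm ι f g = ∫ u, f u * g u ∂(unitSphereMeasure ι) := rfl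

lemma sphereForm_comm (f g : C(USphere ι, ℝ)) : sphereForm ι f g = sphereForm ι g f := by
  simp only [sphereForm_apply, mul_comm]

lemma sphereForm_self_nonneg (f : C(USphere ι, ℝ)) : 0 ≤ sphereForm ι f f :=
  integral_nonneg fun _ => mul_self_nonneg _

/-- The surface measure charges every nonempty open set, so a continuous function that vanishes
almost everywhere vanishes. -/
lemma sphereForm_self_pos {f : C(USphere ι, ℝ)} (hf : f ≠ 0) : 0 < sphereForm ι f f := by
  refine lt_of_le_of_ne (sphereForm_self_nonneg f) fun h => hf ?_
  rw [sphereForm_apply, eq_comm, integral_eq_zero_iff_of_nonneg (fun _ => mul_self_nonneg _)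
    (integrable_continuous (f * f))] at h
  have := Continuous.ae_eq_iff_eq (unitSphereMeasure ι) (f * f).continuous continuous_const |>.1 h
  ext u
  exact mul_self_eq_zero.1 (congrFun this u)

/-- The adjoint of the rotation by `θ` is the rotation by `-θ`, and the uniform law is invariant
under `θ ↦ -θ`. -/
lemma sphereForm_rotAvg (i j : ι) (f g : C(USphere ι, ℝ)) :
    sphereForm ι (rotAvg i j f) g = sphereForm ι f (rotAvg i j g) := by
  have hfl := isCircleFlow_sphereRot i j
  have hi : ∀ f g : C(USphere ι, ℝ), Integrable (Function.uncurry fun (u : USphere ι) (θ : ℝ) =>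
      f (sphereRot i j θ u) * g u) ((unitSphereMeasure ι).prod (angleMeasure uniformDensity)) :=
    fun f g => by
      refine Integrable.of_bound (C := ‖f‖ * ‖g‖) (Continuous.aestronglyMeasurable ?_)
        (Filter.Eventually.of_forall fun p => ?_)
      · exact (f.continuous.comp ((continuous_sphereRot i j).comp continuous_swap)).mul
          (g.continuous.comp continuous_fst)
      · simp only [Function.uncurry, norm_mul]
        exact mul_le_mul (f.norm_coe_le_norm _) (g.norm_coe_le_norm _) (norm_nonneg _)
          (norm_nonneg _)
  rw [sphereForm_comm f]
  simp only [sphereForm_apply, rotAvg_apply, ← integral_mul_const]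
  rw [integral_integral_swap (hi f g), integral_integral_swap (hi g f), ← integral_uniform_neg]
  refine integral_congr_ae (Filter.Eventually.of_forall fun θ => ?_)
  simp only
  rw [← integral_comp_mp (hfl.mp θ) (f := fun u => f (sphereRot i j (-θ) u) * g u)
    (Continuous.aestronglyMeasurable (by
      have := continuous_sphereRot_right i j (-θ)
      fun_prop))]
  simp only [← hfl.add, neg_add_cancel, hfl.zero, mul_comm]

/-- The Dirichlet form of a continuous function under the uniform rotations in a plane. -/
lemma energy_eq_sphereForm (i j : ι) (f : C(USphere ι, ℝ)) :
    energy (unitSphereMeasure ι) (sphereRot i j) (angleMeasure uniformDensity) f =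
      sphereForm ι f (f - rotAvg i j f) := by
  rw [← (isCircleFlow_sphereRot i j).integral_mul_eq_energy _ (memLp_continuous f),
    sphereForm_apply]
  refine integral_congr_ae (Filter.Eventually.of_forall fun u => ?_)
  simp only
  rw [integral_sub (integrable_comp_sphereRot f i j u) (integrable_const _)]
  simp [rotAvg_apply]

end RotAvg

/-! ### Finite-dimensional rotation-invariant spaces of polynomials -/

section Polynomials

variable (ι : Type) [DecidableEq ι] [Fintype ι]

/-- The coordinate functions on the sphere. -/
def sphereCoord {ι : Type} [Fintype ι] (k : ι) : C(USphere ι, ℝ) :=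
  ⟨fun u => (u : EuclideanSpace ℝ ι) k, by fun_prop⟩

/-- The affine functions on the sphere. -/
def sphereAffine : Submodule ℝ C(USphere ι, ℝ) :=
  Submodule.span ℝ (insert 1 (Set.range sphereCoord))

variable {ι}

omit [DecidableEq ι] in
lemma one_mem_sphereAffine : (1 : C(USphere ι, ℝ)) ∈ sphereAffine ι :=
  Submodule.subset_span (Set.mem_insert _ _)

omit [DecidableEq ι] in
lemma sphereCoord_mem (k : ι) : sphereCoord k ∈ sphereAffine ι :=
  Submodule.subset_span (Set.mem_insert_of_mem _ ⟨k, rfl⟩)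

omit [DecidableEq ι] in
instance (m : ℕ) : FiniteDimensional ℝ ↥(sphereAffine ι ^ m) := by
  rw [FiniteDimensional, Module.Finite.iff_fg]
  exact (Submodule.fg_span ((Set.finite_range _).insert _)).pow m

/-- A rotation acts linearly on coordinates, hence preserves affine functions; being an algebra
homomorphism, it preserves the powers of their span. -/
lemma rotComp_mem (i j : ι) (θ : ℝ) (m : ℕ) {f : C(USphere ι, ℝ)} (hf : f ∈ sphereAffine ι ^ m) :
    rotComp i j θ f ∈ sphereAffine ι ^ m := by
  have h1 : (sphereAffine ι).map (rotComp i j θ).toLinearMap ≤ sphereAffine ι := by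
    conv_lhs => rw [sphereAffine]
    rw [Submodule.map_span_le]
    rintro _ (rfl | ⟨k, rfl⟩)
    · simpa using one_mem_sphereAffine
    · by_cases hij : i = j
      · have : rotComp i j θ (sphereCoord k) = sphereCoord k := by
          ext u; simp [rotComp_apply, hij]
        show rotComp i j θ (sphereCoord k) ∈ _
        rw [this]
        exact sphereCoord_mem k
      by_cases hi : k = i
      · have : rotComp i j θ (sphereCoord k) = cos θ • sphereCoord i + sin θ • sphereCoord j := by
          ext u
          simp [rotComp_apply, sphereCoord, rot_apply_left hij, hi]
        show rotComp i j θ (sphereCoord k) ∈ _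
        rw [this]
        exact add_mem (Submodule.smul_mem _ _ (sphereCoord_mem _))
          (Submodule.smul_mem _ _ (sphereCoord_mem _))
      by_cases hj : k = j
      · have : rotComp i j θ (sphereCoord k) = -sin θ • sphereCoord i + cos θ • sphereCoord j := by
          ext u
          simp [rotComp_apply, sphereCoord, rot_apply_right hij, hj]
        show rotComp i j θ (sphereCoord k) ∈ _
        rw [this]
        exact add_mem (Submodule.smul_mem _ _ (sphereCoord_mem _))
          (Submodule.smul_mem _ _ (sphereCoord_mem _))
      · have : rotComp i j θ (sphereCoord k) = sphereCoord k := by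
          ext u; simp [rotComp_apply, sphereCoord, rot_apply_of_ne hi hj]
        show rotComp i j θ (sphereCoord k) ∈ _
        rw [this]
        exact sphereCoord_mem k
  have h2 : rotComp i j θ f ∈ (sphereAffine ι ^ m).map (rotComp i j θ).toLinearMap :=
    ⟨f, hf, rfl⟩
  rw [Submodule.map_pow] at h2
  exact pow_le_pow_left' h1 m h2

lemma rotAvg_mem (i j : ι) (m : ℕ) {f : C(USphere ι, ℝ)} (hf : f ∈ sphereAffine ι ^ m) :
    rotAvg i j f ∈ sphereAffine ι ^ m :=
  rotAvg_mem_of_forall_rotComp_mem fun θ => rotComp_mem i j θ m hf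

omit [DecidableEq ι] in
lemma one_mem_sphereAffine_pow (m : ℕ) : (1 : C(USphere ι, ℝ)) ∈ sphereAffine ι ^ m := by
  have := Submodule.pow_mem_pow (sphereAffine ι) one_mem_sphereAffine m
  rwa [one_pow] at this

omit [DecidableEq ι] in
lemma exists_mem_sphereAffine_pow {f : C(USphere ι, ℝ)}
    (hf : f ∈ Algebra.adjoin ℝ (Set.range (sphereCoord (ι := ι)))) :
    ∃ m, f ∈ sphereAffine ι ^ m := by
  have hmono : ∀ {a b : ℕ}, a ≤ b → sphereAffine ι ^ a ≤ sphereAffine ι ^ b := fun {a b} h =>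
    pow_le_pow_right₀ (Submodule.one_le.2 one_mem_sphereAffine) h
  induction hf using Algebra.adjoin_induction with
  | mem x hx =>
    obtain ⟨k, rfl⟩ := hx
    exact ⟨1, by rw [pow_one]; exact sphereCoord_mem k⟩
  | algebraMap r =>
    refine ⟨1, ?_⟩
    rw [pow_one, Algebra.algebraMap_eq_smul_one]
    exact Submodule.smul_mem _ _ one_mem_sphereAffine
  | add x y _ _ hx hy =>
    obtain ⟨a, ha⟩ := hx
    obtain ⟨b, hb⟩ := hy
    exact ⟨max a b, add_mem (hmono (le_max_left a b) ha) (hmono (le_max_right a b) hb)⟩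
  | mul x y _ _ hx hy =>
    obtain ⟨a, ha⟩ := hx
    obtain ⟨b, hb⟩ := hy
    exact ⟨a + b, by rw [pow_add]; exact Submodule.mul_mem_mul ha hb⟩

omit [DecidableEq ι] in
/-- Functions in `sphereAffine ι ^ m` are restrictions of polynomials. -/
lemma exists_mvPolynomial {m : ℕ} {f : C(USphere ι, ℝ)} (hf : f ∈ sphereAffine ι ^ m) :
    ∃ p : MvPolynomial ι ℝ, ∀ u : USphere ι,
      f u = MvPolynomial.eval (fun k => (u : EuclideanSpace ℝ ι) k) p := by
  have h1 : sphereAffine ι ≤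
      Subalgebra.toSubmodule (MvPolynomial.aeval (R := ℝ) (sphereCoord (ι := ι))).range := by
    rw [sphereAffine, Submodule.span_le]
    rintro _ (rfl | ⟨k, rfl⟩)
    · exact ⟨1, by simp⟩
    · exact ⟨MvPolynomial.X k, by simp⟩
  have h2 : ∀ m, sphereAffine ι ^ m ≤
      Subalgebra.toSubmodule (MvPolynomial.aeval (R := ℝ) (sphereCoord (ι := ι))).range := fun m => by
    induction m with
    | zero =>
      rw [pow_zero, Submodule.one_le]
      exact ⟨1, by simp⟩
    | succ m ih =>
      rw [pow_succ, Submodule.mul_le]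
      exact fun a ha b hb => mul_mem (S := Subalgebra ℝ C(USphere ι, ℝ)) (ih ha) (h1 hb)
  obtain ⟨p, rfl⟩ := h2 m hf
  refine ⟨p, fun u => ?_⟩
  have := MvPolynomial.comp_aeval_apply (sphereCoord (ι := ι)) (ContinuousMap.evalAlgHom ℝ ℝ u) p
  rw [← MvPolynomial.coe_aeval_eq_eval]
  exact this

end Polynomials

/-! ### Moments of the cosine of a uniform angle -/

section Moments

/-- The moments of the cosine of a uniform angle. -/
def cosMoment (n : ℕ) : ℝ := ∫ θ, cos θ ^ n ∂(angleMeasure uniformDensity)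

lemma integrable_uniform_of_continuous {g : ℝ → ℝ} (hg : Continuous g) :
    Integrable g (angleMeasure uniformDensity) :=
  integrable_angleMeasure_uniform.2 (hg.intervalIntegrable _ _)

/-- Shifting `θ` by the argument of y + iz turns (y, z) into (√(y² + z²), 0), and the integrand is
periodic. -/
lemma integral_planar_eq {F : ℝ → ℝ → ℝ} (y z : ℝ) :
    ∫ θ, F (cos θ * y + sin θ * z) (-sin θ * y + cos θ * z) ∂(angleMeasure uniformDensity) =
      ∫ θ, F (√(y ^ 2 + z ^ 2) * cos θ) (√(y ^ 2 + z ^ 2) * -sin θ)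
        ∂(angleMeasure uniformDensity) := by
  set w : ℂ := ⟨y, z⟩ with hw
  have hn : √(y ^ 2 + z ^ 2) = ‖w‖ := by
    rw [Complex.norm_eq_sqrt_sq_add_sq]
  have hy : y = ‖w‖ * cos w.arg := (Complex.norm_mul_cos_arg w).symm
  have hz : z = ‖w‖ * sin w.arg := (Complex.norm_mul_sin_arg w).symm
  rw [hn]
  have hp : Function.Periodic (fun θ => F (‖w‖ * cos θ) (‖w‖ * -sin θ)) (2 * π) := fun θ => by
    simp only [cos_add_two_pi, sin_add_two_pi]
  rw [← integral_uniform_add_of_periodic hp (-w.arg)]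
  refine integral_congr_ae (Filter.Eventually.of_forall fun θ => ?_)
  simp only
  congr 1
  · rw [cos_add, cos_neg, sin_neg]
    linear_combination cos θ * hy + sin θ * hz
  · rw [sin_add, cos_neg, sin_neg]
    linear_combination -sin θ * hy + cos θ * hz

lemma cosMoment_zero : cosMoment 0 = 1 := by simp [cosMoment]

lemma integral_shift_pi {g : ℝ → ℝ} (hp : Function.Periodic g (2 * π)) (h : ∀ θ, g (θ + π) = -g θ) :
    ∫ θ, g θ ∂(angleMeasure uniformDensity) = 0 := by
  have := integral_uniform_add_of_periodic hp π
  simp only [h, integral_neg] at this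
  linarith

lemma cosMoment_odd {n : ℕ} (hn : Odd n) : cosMoment n = 0 :=
  integral_shift_pi (fun θ => by simp only [cos_add_two_pi])
    fun θ => by simp only [cos_add_pi, hn.neg_pow]

lemma cosMoment_two : cosMoment 2 = 1 / 2 := by
  have := pi_pos
  rw [cosMoment, integral_angleMeasure_uniform, integral_cos_sq]
  simp
  field_simp

lemma cosMoment_four : cosMoment 4 = 3 / 8 := by
  have := pi_pos
  rw [cosMoment, integral_angleMeasure_uniform, integral_cos_pow, integral_cos_sq]
  simp
  field_simp
  ring

lemma cosMoment_bounds {m : ℕ} (hm : 2 ≤ m) :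
    0 ≤ cosMoment (2 * m) ∧ cosMoment (2 * m) ≤ 3 / 8 := by
  refine ⟨integral_nonneg fun θ => by rw [pow_mul]; positivity, ?_⟩
  rw [← cosMoment_four]
  refine integral_mono (integrable_uniform_of_continuous (by fun_prop))
    (integrable_uniform_of_continuous (by fun_prop)) fun θ => ?_
  simp only
  rw [pow_mul, show 4 = 2 * 2 by norm_num, pow_mul]
  exact pow_le_pow_of_le_one (sq_nonneg _) (cos_sq_le_one θ) hm

end Moments

/-! ### Spectrum of the Kac operator on polynomials -/

section KacOperator

open Polynomial

/-- The Kac operator on the polynomials in one coordinate of a sphere of radius `√r`: the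
conditional expectation of a function of a second coordinate given the first one. -/
def kacPoly (r : ℝ) (p : ℝ[X]) : ℝ[X] :=
  ∑ n ∈ Finset.range (p.natDegree + 1), C (p.coeff n * cosMoment n) * (C r - X ^ 2) ^ (n / 2)

lemma integral_linear_pow (y z : ℝ) (n : ℕ) :
    ∫ θ, (cos θ * y + sin θ * z) ^ n ∂(angleMeasure uniformDensity) =
      cosMoment n * (y ^ 2 + z ^ 2) ^ (n / 2) := by
  rw [integral_planar_eq (F := fun a _ => a ^ n)]
  simp only [mul_pow]
  rw [integral_const_mul, ← cosMoment]
  rcases Nat.even_or_odd n with h | h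
  · obtain ⟨m, rfl⟩ := h.two_dvd
    rw [pow_mul, sq_sqrt (by positivity), Nat.mul_div_cancel_left _ two_pos, mul_comm]
  · simp [cosMoment_odd h]

/-- The average of a monomial depends on (y, z) only through y² + z² = r - t², so the conditional
expectation is again a polynomial in `t`. -/
lemma eval_kacPoly {r t y z : ℝ} (h : t ^ 2 + y ^ 2 + z ^ 2 = r) (p : ℝ[X]) :
    (kacPoly r p).eval t =
      ∫ θ, p.eval (cos θ * y + sin θ * z) ∂(angleMeasure uniformDensity) := by
  simp only [eval_eq_sum_range (p := p), kacPoly, eval_finsetSum, eval_mul, eval_C, eval_pow,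
    eval_sub, eval_X]
  rw [integral_finsetSum]
  · refine Finset.sum_congr rfl fun n _ => ?_
    rw [integral_const_mul, integral_linear_pow, show r - t ^ 2 = y ^ 2 + z ^ 2 by linarith]
    ring
  · exact fun n _ => integrable_uniform_of_continuous (by fun_prop)

lemma natDegree_C_sub_X_sq_pow (r : ℝ) (m : ℕ) : ((C r - X ^ 2 : ℝ[X]) ^ m).natDegree ≤ 2 * m := by
  refine natDegree_pow_le.trans ?_
  rw [mul_comm]
  refine Nat.mul_le_mul_right m ?_
  compute_degree

/-- The operator is triangular for the degree: the image of Xⁿ has degree at most n, so only the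
leading monomial reaches the top coefficient. The factor read there is the eigenvalue. -/
lemma coeff_kacPoly_natDegree (r : ℝ) (p : ℝ[X]) :
    (kacPoly r p).coeff p.natDegree =
      p.leadingCoeff * cosMoment p.natDegree * (-1) ^ (p.natDegree / 2) := by
  rw [kacPoly, finsetSum_coeff, Finset.sum_range_succ, Finset.sum_eq_zero, zero_add, coeff_C_mul]
  · rcases Nat.even_or_odd p.natDegree with h | h
    · obtain ⟨m, hm⟩ := h.two_dvd
      have : ((C r - X ^ 2 : ℝ[X]) ^ m).coeff (m * 2) = (-1) ^ m := by
        rw [coeff_pow_of_natDegree_le (by compute_degree)]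
        simp
      rw [leadingCoeff, hm, Nat.mul_div_cancel_left _ two_pos, mul_comm 2 m, this]
    · simp [cosMoment_odd h]
  · intro n hn
    rw [coeff_C_mul, coeff_eq_zero_of_natDegree_lt (p := (C r - X ^ 2) ^ (n / 2)), mul_zero]
    have := natDegree_C_sub_X_sq_pow r (n / 2)
    have := Finset.mem_range.1 hn
    omega

/-- The eigenvalues of the Kac operator on polynomials. -/
lemma kac_eigenvalue {r : ℝ} (hr : 0 < r) {p : ℝ[X]} (hp : p ≠ 0) {a : ℝ}
    (h : ∀ t y z : ℝ, t ^ 2 + y ^ 2 + z ^ 2 = r → a * p.eval t =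
      ∫ θ, p.eval (cos θ * y + sin θ * z) ∂(angleMeasure uniformDensity)) :
    a = 1 ∨ (-1 / 2 ≤ a ∧ a ≤ 3 / 8) := by
  have key : C a * p = kacPoly r p := by
    -- Every t in [0, √r] is a coordinate of the point (t, √(r - t²), 0) of the sphere, which gives
    -- infinitely many points of agreement.
    refine Polynomial.eq_of_infinite_eval_eq _ _ (Set.Infinite.mono (s := Set.Icc 0 √r) ?_
      (Set.Icc_infinite (sqrt_pos.2 hr)))
    intro t ht
    have h1 : t ^ 2 ≤ r := by
      have := pow_le_pow_left₀ ht.1 ht.2 2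
      rwa [sq_sqrt hr.le] at this
    have h2 : t ^ 2 + √(r - t ^ 2) ^ 2 + 0 ^ 2 = r := by
      rw [sq_sqrt (by linarith)]; ring
    show eval t _ = eval t _
    rw [eval_mul, eval_C, h t _ _ h2, eval_kacPoly h2]
  have h1 := congrArg (fun q => coeff q p.natDegree) key
  simp only [coeff_C_mul, coeff_kacPoly_natDegree] at h1
  rw [coeff_natDegree, mul_comm a, mul_assoc] at h1
  have h2 := mul_left_cancel₀ (leadingCoeff_ne_zero.2 hp) h1
  -- The degree decides: odd gives 0, degree 0 gives 1, degree 2 gives -1/2, and an even degree of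
  -- at least 4 gives absolute value at most 3/8.
  rcases Nat.even_or_odd p.natDegree with hd | hd
  · obtain ⟨m, hm⟩ := hd.two_dvd
    rw [hm, Nat.mul_div_cancel_left _ two_pos] at h2
    rcases Nat.lt_or_ge m 2 with h3 | h3
    · interval_cases m
      · left; simpa [cosMoment_zero] using h2
      · right
        rw [mul_one, cosMoment_two] at h2
        constructor <;> linarith
    · right
      obtain ⟨b1, b2⟩ := cosMoment_bounds h3
      rcases neg_one_pow_eq_or ℝ m with h4 | h4 <;> rw [h4] at h2 <;> constructor <;> linarith
  · rw [cosMoment_odd hd, zero_mul] at h2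
    right
    rw [h2]
    norm_num

end KacOperator

/-! ### The three-particle operator on a fibre with the other coordinates frozen -/

section Fibre

variable {ι : Type} [DecidableEq ι] [Fintype ι]

open Polynomial in
/-- Averages of monomials over planar rotations are polynomials in the squared radius. -/
lemma exists_planar_moment (a b : ℕ) : ∃ q : ℝ[X], ∀ x y : ℝ,
    ∫ θ, (cos θ * x + sin θ * y) ^ a * (-sin θ * x + cos θ * y) ^ b
      ∂(angleMeasure uniformDensity) = q.eval (x ^ 2 + y ^ 2) := by
  set c := ∫ θ, cos θ ^ a * (-sin θ) ^ b ∂(angleMeasure uniformDensity) with hc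
  refine ⟨C c * X ^ ((a + b) / 2), fun x y => ?_⟩
  rw [integral_planar_eq (F := fun u v => u ^ a * v ^ b)]
  have e : ∀ θ, (√(x ^ 2 + y ^ 2) * cos θ) ^ a * (√(x ^ 2 + y ^ 2) * -sin θ) ^ b =
      √(x ^ 2 + y ^ 2) ^ (a + b) * (cos θ ^ a * (-sin θ) ^ b) := fun θ => by ring
  simp only [e]
  rw [integral_const_mul, ← hc, eval_mul, eval_C, eval_pow, eval_X]
  rcases Nat.even_or_odd (a + b) with h | h
  · obtain ⟨m, hm⟩ := h.two_dvd
    rw [hm, Nat.mul_div_cancel_left _ two_pos, pow_mul, sq_sqrt (by positivity), mul_comm]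
  -- A half-turn multiplies the integrand by (-1)^(a + b) = -1.
  · have : c = 0 := integral_shift_pi (fun θ => by simp only [cos_add_two_pi, sin_add_two_pi])
      fun θ => by
        simp only [cos_add_pi, sin_add_pi]
        rw [neg_pow (cos θ), neg_pow (- sin θ), ← mul_assoc, mul_right_comm _ _ ((-1) ^ b),
          ← pow_add, h.neg_one_pow]
        ring
    simp [this]

/-- The points with the same coordinates as `u` off `i`, `j`, `k`. -/
def SameOff (i j k : ι) (u v : USphere ι) : Prop :=
  ∀ l, l ≠ i → l ≠ j → l ≠ k → (v : EuclideanSpace ℝ ι) l = (u : EuclideanSpace ℝ ι) l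

lemma sum_eq_triple {i j k : ι} (hij : i ≠ j) (hik : i ≠ k) (hjk : j ≠ k) (g : ι → ℝ) :
    ∑ l, g l = g i + g j + g k + ∑ l ∈ ((Finset.univ.erase i).erase j).erase k, g l := by
  rw [← Finset.add_sum_erase _ _ (Finset.mem_univ i),
    ← Finset.add_sum_erase _ _ (Finset.mem_erase.2 ⟨hij.symm, Finset.mem_univ j⟩),
    ← Finset.add_sum_erase _ _ (Finset.mem_erase.2 ⟨hjk.symm, Finset.mem_erase.2
      ⟨hik.symm, Finset.mem_univ k⟩⟩)]
  ring

lemma prod_eq_triple {i j k : ι} (hij : i ≠ j) (hik : i ≠ k) (hjk : j ≠ k) (g : ι → ℝ) :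
    ∏ l, g l = g i * g j * g k * ∏ l ∈ ((Finset.univ.erase i).erase j).erase k, g l := by
  rw [← Finset.mul_prod_erase _ _ (Finset.mem_univ i),
    ← Finset.mul_prod_erase _ _ (Finset.mem_erase.2 ⟨hij.symm, Finset.mem_univ j⟩),
    ← Finset.mul_prod_erase _ _ (Finset.mem_erase.2 ⟨hjk.symm, Finset.mem_erase.2
      ⟨hik.symm, Finset.mem_univ k⟩⟩)]
  ring

omit [DecidableEq ι] in
lemma sum_sq_eq_one (u : USphere ι) : ∑ l, (u : EuclideanSpace ℝ ι) l ^ 2 = 1 := by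
  have h : ‖(u : EuclideanSpace ℝ ι)‖ = 1 := by simp
  have := EuclideanSpace.norm_sq_eq (u : EuclideanSpace ℝ ι)
  rw [h] at this
  simpa using this.symm

/-- The squared radius of the fibre of `SameOff`. -/
def tripleSq (i j k : ι) (u : USphere ι) : ℝ :=
  (u : EuclideanSpace ℝ ι) i ^ 2 + (u : EuclideanSpace ℝ ι) j ^ 2 + (u : EuclideanSpace ℝ ι) k ^ 2

lemma SameOff.tripleSq_eq {i j k : ι} (hij : i ≠ j) (hik : i ≠ k) (hjk : j ≠ k) {u v : USphere ι}
    (h : SameOff i j k u v) : tripleSq i j k v = tripleSq i j k u := by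
  have h1 := sum_sq_eq_one u
  have h2 := sum_sq_eq_one v
  rw [sum_eq_triple hij hik hjk] at h1 h2
  have : ∑ l ∈ ((Finset.univ.erase i).erase j).erase k, (v : EuclideanSpace ℝ ι) l ^ 2 =
      ∑ l ∈ ((Finset.univ.erase i).erase j).erase k, (u : EuclideanSpace ℝ ι) l ^ 2 := by
    refine Finset.sum_congr rfl fun l hl => ?_
    simp only [Finset.mem_erase] at hl
    rw [h l hl.2.2.1 hl.2.1 hl.1]
  simp only [tripleSq]
  linarith

/-- The fibre is a full two-dimensional sphere, of squared radius `tripleSq`, in the three free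
coordinates; identities on the fibre thus hold for all (x, y, z) on it. -/
lemma exists_sameOff {i j k : ι} (hij : i ≠ j) (hik : i ≠ k) (hjk : j ≠ k) (u : USphere ι)
    {x y z : ℝ} (h : x ^ 2 + y ^ 2 + z ^ 2 = tripleSq i j k u) :
    ∃ v, SameOff i j k u v ∧ (v : EuclideanSpace ℝ ι) i = x ∧ (v : EuclideanSpace ℝ ι) j = y ∧
      (v : EuclideanSpace ℝ ι) k = z := by
  let w : EuclideanSpace ℝ ι := WithLp.toLp 2 fun l =>
    if l = i then x else if l = j then y else if l = k then z else (u : EuclideanSpace ℝ ι) l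
  have hw : ∀ l, w l = if l = i then x else if l = j then y else if l = k then z
    else (u : EuclideanSpace ℝ ι) l := fun l => rfl
  have wi : w i = x := by simp [hw]
  have wj : w j = y := by simp [hw, hij.symm]
  have wk : w k = z := by simp [hw, hik.symm, hjk.symm]
  have wl : ∀ l, l ≠ i → l ≠ j → l ≠ k → w l = (u : EuclideanSpace ℝ ι) l := fun l h1 h2 h3 => by
    simp [hw, h1, h2, h3]
  have hn : ‖w‖ = 1 := by
    rw [← sq_eq_sq₀ (norm_nonneg _) zero_le_one, EuclideanSpace.norm_sq_eq]
    simp only [Real.norm_eq_abs, sq_abs]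
    have h1 := sum_sq_eq_one u
    rw [sum_eq_triple hij hik hjk] at h1 ⊢
    have : ∑ l ∈ ((Finset.univ.erase i).erase j).erase k, w l ^ 2 =
        ∑ l ∈ ((Finset.univ.erase i).erase j).erase k, (u : EuclideanSpace ℝ ι) l ^ 2 := by
      refine Finset.sum_congr rfl fun l hl => ?_
      simp only [Finset.mem_erase] at hl
      rw [wl l hl.2.2.1 hl.2.1 hl.1]
    rw [this, wi, wj, wk, h]
    rw [tripleSq]
    linarith
  exact ⟨⟨w, by simpa using hn⟩, wl, wi, wj, wk⟩

open Polynomial in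
/-- On a fibre, the average of a polynomial over the rotations in the plane `(i, j)` is a
polynomial in the coordinate `k`. -/
lemma exists_polynomial_rotAvg {i j k : ι} (hij : i ≠ j) (hik : i ≠ k) (hjk : j ≠ k)
    (u : USphere ι) {f : C(USphere ι, ℝ)} {p : MvPolynomial ι ℝ}
    (hf : ∀ v : USphere ι, f v = MvPolynomial.eval (fun l => (v : EuclideanSpace ℝ ι) l) p) :
    ∃ q : ℝ[X], ∀ v, SameOff i j k u v →
      rotAvg i j f v = q.eval ((v : EuclideanSpace ℝ ι) k) := by
  simp only [rotAvg_apply, hf, coe_sphereRot]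
  clear hf f
  have hcont : ∀ (p : MvPolynomial ι ℝ) (v : USphere ι),
      Continuous fun θ => MvPolynomial.eval (fun l => rot i j θ v l) p := fun p v => by
    have h1 : Continuous fun θ : ℝ => (fun l => (rot i j θ (v : EuclideanSpace ℝ ι)) l) := by
      have := continuous_subtype_val.comp (continuous_sphereRot_left i j v)
      exact (PiLp.continuous_ofLp 2 _).comp this
    exact (MvPolynomial.continuous_eval p).comp h1
  induction p using MvPolynomial.induction_on' with
  | monomial s a =>
    obtain ⟨q, hq⟩ := exists_planar_moment (s i) (s j)
    -- Coordinates off the triple are constant on the fibre, coordinate `k` is not rotated, and the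
    -- planar moment depends on the squares of coordinates `i`, `j`, whose sum is `tripleSq` minus
    -- the square of coordinate `k`.
    refine ⟨C (a * ∏ l ∈ ((Finset.univ.erase i).erase j).erase k,
      (u : EuclideanSpace ℝ ι) l ^ s l) * X ^ s k * q.comp (C (tripleSq i j k u) - X ^ 2),
      fun v hv => ?_⟩
    have hm : ∀ θ, MvPolynomial.eval (fun l => rot i j θ (v : EuclideanSpace ℝ ι) l)
        (MvPolynomial.monomial s a) = (a * ∏ l ∈ ((Finset.univ.erase i).erase j).erase k,
          (u : EuclideanSpace ℝ ι) l ^ s l) * (v : EuclideanSpace ℝ ι) k ^ s k *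
          ((cos θ * (v : EuclideanSpace ℝ ι) i + sin θ * (v : EuclideanSpace ℝ ι) j) ^ s i *
          (-sin θ * (v : EuclideanSpace ℝ ι) i + cos θ * (v : EuclideanSpace ℝ ι) j) ^ s j) := by
      intro θ
      rw [MvPolynomial.eval_monomial, Finsupp.prod_fintype _ _ (fun _ => pow_zero _),
        prod_eq_triple hij hik hjk, rot_apply_left hij, rot_apply_right hij,
        rot_apply_of_ne hik.symm hjk.symm]
      have : ∏ l ∈ ((Finset.univ.erase i).erase j).erase k,
            rot i j θ (v : EuclideanSpace ℝ ι) l ^ s l =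
          ∏ l ∈ ((Finset.univ.erase i).erase j).erase k, (u : EuclideanSpace ℝ ι) l ^ s l := by
        refine Finset.prod_congr rfl fun l hl => ?_
        simp only [Finset.mem_erase] at hl
        rw [rot_apply_of_ne hl.2.2.1 hl.2.1, hv l hl.2.2.1 hl.2.1 hl.1]
      rw [this]
      ring
    simp only [hm]
    rw [integral_const_mul, hq, ← hv.tripleSq_eq hij hik hjk]
    simp only [eval_mul, eval_C, eval_pow, eval_X, eval_comp, eval_sub, tripleSq]
    ring_nf
  | add p q hp hq =>
    obtain ⟨a, ha⟩ := hp
    obtain ⟨b, hb⟩ := hq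
    refine ⟨a + b, fun v hv => ?_⟩
    simp only [map_add, eval_add]
    rw [integral_add (integrable_uniform_of_continuous (hcont p v))
      (integrable_uniform_of_continuous (hcont q v)), ha v hv, hb v hv]

-- Average `hs` over rotations in the plane (j, k): `f` becomes p by definition, p does not change,
-- and q, r turn into their images under the Kac operator.
open Polynomial in
lemma fibre_equation {i j k : ι} (hij : i ≠ j) (hik : i ≠ k) (hjk : j ≠ k) {u : USphere ι}
    {f : C(USphere ι, ℝ)} {s : ℝ} {p q r : ℝ[X]}
    (hp : ∀ v, SameOff i j k u v → rotAvg j k f v = p.eval ((v : EuclideanSpace ℝ ι) i))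
    (hs : ∀ v, SameOff i j k u v → s * f v = p.eval ((v : EuclideanSpace ℝ ι) i) +
      q.eval ((v : EuclideanSpace ℝ ι) j) + r.eval ((v : EuclideanSpace ℝ ι) k))
    {x y z : ℝ} (h : x ^ 2 + y ^ 2 + z ^ 2 = tripleSq i j k u) :
    (s - 1) * p.eval x = ∫ θ, q.eval (cos θ * y + sin θ * z) ∂(angleMeasure uniformDensity) +
      ∫ θ, r.eval (cos θ * y + sin θ * z) ∂(angleMeasure uniformDensity) := by
  obtain ⟨v, hv, rfl, rfl, rfl⟩ := exists_sameOff hij hik hjk u h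
  set x := (v : EuclideanSpace ℝ ι) i
  set y := (v : EuclideanSpace ℝ ι) j
  set z := (v : EuclideanSpace ℝ ι) k
  have h1 : ∀ θ, s * f (sphereRot j k θ v) = p.eval x + q.eval (cos θ * y + sin θ * z) +
      r.eval (-sin θ * y + cos θ * z) := fun θ => by
    rw [hs]
    · rw [coe_sphereRot, rot_apply_left hjk, rot_apply_right hjk, rot_apply_of_ne hij hik]
    · intro l hi hj hk
      rw [coe_sphereRot, rot_apply_of_ne hj hk, hv l hi hj hk]
  have h2 : s * p.eval x = ∫ θ, s * f (sphereRot j k θ v) ∂(angleMeasure uniformDensity) := by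
    rw [integral_const_mul, ← rotAvg_apply, hp v hv]
  -- The second rotated coordinate of (y, z) is the first rotated coordinate of (z, -y), so both
  -- have the same law.
  have h3 : ∫ θ, r.eval (-sin θ * y + cos θ * z) ∂(angleMeasure uniformDensity) =
      ∫ θ, r.eval (cos θ * y + sin θ * z) ∂(angleMeasure uniformDensity) := by
    have e1 := eval_kacPoly h r
    have e2 := eval_kacPoly (r := tripleSq i j k u) (t := x) (y := z) (z := -y)
      (by linarith [neg_sq y]) r
    rw [← e1, e2]
    refine integral_congr_ae (Filter.Eventually.of_forall fun θ => ?_)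
    simp only
    ring_nf
  simp only [h1] at h2
  rw [integral_add (integrable_uniform_of_continuous (by fun_prop))
    (integrable_uniform_of_continuous (by fun_prop)), integral_add (integrable_const _)
    (integrable_uniform_of_continuous (by fun_prop)), h3] at h2
  simp only [integral_const, probReal_univ, one_smul] at h2
  linarith

/-- The nonzero eigenvalues of the three-particle operator on polynomials are at least `5 / 4`. -/
lemma triple_eigenvalue {i j k : ι} (hij : i ≠ j) (hik : i ≠ k) (hjk : j ≠ k) {m : ℕ}
    {f : C(USphere ι, ℝ)} (hf : f ∈ sphereAffine ι ^ m) (hf0 : f ≠ 0) {μ : ℝ}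
    (h : (f - rotAvg i j f) + (f - rotAvg j k f) + (f - rotAvg i k f) = μ • f) :
    μ = 0 ∨ 5 / 4 ≤ μ := by
  obtain ⟨u, hu⟩ : ∃ u, f u ≠ 0 := by
    by_contra hne
    push Not at hne
    exact hf0 (ContinuousMap.ext hne)
  by_contra hcon
  push Not at hcon
  obtain ⟨hμ0, hμ⟩ := hcon
  have hs : ∀ v, (3 - μ) * f v = rotAvg j k f v + rotAvg i k f v + rotAvg i j f v := fun v => by
    have := congrArg (fun g : C(USphere ι, ℝ) => g v) h
    simp only [ContinuousMap.add_apply, ContinuousMap.sub_apply, ContinuousMap.smul_apply,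
      smul_eq_mul] at this
    linarith
  obtain ⟨P, hP⟩ := exists_mvPolynomial hf
  obtain ⟨p, hp⟩ := exists_polynomial_rotAvg hjk hij.symm hik.symm u hP
  obtain ⟨q, hq⟩ := exists_polynomial_rotAvg hik hij hjk.symm u hP
  obtain ⟨r, hr⟩ := exists_polynomial_rotAvg hij hik hjk u hP
  have hp' : ∀ v, SameOff i j k u v → rotAvg j k f v = p.eval ((v : EuclideanSpace ℝ ι) i) :=
    fun v hv => hp v fun l a b c => hv l c a b
  have hq' : ∀ v, SameOff i j k u v → rotAvg i k f v = q.eval ((v : EuclideanSpace ℝ ι) j) :=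
    fun v hv => hq v fun l a b c => hv l a c b
  have hsum : ∀ v, SameOff i j k u v → (3 - μ) * f v = p.eval ((v : EuclideanSpace ℝ ι) i) +
      q.eval ((v : EuclideanSpace ℝ ι) j) + r.eval ((v : EuclideanSpace ℝ ι) k) := fun v hv => by
    rw [hs, hp' v hv, hq' v hv, hr v hv]
  have huu : SameOff i j k u u := fun _ _ _ _ => rfl
  -- On a degenerate fibre the three coordinates vanish, all the rotations fix `u`, and the equation
  -- reads `μ * f u = 0`.
  rcases (show 0 ≤ tripleSq i j k u by rw [tripleSq]; positivity).eq_or_lt with h0 | h0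
  · have hz : (u : EuclideanSpace ℝ ι) i = 0 ∧ (u : EuclideanSpace ℝ ι) j = 0 ∧
        (u : EuclideanSpace ℝ ι) k = 0 := by
      rw [tripleSq] at h0
      have a1 := sq_nonneg ((u : EuclideanSpace ℝ ι) i)
      have a2 := sq_nonneg ((u : EuclideanSpace ℝ ι) j)
      have a3 := sq_nonneg ((u : EuclideanSpace ℝ ι) k)
      refine ⟨?_, ?_, ?_⟩ <;> exact (pow_eq_zero_iff two_ne_zero).1 (by linarith)
    have hfix : ∀ a b : ι, a ≠ b → (u : EuclideanSpace ℝ ι) a = 0 →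
        (u : EuclideanSpace ℝ ι) b = 0 → rotAvg a b f u = f u := fun a b hab ha hb => by
      have : ∀ θ, sphereRot a b θ u = u := fun θ => by
        refine Subtype.ext ?_
        ext l
        rw [coe_sphereRot]
        by_cases h1 : l = a
        · subst h1; rw [rot_apply_left hab, ha, hb]; ring
        by_cases h2 : l = b
        · subst h2; rw [rot_apply_right hab, ha, hb]; ring
        rw [rot_apply_of_ne h1 h2]
      simp [rotAvg_apply, this]
    have := hs u
    rw [hfix j k hjk hz.2.1 hz.2.2, hfix i k hik hz.1 hz.2.2, hfix i j hij hz.1 hz.2.1] at this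
    have : μ * f u = 0 := by linarith
    exact (mul_ne_zero hμ0 hu) this
  have e1 : ∀ x y z : ℝ, x ^ 2 + y ^ 2 + z ^ 2 = tripleSq i j k u → _ := fun x y z hxyz =>
    fibre_equation hij hik hjk hp' hsum hxyz
  have hper : ∀ y z : ℝ, ∀ p : Polynomial ℝ, Integrable
      (fun θ => p.eval (cos θ * y + sin θ * z)) (angleMeasure uniformDensity) := fun y z p =>
    integrable_uniform_of_continuous (by fun_prop)
  have e2 : ∀ x y z : ℝ, x ^ 2 + y ^ 2 + z ^ 2 = tripleSq i j k u → _ := fun x y z hxyz =>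
    fibre_equation (u := u) (f := f) (s := 3 - μ) (p := q) (q := p) (r := r)
      hij.symm hjk hik (fun v hv => hq' v fun l a b c => hv l b a c)
      (fun v hv => by rw [hsum v fun l a b c => hv l b a c]; ring)
      (x := x) (y := y) (z := z) (by rw [hxyz]; simp only [tripleSq]; ring)
  have e3 : ∀ x y z : ℝ, x ^ 2 + y ^ 2 + z ^ 2 = tripleSq i j k u → _ := fun x y z hxyz =>
    fibre_equation (u := u) (f := f) (s := 3 - μ) (p := r) (q := p) (r := q)
      hik.symm hjk.symm hij (fun v hv => hr v fun l a b c => hv l c a b)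
      (fun v hv => by rw [hsum v fun l a b c => hv l c a b]; ring)
      (x := x) (y := y) (z := z) (by rw [hxyz]; simp only [tripleSq]; ring)
  -- The three equations add up to K ψ = (2 - μ)/2 · ψ for ψ = p + q + r, K the Kac operator. The
  -- eigenvalue 1 would mean μ = 0, and one at most 3/8 would mean μ ≥ 5/4.
  have hψ : p + q + r = 0 := by
    by_contra hne
    have hk := kac_eigenvalue h0 hne (a := (2 - μ) / 2) fun x y z hxyz => ?_
    · rcases hk with h1 | h1
      · exact hμ0 (by linarith)
      · linarith
    · have h1 := e1 x y z hxyz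
      have h2 := e2 x y z hxyz
      have h3 := e3 x y z hxyz
      have h4 := integral_add ((hper y z p).add (hper y z q)) (hper y z r)
      simp only [Pi.add_apply] at h4
      simp only [Polynomial.eval_add]
      rw [h4, integral_add (hper y z p) (hper y z q)]
      linarith
  -- Subtraction gives K χ = (μ - 2) χ for χ = p - q. The eigenvalue 1 would mean μ = 3, and one at
  -- least -1/2 would mean μ ≥ 3/2.
  have hχ : p - q = 0 := by
    by_contra hne
    have hk := kac_eigenvalue h0 hne (a := -(2 - μ)) fun x y z hxyz => ?_
    · rcases hk with h1 | h1
      · linarith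
      · linarith
    · have h1 := e1 x y z hxyz
      have h2 := e2 x y z hxyz
      simp only [Polynomial.eval_sub]
      rw [integral_sub (hper y z p) (hper y z q)]
      linarith
  have hχ' : p - r = 0 := by
    by_contra hne
    have hk := kac_eigenvalue h0 hne (a := -(2 - μ)) fun x y z hxyz => ?_
    · rcases hk with h1 | h1
      · linarith
      · linarith
    · have h1 := e1 x y z hxyz
      have h3 := e3 x y z hxyz
      simp only [Polynomial.eval_sub]
      rw [integral_sub (hper y z p) (hper y z r)]
      linarith
  have hq0 : q = p := (sub_eq_zero.1 hχ).symm
  have hr0 : r = p := (sub_eq_zero.1 hχ').symm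
  have hev : ∀ x : ℝ, p.eval x = 0 := fun x => by
    rw [hq0, hr0] at hψ
    have := congrArg (Polynomial.eval x) hψ
    simp only [Polynomial.eval_add, Polynomial.eval_zero] at this
    linarith
  have := hsum u huu
  rw [hq0, hr0, hev, hev, hev] at this
  have h3 : (3 - μ) ≠ 0 := by linarith
  exact mul_ne_zero h3 hu (by linarith)

end Fibre

/-! ### Symmetric operators and eigenvalue bounds in finite dimension -/

section Spectral

variable {V : Type*} [AddCommGroup V] [Module ℝ V] [FiniteDimensional ℝ V]
  {B : LinearMap.BilinForm ℝ V} (hB : ∀ x y, B x y = B y x) (hpos : ∀ x, x ≠ 0 → 0 < B x x)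
  {T : V →ₗ[ℝ] V} (hT : ∀ x y, B (T x) y = B x (T y))

include hB hpos hT

/-- The spectral theorem for an operator symmetric for a positive definite bilinear form. -/
lemma exists_eigenbasis : ∃ (n : ℕ) (b : Fin n → V) (μ : Fin n → ℝ),
    (∀ i, b i ≠ 0) ∧ (∀ i, T (b i) = μ i • b i) ∧
      ∀ x y, B x y = ∑ i, B x (b i) * B (b i) y := by
  -- `B` is made into a local inner product, for which the spectral theorem applies to `T`.
  let core : InnerProductSpace.Core ℝ V :=
    { inner := fun x y => B x y
      conj_inner_symm := fun x y => hB y x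
      re_inner_nonneg := fun x => by
        by_cases h : x = 0
        · simp [h]
        · exact (hpos x h).le
      add_left := fun x y z => by simp
      smul_left := fun x y r => by simp
      definite := fun x h => by
        by_contra hx
        exact (hpos x hx).ne' h }
  let _ : NormedAddCommGroup V := core.toNormedAddCommGroup
  let _ : InnerProductSpace ℝ V := InnerProductSpace.ofCore core.toCore
  have hsym : T.IsSymmetric := hT
  refine ⟨_, hsym.eigenvectorBasis rfl, hsym.eigenvalues rfl, fun i => ?_, fun i => ?_, fun x y => ?_⟩
  · exact (hsym.eigenvectorBasis rfl).orthonormal.ne_zero i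
  · exact hsym.apply_eigenvectorBasis rfl i
  · exact ((hsym.eigenvectorBasis rfl).sum_inner_mul_inner x y).symm

/-- In an eigenbasis the claim is c μ ≤ μ² for each eigenvalue, which holds when μ = 0 or μ ≥ c. -/
lemma sq_lower_bound_of_eigenvalues {c : ℝ} (hc : 0 ≤ c)
    (h : ∀ (μ : ℝ) (x : V), x ≠ 0 → T x = μ • x → μ = 0 ∨ c ≤ μ) (x : V) :
    c * B x (T x) ≤ B (T x) (T x) := by
  obtain ⟨n, b, μ, hb0, hb, hexp⟩ := exists_eigenbasis hB hpos hT
  rw [hexp x (T x), hexp (T x) (T x), Finset.mul_sum]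
  refine Finset.sum_le_sum fun i _ => ?_
  have e : B (b i) (T x) = μ i * B x (b i) := by rw [← hT, hb, map_smul]; simp [hB x]
  rw [hB (T x), e]
  have : c * μ i ≤ μ i * μ i := by
    rcases h (μ i) (b i) (hb0 i) (hb i) with h1 | h1
    · simp [h1]
    · exact mul_le_mul_of_nonneg_right h1 (hc.trans h1)
  nlinarith [mul_le_mul_of_nonneg_right this (sq_nonneg (B x (b i)))]

/-- Tested on an eigenvector, `h` and `hT0` give c μ ≤ μ² and μ ≥ 0, hence μ = 0 or c ≤ μ.
Orthogonality to the kernel removes the components with μ = 0. -/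
lemma lower_bound_of_sq_lower_bound {c : ℝ} (h : ∀ x, c * B x (T x) ≤ B (T x) (T x))
    (hT0 : ∀ x, 0 ≤ B x (T x)) {x : V} (hx : ∀ z, T z = 0 → B x z = 0) :
    c * B x x ≤ B x (T x) := by
  obtain ⟨n, b, μ, hb0, hb, hexp⟩ := exists_eigenbasis hB hpos hT
  rw [hexp x (T x), hexp x x, Finset.mul_sum]
  refine Finset.sum_le_sum fun i _ => ?_
  have e : B (b i) (T x) = μ i * B x (b i) := by rw [← hT, hb, map_smul]; simp [hB x]
  rw [e, hB (b i)]
  have hbb := hpos (b i) (hb0 i)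
  have h1 := h (b i)
  have h2 := hT0 (b i)
  simp only [hb, map_smul, LinearMap.smul_apply, smul_eq_mul] at h1 h2
  have h3 : 0 ≤ μ i := nonneg_of_mul_nonneg_left h2 hbb
  rcases h3.eq_or_lt with h4 | h4
  · have : B x (b i) = 0 := hx _ (by rw [hb, ← h4, zero_smul])
    simp [this]
  · have h5 : c ≤ μ i := by
      have := mul_pos h4 hbb
      exact le_of_mul_le_mul_right h1 this
    nlinarith [mul_le_mul_of_nonneg_right h5 (mul_self_nonneg (B x (b i)))]

end Spectral

/-! ### Combinatorics of pairs of pairs -/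

section Caputo

variable {ι : Type*} [Fintype ι] [DecidableEq ι]

lemma sum_eq_pair {i j : ι} (hij : i ≠ j) (g : ι → ℝ) :
    ∑ l, g l = g i + g j + ∑ l ∈ (Finset.univ.erase i).erase j, g l := by
  rw [← Finset.add_sum_erase _ _ (Finset.mem_univ i),
    ← Finset.add_sum_erase _ _ (Finset.mem_erase.2 ⟨hij.symm, Finset.mem_univ j⟩)]
  ring

lemma sum_erase_erase_eq_ite {i j : ι} (hij : i ≠ j) (g : ι → ℝ) :
    ∑ l ∈ (Finset.univ.erase i).erase j, g l =
      ∑ l, if i ≠ j ∧ i ≠ l ∧ j ≠ l then g l else 0 := by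
  rw [← Finset.sum_filter]
  refine Finset.sum_congr ?_ fun _ _ => rfl
  ext l
  simp [hij, and_comm, eq_comm]

/-- The sum over pairs of pairs in Caputo's argument: if the three-particle interactions dominate
and disjoint pairs interact positively, then so does the whole system. -/
lemma pair_sum_lower_bound {q : ι → ι → ι → ι → ℝ} (h1 : ∀ i j k l, q i j k l = q j i k l)
    (h2 : ∀ i j k l, q i j k l = q i j l k) (h3 : ∀ i j k l, q i j k l = q k l i j)
    (h0 : ∀ i k l, q i i k l = 0)
    (hpos : ∀ i j k l, i ≠ k → i ≠ l → j ≠ k → j ≠ l → 0 ≤ q i j k l)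
    (htri : ∀ i j k, i ≠ j → i ≠ k → j ≠ k → 1 / 4 * (q i j i j + q j k j k + q i k i k) ≤
      2 * (q i j j k + q j k i k + q i j i k)) :
    ((Fintype.card ι : ℝ) + 2) / 2 * ∑ i, ∑ j, q i j i j ≤ ∑ i, ∑ j, ∑ k, ∑ l, q i j k l := by
  set F : ι → ι → ι → ℝ := fun i j l => if i ≠ j ∧ i ≠ l ∧ j ≠ l then q i j j l else 0 with hF
  set G : ι → ι → ι → ℝ := fun i j l => if i ≠ j ∧ i ≠ l ∧ j ≠ l then q i j i j else 0 with hG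
  set X := ∑ i, ∑ j, ∑ l, F i j l with hX
  set S := ∑ i, ∑ j, q i j i j with hS
  have h0' : ∀ i k l, q k l i i = 0 := fun i k l => by rw [h3, h0]
  -- the contribution of a fixed pair
  have hpair : ∀ i j, 2 * q i j i j + 2 * ∑ l, (F i j l + F j i l) ≤ ∑ k, ∑ l, q i j k l := by
    intro i j
    by_cases hij : i = j
    · subst hij
      simp [h0, hF]
    have e1 : ∑ l, F i j l = ∑ l ∈ (Finset.univ.erase i).erase j, q i j j l :=
      (sum_erase_erase_eq_ite hij fun l => q i j j l).symm
    have e2 : ∑ l, F j i l = ∑ l ∈ (Finset.univ.erase i).erase j, q i j i l := by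
      rw [Finset.erase_right_comm, sum_erase_erase_eq_ite (Ne.symm hij)]
      refine Finset.sum_congr rfl fun l _ => ?_
      simp only [hF, h1 j i]
    rw [Finset.sum_add_distrib, e1, e2, sum_eq_pair hij, sum_eq_pair hij, sum_eq_pair hij (q i j j)]
    -- For k outside {i, j}, the pairs (k, l) with l in {i, j} are kept and the disjoint ones, being
    -- nonnegative, are dropped.
    have e3 : ∀ k ∈ (Finset.univ.erase i).erase j,
        q i j i k + q i j j k ≤ ∑ l, q i j k l := fun k hk => by
      rw [sum_eq_pair hij, h2 i j k i, h2 i j k j]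
      have : 0 ≤ ∑ l ∈ (Finset.univ.erase i).erase j, q i j k l :=
        Finset.sum_nonneg fun l hl => by
          simp only [Finset.mem_erase] at hk hl
          exact hpos i j k l (Ne.symm hk.2.1) (Ne.symm hl.2.1) (Ne.symm hk.1) (Ne.symm hl.1)
      linarith
    have e4 := Finset.sum_le_sum e3
    rw [Finset.sum_add_distrib] at e4
    rw [h0', h0', h2 i j j i]
    linarith
  have hsum : 2 * S + 4 * X ≤ ∑ i, ∑ j, ∑ k, ∑ l, q i j k l := by
    have := Finset.sum_le_sum fun i (_ : i ∈ Finset.univ) =>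
      Finset.sum_le_sum fun j (_ : j ∈ Finset.univ) => hpair i j
    simp only [Finset.sum_add_distrib, ← Finset.mul_sum] at this
    have e : ∑ i, ∑ j, ∑ l, F j i l = X := Finset.sum_comm
    rw [e] at this
    linarith
  have htri' : ∀ i j k, 1 / 4 * (G i j k + G j k i + G k i j) ≤
      2 * (F i j k + F j k i + F k i j) := by
    intro i j k
    by_cases h : i ≠ j ∧ i ≠ k ∧ j ≠ k
    · have hb : j ≠ k ∧ j ≠ i ∧ k ≠ i := ⟨h.2.2, h.1.symm, h.2.1.symm⟩
      have hc : k ≠ i ∧ k ≠ j ∧ i ≠ j := ⟨h.2.1.symm, h.2.2.symm, h.1⟩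
      have := htri i j k h.1 h.2.1 h.2.2
      simp only [hF, hG, if_pos h, if_pos hb, if_pos hc]
      have e1 : q k i k i = q i k i k := by rw [h1, h2]
      have e2 : q j k k i = q j k i k := h2 _ _ _ _
      have e3 : q k i i j = q i j i k := by rw [h3, h2]
      rw [e1, e2, e3]
      linarith
    · have hb : ¬ (j ≠ k ∧ j ≠ i ∧ k ≠ i) := fun hb => h ⟨hb.2.1.symm, hb.2.2.symm, hb.1⟩
      have hc : ¬ (k ≠ i ∧ k ≠ j ∧ i ≠ j) := fun hb => h ⟨hb.2.2, hb.1.symm, hb.2.1.symm⟩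
      simp only [hF, hG, if_neg h, if_neg hb, if_neg hc]
      norm_num
  have hcyc : ∀ H : ι → ι → ι → ℝ, ∑ i, ∑ j, ∑ k, H j k i = ∑ i, ∑ j, ∑ k, H i j k := fun H => by
    rw [Finset.sum_comm]
    exact Finset.sum_congr rfl fun j _ => Finset.sum_comm
  -- Each pair lies in card - 2 triangles.
  have hGsum : ∑ i, ∑ j, ∑ k, G i j k = ((Fintype.card ι : ℝ) - 2) * S := by
    rw [hS, Finset.mul_sum]
    refine Finset.sum_congr rfl fun i _ => ?_
    rw [Finset.mul_sum]
    refine Finset.sum_congr rfl fun j _ => ?_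
    by_cases hij : i = j
    · subst hij
      simp [hG, h0]
    have e1 : ∑ l, G i j l = ∑ l ∈ (Finset.univ.erase i).erase j, q i j i j :=
      (sum_erase_erase_eq_ite hij fun l => q i j i j).symm
    have e2 := sum_eq_pair hij (fun _ => q i j i j)
    rw [e1]
    simp only [Finset.sum_const, Finset.card_univ, nsmul_eq_mul] at e2 ⊢
    linarith
  -- This says X ≥ (card - 2) S / 8; inserted in 2S + 4X it gives (card + 2) S / 2.
  have hfin : 1 / 4 * (3 * ((Fintype.card ι : ℝ) - 2) * S) ≤ 2 * (3 * X) := by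
    have := Finset.sum_le_sum fun i (_ : i ∈ Finset.univ) =>
      Finset.sum_le_sum fun j (_ : j ∈ Finset.univ) =>
        Finset.sum_le_sum fun k (_ : k ∈ Finset.univ) => htri' i j k
    simp only [Finset.sum_add_distrib, ← Finset.mul_sum] at this
    rw [hcyc F, hcyc G, ← hcyc (fun i j k => F k i j), ← hcyc (fun i j k => G k i j), hGsum] at this
    linarith
  linarith

end Caputo

variable {ι : Type} [DecidableEq ι] [Fintype ι]

/-! ### Planar rotations act transitively on the sphere -/

section Transitivity

/-- A function on the sphere invariant under all planar rotations is constant. -/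
lemma eq_of_forall_sphereRot [Nontrivial ι] {f : USphere ι → ℝ}
    (hf : ∀ i j θ u, f (sphereRot i j θ u) = f u) (u v : USphere ι) : f u = f v := by
  obtain ⟨i⟩ := (inferInstance : Nonempty ι)
  -- Rotating the plane (i, j) by the argument of (η_i, η_j) puts coordinate j to zero and makes
  -- coordinate i nonnegative. At least one rotation is needed to fix the sign of coordinate i, so
  -- `s` is nonempty.
  have step : ∀ s : Finset ι, s.Nonempty → i ∉ s → ∀ u : USphere ι, ∃ w : USphere ι, f w = f u ∧
      0 ≤ (w : EuclideanSpace ℝ ι) i ∧ ∀ j ∈ s, (w : EuclideanSpace ℝ ι) j = 0 := by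
    have one : ∀ j, i ≠ j → ∀ u : USphere ι, ∃ w : USphere ι, f w = f u ∧
        0 ≤ (w : EuclideanSpace ℝ ι) i ∧ (w : EuclideanSpace ℝ ι) j = 0 ∧
        ∀ k, k ≠ i → k ≠ j → (w : EuclideanSpace ℝ ι) k = (u : EuclideanSpace ℝ ι) k := by
      intro j hij u
      set z : ℂ := ⟨(u : EuclideanSpace ℝ ι) i, (u : EuclideanSpace ℝ ι) j⟩ with hz
      have hx : (u : EuclideanSpace ℝ ι) i = ‖z‖ * cos z.arg := (Complex.norm_mul_cos_arg z).symm
      have hy : (u : EuclideanSpace ℝ ι) j = ‖z‖ * sin z.arg := (Complex.norm_mul_sin_arg z).symm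
      refine ⟨sphereRot i j z.arg u, hf _ _ _ _, ?_, ?_, fun k h1 h2 => ?_⟩
      · rw [coe_sphereRot, rot_apply_left hij]
        have : cos z.arg * (u : EuclideanSpace ℝ ι) i + sin z.arg * (u : EuclideanSpace ℝ ι) j =
            ‖z‖ := by
          linear_combination cos z.arg * hx + sin z.arg * hy + ‖z‖ * sin_sq_add_cos_sq z.arg
        rw [this]
        exact norm_nonneg z
      · rw [coe_sphereRot, rot_apply_right hij]
        linear_combination -sin z.arg * hx + cos z.arg * hy
      · rw [coe_sphereRot, rot_apply_of_ne h1 h2]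
    intro s hs
    induction hs using Finset.Nonempty.cons_induction with
    | singleton j =>
      intro hi u
      obtain ⟨w, h1, h2, h3, -⟩ := one j (by simpa using hi) u
      exact ⟨w, h1, h2, by simpa using h3⟩
    | cons j s hj hs ih =>
      intro hi u
      simp only [Finset.mem_cons, not_or] at hi
      obtain ⟨w, h1, -, h3⟩ := ih hi.2 u
      obtain ⟨w', h1', h2', h3', h4'⟩ := one j hi.1 w
      refine ⟨w', h1'.trans h1, h2', fun k hk => ?_⟩
      rcases Finset.mem_cons.1 hk with rfl | hk
      · exact h3'
      · rw [h4' k (fun e => hi.2 (e ▸ hk)) (fun e => hj (e ▸ hk)), h3 k hk]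
  obtain ⟨j, hj⟩ := exists_ne i
  have hne : (Finset.univ.erase i).Nonempty := ⟨j, Finset.mem_erase.2 ⟨hj, Finset.mem_univ j⟩⟩
  obtain ⟨u', hu', hu0, hu⟩ := step _ hne (Finset.notMem_erase i _) u
  obtain ⟨v', hv', hv0, hv⟩ := step _ hne (Finset.notMem_erase i _) v
  have hone : ∀ w : USphere ι, 0 ≤ (w : EuclideanSpace ℝ ι) i →
      (∀ j ∈ Finset.univ.erase i, (w : EuclideanSpace ℝ ι) j = 0) →
      (w : EuclideanSpace ℝ ι) i = 1 := fun w h0 h => by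
    have h1 := sum_sq_eq_one w
    rw [← Finset.add_sum_erase _ _ (Finset.mem_univ i), Finset.sum_eq_zero (s := Finset.univ.erase i)
      (fun j hj => by rw [h j hj]; ring), add_zero] at h1
    nlinarith
  have : u' = v' := by
    refine Subtype.ext ?_
    ext k
    by_cases hk : k = i
    · rw [hk, hone u' hu0 hu, hone v' hv0 hv]
    · rw [hu k (by simp [hk]), hv k (by simp [hk])]
  rw [← hu', ← hv', this]

end Transitivity

/-! ### The Kac gap on polynomials -/

section RotLap

/-- The operator `1 - rotAvg`. -/
def rotLap (i j : ι) : C(USphere ι, ℝ) →ₗ[ℝ] C(USphere ι, ℝ) := LinearMap.id - rotAvg i j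

lemma rotLap_apply (i j : ι) (f : C(USphere ι, ℝ)) : rotLap i j f = f - rotAvg i j f := rfl

lemma rotLap_swap (i j : ι) : (rotLap j i : C(USphere ι, ℝ) →ₗ[ℝ] C(USphere ι, ℝ)) = rotLap i j := by
  rw [rotLap, rotLap, rotAvg_swap]

lemma rotLap_self (i : ι) : (rotLap i i : C(USphere ι, ℝ) →ₗ[ℝ] C(USphere ι, ℝ)) = 0 := by
  rw [rotLap, rotAvg_self, sub_self]

lemma rotLap_rotLap (i j : ι) (f : C(USphere ι, ℝ)) : rotLap i j (rotLap i j f) = rotLap i j f := by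
  simp [rotLap_apply, rotAvg_rotAvg]

lemma rotLap_mem (i j : ι) (m : ℕ) {f : C(USphere ι, ℝ)} (hf : f ∈ sphereAffine ι ^ m) :
    rotLap i j f ∈ sphereAffine ι ^ m := sub_mem hf (rotAvg_mem i j m hf)

lemma rotLap_one (i j : ι) : rotLap i j (1 : C(USphere ι, ℝ)) = 0 := by
  ext u
  simp [rotLap_apply, rotAvg_apply]

variable [Nonempty ι]

lemma sphereForm_rotLap (i j : ι) (f g : C(USphere ι, ℝ)) :
    sphereForm ι (rotLap i j f) g = sphereForm ι f (rotLap i j g) := by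
  simp [rotLap_apply, sphereForm_rotAvg]

lemma sphereForm_rotLap_self (i j : ι) (f : C(USphere ι, ℝ)) :
    sphereForm ι (rotLap i j f) (rotLap i j f) = sphereForm ι f (rotLap i j f) := by
  rw [sphereForm_rotLap, rotLap_rotLap]

/-- Rotations in disjoint planes commute, and the product of two commuting orthogonal projections is
an orthogonal projection. -/
lemma sphereForm_rotLap_nonneg {i j k l : ι} (hik : i ≠ k) (hil : i ≠ l) (hjk : j ≠ k)
    (hjl : j ≠ l) (f : C(USphere ι, ℝ)) :
    0 ≤ sphereForm ι (rotLap i j f) (rotLap k l f) := by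
  have hc : rotLap i j (rotLap k l f) = rotLap k l (rotLap i j f) := by
    simp only [rotLap_apply, map_sub, rotAvg_comm hik hil hjk hjl]
    abel
  have : sphereForm ι (rotLap i j f) (rotLap k l f) =
      sphereForm ι (rotLap i j (rotLap k l f)) (rotLap i j (rotLap k l f)) := by
    calc sphereForm ι (rotLap i j f) (rotLap k l f)
        = sphereForm ι (rotLap i j f) (rotLap k l (rotLap k l f)) := by rw [rotLap_rotLap]
      _ = sphereForm ι (rotLap i j (rotLap k l f)) (rotLap k l f) := by
        rw [← sphereForm_rotLap, hc]
      _ = _ := by rw [sphereForm_rotLap_self, sphereForm_comm]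
  rw [this]
  exact sphereForm_self_nonneg _

/-- The spectral bounds of `Spectral` for symmetric operators on continuous functions that leave a
finite-dimensional subspace invariant. -/
lemma sphereForm_sq_lower_bound {W : Submodule ℝ C(USphere ι, ℝ)} [FiniteDimensional ℝ W]
    {T : C(USphere ι, ℝ) →ₗ[ℝ] C(USphere ι, ℝ)} (hTW : ∀ f ∈ W, T f ∈ W)
    (hT : ∀ f g, sphereForm ι (T f) g = sphereForm ι f (T g)) {c : ℝ} (hc : 0 ≤ c)
    (h : ∀ (μ : ℝ), ∀ f ∈ W, f ≠ 0 → T f = μ • f → μ = 0 ∨ c ≤ μ) {f : C(USphere ι, ℝ)}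
    (hf : f ∈ W) : c * sphereForm ι f (T f) ≤ sphereForm ι (T f) (T f) :=
  sq_lower_bound_of_eigenvalues (B := (sphereForm ι).restrict W) (T := T.restrict hTW)
    (fun _ _ => sphereForm_comm _ _)
    (fun _ hx => sphereForm_self_pos fun h => hx (Subtype.ext h)) (fun _ _ => hT _ _) hc
    (fun μ x hx hμ => h μ x x.2 (fun h => hx (Subtype.ext h)) (congrArg Subtype.val hμ)) ⟨f, hf⟩

lemma sphereForm_lower_bound {W : Submodule ℝ C(USphere ι, ℝ)} [FiniteDimensional ℝ W]
    {T : C(USphere ι, ℝ) →ₗ[ℝ] C(USphere ι, ℝ)} (hTW : ∀ f ∈ W, T f ∈ W)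
    (hT : ∀ f g, sphereForm ι (T f) g = sphereForm ι f (T g)) {c : ℝ}
    (h : ∀ f ∈ W, c * sphereForm ι f (T f) ≤ sphereForm ι (T f) (T f))
    (hT0 : ∀ f, 0 ≤ sphereForm ι f (T f)) {f : C(USphere ι, ℝ)} (hf : f ∈ W)
    (hker : ∀ g ∈ W, T g = 0 → sphereForm ι f g = 0) :
    c * sphereForm ι f f ≤ sphereForm ι f (T f) :=
  lower_bound_of_sq_lower_bound (B := (sphereForm ι).restrict W) (T := T.restrict hTW)
    (fun _ _ => sphereForm_comm _ _)
    (fun _ hx => sphereForm_self_pos fun h => hx (Subtype.ext h)) (fun _ _ => hT _ _)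
    (fun x => h x x.2) (fun x => hT0 x) (x := ⟨f, hf⟩)
    (fun z hz => hker z z.2 (congrArg Subtype.val hz))

/-- This is T² ≥ (5/4) T for T = D_ij + D_jk + D_ik, expanded. Since D² = D, the diagonal of T² uses
up one unit of 5/4 and the cross terms must supply the remaining 1/4. -/
lemma triple_form {i j k : ι} (hij : i ≠ j) (hik : i ≠ k) (hjk : j ≠ k) {m : ℕ}
    {f : C(USphere ι, ℝ)} (hf : f ∈ sphereAffine ι ^ m) :
    1 / 4 * (sphereForm ι (rotLap i j f) (rotLap i j f) +
        sphereForm ι (rotLap j k f) (rotLap j k f) + sphereForm ι (rotLap i k f) (rotLap i k f)) ≤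
      2 * (sphereForm ι (rotLap i j f) (rotLap j k f) +
        sphereForm ι (rotLap j k f) (rotLap i k f) + sphereForm ι (rotLap i j f) (rotLap i k f)) := by
  have := sphereForm_sq_lower_bound (T := rotLap i j + rotLap j k + rotLap i k)
    (W := sphereAffine ι ^ m) (c := 5 / 4)
    (fun f hf => add_mem (add_mem (rotLap_mem i j m hf) (rotLap_mem j k m hf)) (rotLap_mem i k m hf))
    (fun f g => by simp only [LinearMap.add_apply, map_add, sphereForm_rotLap]) (by norm_num)
    (fun μ f hf hf0 hμ => triple_eigenvalue hij hik hjk hf hf0 hμ) hf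
  simp only [LinearMap.add_apply, map_add, ← sphereForm_rotLap_self] at this
  have c1 := sphereForm_comm (rotLap i j f) (rotLap j k f)
  have c2 := sphereForm_comm (rotLap i j f) (rotLap i k f)
  have c3 := sphereForm_comm (rotLap j k f) (rotLap i k f)
  linarith

/-- The spectral gap of the Kac walk, for polynomials. -/
lemma kac_gap_polynomial [Nontrivial ι] {m : ℕ} {f : C(USphere ι, ℝ)}
    (hf : f ∈ sphereAffine ι ^ m) :
    ((Fintype.card ι : ℝ) + 2) / 2 *
        (∫ u, f u ^ 2 ∂(unitSphereMeasure ι) - (∫ u, f u ∂(unitSphereMeasure ι)) ^ 2) ≤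
      ∑ i, ∑ j, energy (unitSphereMeasure ι) (sphereRot i j) (angleMeasure uniformDensity) f := by
  set T : C(USphere ι, ℝ) →ₗ[ℝ] C(USphere ι, ℝ) := ∑ i, ∑ j, rotLap i j with hTdef
  have hTapp : ∀ f, T f = ∑ i, ∑ j, rotLap i j f := fun f => by
    simp [hTdef, LinearMap.sum_apply]
  have hTW : ∀ f ∈ sphereAffine ι ^ m, T f ∈ sphereAffine ι ^ m := fun f hf => by
    rw [hTapp]
    exact sum_mem fun i _ => sum_mem fun j _ => rotLap_mem i j m hf
  have hT : ∀ f g, sphereForm ι (T f) g = sphereForm ι f (T g) := fun f g => by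
    simp only [hTapp, map_sum, LinearMap.sum_apply, sphereForm_rotLap]
  have hTf : ∀ f, sphereForm ι f (T f) =
      ∑ i, ∑ j, sphereForm ι (rotLap i j f) (rotLap i j f) := fun f => by
    simp only [hTapp, map_sum, sphereForm_rotLap_self]
  have hT0 : ∀ f, 0 ≤ sphereForm ι f (T f) := fun f => by
    rw [hTf]
    exact Finset.sum_nonneg fun i _ => Finset.sum_nonneg fun j _ => sphereForm_self_nonneg _
  have hsq : ∀ f ∈ sphereAffine ι ^ m, ((Fintype.card ι : ℝ) + 2) / 2 * sphereForm ι f (T f) ≤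
      sphereForm ι (T f) (T f) := fun f hf => by
    have := pair_sum_lower_bound
      (q := fun i j k l => sphereForm ι (rotLap i j f) (rotLap k l f))
      (fun i j k l => by rw [rotLap_swap]) (fun i j k l => by rw [rotLap_swap k l])
      (fun i j k l => sphereForm_comm _ _) (fun i k l => by rw [rotLap_self]; simp)
      (fun i j k l a b c d => sphereForm_rotLap_nonneg a b c d f)
      (fun i j k a b c => triple_form a b c hf)
    rw [hTf]
    refine this.trans_eq ?_
    have e : ∀ g, sphereForm ι (T f) g = ∑ i, ∑ j, sphereForm ι (rotLap i j f) g := fun g => by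
      simp only [hTapp, map_sum, LinearMap.sum_apply]
    rw [e]
    simp only [hTapp, map_sum]
  -- The form of `T` is a sum of squares, so each `rotLap i j g` vanishes; `g` is then invariant
  -- under all planar rotations.
  have hker : ∀ g, T g = 0 → ∀ u v, g u = g v := fun g hg => by
    refine fun u v => eq_of_forall_sphereRot (f := g) (fun i j θ w => ?_) u v
    have h1 := hTf g
    rw [hg, map_zero, eq_comm, Finset.sum_eq_zero_iff_of_nonneg fun i _ =>
      Finset.sum_nonneg fun j _ => sphereForm_self_nonneg _] at h1
    have h2 := h1 i (Finset.mem_univ i)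
    rw [Finset.sum_eq_zero_iff_of_nonneg fun j _ => sphereForm_self_nonneg _] at h2
    have h3 : rotLap i j g = 0 := by
      by_contra hne
      exact (sphereForm_self_pos hne).ne' (h2 j (Finset.mem_univ j))
    have h4 : rotAvg i j g = g := (sub_eq_zero.1 h3).symm
    rw [← h4, rotAvg_sphereRot]
  set c := ∫ u, f u ∂(unitSphereMeasure ι)
  have hf' : f - c • 1 ∈ sphereAffine ι ^ m :=
    sub_mem hf (Submodule.smul_mem _ _ (one_mem_sphereAffine_pow m))
  have hmean : ∫ u, (f - c • (1 : C(USphere ι, ℝ))) u ∂(unitSphereMeasure ι) = 0 := by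
    simp only [ContinuousMap.sub_apply, ContinuousMap.smul_apply, ContinuousMap.one_apply,
      smul_eq_mul, mul_one]
    rw [integral_sub (integrable_continuous f) (integrable_const _)]
    simp [c]
  have key := sphereForm_lower_bound hTW hT hsq hT0 hf' fun g _ hg => by
    obtain ⟨u₀⟩ : Nonempty (USphere ι) :=
      (NormedSpace.sphere_nonempty.2 zero_le_one).to_subtype
    rw [sphereForm_apply]
    simp only [hker g hg _ u₀]
    rw [integral_mul_const, hmean, zero_mul]
  have e1 : sphereForm ι (f - c • 1) (f - c • 1) = ∫ u, f u ^ 2 ∂(unitSphereMeasure ι) - c ^ 2 := by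
    have a1 : sphereForm ι f 1 = c := by simp [sphereForm_apply, c]
    have a2 : sphereForm ι (1 : C(USphere ι, ℝ)) 1 = 1 := by simp [sphereForm_apply]
    have a3 : sphereForm ι f f = ∫ u, f u ^ 2 ∂(unitSphereMeasure ι) := by
      simp only [sphereForm_apply, sq]
    simp only [map_sub, LinearMap.sub_apply, map_smul, LinearMap.smul_apply, smul_eq_mul,
      sphereForm_comm 1 f, a1, a2, a3]
    ring
  have e2 : sphereForm ι (f - c • 1) (T (f - c • 1)) = ∑ i, ∑ j,
      energy (unitSphereMeasure ι) (sphereRot i j) (angleMeasure uniformDensity) f := by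
    rw [hTf]
    refine Finset.sum_congr rfl fun i _ => Finset.sum_congr rfl fun j _ => ?_
    rw [map_sub, map_smul, rotLap_one, smul_zero, sub_zero, sphereForm_rotLap_self,
      energy_eq_sphereForm, rotLap_apply]
  rwa [e1, e2] at key

end RotLap

/-! ### Stability of variance and energy under L² perturbation -/

section Approximation

lemma integral_sq_eq_eLpNorm_sq {X : Type*} [MeasurableSpace X] {ν : Measure X} {f : X → ℝ}
    (hf : MemLp f 2 ν) : ∫ x, f x ^ 2 ∂ν = (eLpNorm f 2 ν).toReal ^ 2 := by
  rw [hf.eLpNorm_eq_integral_rpow_norm two_ne_zero ENNReal.ofNat_ne_top,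
    ENNReal.toReal_ofReal (by positivity)]
  have h : 0 ≤ ∫ x, f x ^ 2 ∂ν := integral_nonneg fun _ => sq_nonneg _
  simp only [ENNReal.toReal_ofNat, rpow_two, Real.norm_eq_abs, sq_abs]
  rw [← rpow_natCast, ← rpow_mul h]
  norm_num

variable {X : Type*} [MeasurableSpace X] {ν : Measure X}

/-- The weight `δ` keeps the coefficient of `b ^ 2` close to 1 at the price of 1/δ on the error, so
no constant is lost in the limit. -/
lemma sq_perturb {δ : ℝ} (hδ : 0 < δ) (a b : ℝ) :
    (1 - δ) * b ^ 2 - 1 / δ * (a - b) ^ 2 ≤ a ^ 2 := by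
  have h : a ^ 2 - ((1 - δ) * b ^ 2 - 1 / δ * (a - b) ^ 2) =
      1 / δ * (δ * b + (a - b)) ^ 2 + (a - b) ^ 2 := by
    field_simp
    ring
  have : 0 ≤ 1 / δ * (δ * b + (a - b)) ^ 2 + (a - b) ^ 2 := by positivity
  linarith

lemma integral_sq_perturb {F G : X → ℝ} (hF : MemLp F 2 ν) (hG : MemLp G 2 ν) {δ : ℝ} (hδ : 0 < δ) :
    (1 - δ) * ∫ x, G x ^ 2 ∂ν - 1 / δ * ∫ x, (F x - G x) ^ 2 ∂ν ≤ ∫ x, F x ^ 2 ∂ν := by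
  have h1 := hG.integrable_sq.const_mul (1 - δ)
  have h2 : Integrable (fun x => 1 / δ * (F x - G x) ^ 2) ν :=
    (hF.sub hG).integrable_sq.const_mul (1 / δ)
  rw [← integral_const_mul, ← integral_const_mul, ← integral_sub h1 h2]
  exact integral_mono (h1.sub h2) hF.integrable_sq fun x => sq_perturb hδ _ _

lemma sqIncr_perturb {A : X → X} (hA : MeasurePreserving A ν ν) {F G : X → ℝ} (hF : MemLp F 2 ν)
    (hG : MemLp G 2 ν) {δ : ℝ} (hδ : 0 < δ) :
    (1 - δ) * sqIncr ν A G - 1 / δ * (4 * ∫ x, (F x - G x) ^ 2 ∂ν) ≤ sqIncr ν A F := by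
  have h := integral_sq_perturb ((hF.comp_measurePreserving hA).sub hF)
    ((hG.comp_measurePreserving hA).sub hG) hδ
  have h2 := sqIncr_le hA (hF.sub hG)
  simp only [Pi.sub_apply, Function.comp] at h
  simp only [Pi.sub_apply, sqIncr] at h2 ⊢
  have e : ∀ x, F (A x) - F x - (G (A x) - G x) = F (A x) - G (A x) - (F x - G x) := fun x => by
    ring
  simp only [e] at h
  have : 1 / δ * ∫ x, (F (A x) - G (A x) - (F x - G x)) ^ 2 ∂ν ≤
      1 / δ * (4 * ∫ x, (F x - G x) ^ 2 ∂ν) := mul_le_mul_of_nonneg_left h2 (by positivity)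
  linarith

variable [IsProbabilityMeasure ν]

lemma energy_perturb {T : ℝ → X → X} (hT : IsCircleFlow T ν) {F G : X → ℝ} (hF : MemLp F 2 ν)
    (hG : MemLp G 2 ν) {δ : ℝ} (hδ : 0 < δ) :
    (1 - δ) * energy ν T (angleMeasure uniformDensity) G -
      2 / δ * ∫ x, (F x - G x) ^ 2 ∂ν ≤ energy ν T (angleMeasure uniformDensity) F := by
  have h1 := hT.integrable_sqIncr (angleMeasure uniformDensity) hF
  have h2 := (hT.integrable_sqIncr (angleMeasure uniformDensity) hG).const_mul (1 - δ)
  have h3 : Integrable (fun _ : ℝ => 1 / δ * (4 * ∫ x, (F x - G x) ^ 2 ∂ν))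
    (angleMeasure uniformDensity) := integrable_const _
  have := integral_mono (h2.sub h3) h1 fun θ => sqIncr_perturb (hT.mp θ) hF hG hδ
  simp only [Pi.sub_apply] at this
  rw [integral_sub h2 h3, integral_const_mul] at this
  simp only [integral_const, probReal_univ, one_smul] at this
  simp only [energy]
  have e : 2 / δ * ∫ x, (F x - G x) ^ 2 ∂ν = 1 / 2 * (1 / δ * (4 * ∫ x, (F x - G x) ^ 2 ∂ν)) := by
    ring
  rw [e]
  linarith

lemma integral_sub_mean_sq {F : X → ℝ} (hF : MemLp F 2 ν) :
    ∫ x, (F x - ∫ y, F y ∂ν) ^ 2 ∂ν = ∫ x, F x ^ 2 ∂ν - (∫ x, F x ∂ν) ^ 2 := by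
  set c := ∫ y, F y ∂ν
  have h1 := hF.integrable_sq
  have h2 := hF.integrable one_le_two
  have e : ∀ x, (F x - c) ^ 2 = F x ^ 2 - (2 * c * F x - c ^ 2) := fun x => by ring
  simp only [e]
  have h3 : Integrable (fun x => 2 * c * F x) ν := h2.const_mul _
  have h4 : Integrable (fun _ : X => c ^ 2) ν := integrable_const _
  have h5 : Integrable (fun x => 2 * c * F x - c ^ 2) ν := h3.sub h4
  rw [integral_sub h1 h5, integral_sub h3 h4, integral_const_mul]
  simp only [integral_const, probReal_univ, one_smul]
  ring

lemma variance_perturb {F G : X → ℝ} (hF : MemLp F 2 ν) (hG : MemLp G 2 ν) {δ : ℝ} (hδ : 0 < δ) :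
    (1 - δ) * (∫ x, F x ^ 2 ∂ν - (∫ x, F x ∂ν) ^ 2) - 1 / δ * ∫ x, (F x - G x) ^ 2 ∂ν ≤
      ∫ x, G x ^ 2 ∂ν - (∫ x, G x ∂ν) ^ 2 := by
  have h := integral_sq_perturb (hG.sub (memLp_const (∫ x, G x ∂ν)))
    (hF.sub (memLp_const (∫ x, F x ∂ν))) hδ
  simp only [Pi.sub_apply] at h
  rw [integral_sub_mean_sq hF, integral_sub_mean_sq hG] at h
  have h2 := integral_sub_mean_sq (hF.sub hG)
  simp only [Pi.sub_apply] at h2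
  rw [integral_sub (hF.integrable one_le_two) (hG.integrable one_le_two)] at h2
  have e : ∀ x, (G x - ∫ y, G y ∂ν - (F x - ∫ y, F y ∂ν)) ^ 2 =
      (F x - G x - (∫ y, F y ∂ν - ∫ y, G y ∂ν)) ^ 2 := fun x => by ring
  simp only [e] at h
  rw [h2] at h
  have : 1 / δ * (∫ x, (F x - G x) ^ 2 ∂ν - (∫ y, F y ∂ν - ∫ y, G y ∂ν) ^ 2) ≤
      1 / δ * ∫ x, (F x - G x) ^ 2 ∂ν :=
    mul_le_mul_of_nonneg_left (by linarith [sq_nonneg (∫ y, F y ∂ν - ∫ y, G y ∂ν)]) (by positivity)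
  linarith

end Approximation

/-! ### The Kac gap on L² by density of polynomials -/

section KacGap

variable {ι : Type} [Fintype ι]

/-- Polynomials are dense in `L²` of the sphere. -/
lemma exists_polynomial_near [Nonempty ι] {F : USphere ι → ℝ} (hF : MemLp F 2 (unitSphereMeasure ι))
    {ε : ℝ} (hε : 0 < ε) : ∃ (m : ℕ) (p : C(USphere ι, ℝ)), p ∈ sphereAffine ι ^ m ∧
      ∫ u, (F u - p u) ^ 2 ∂(unitSphereMeasure ι) ≤ 4 * ε ^ 2 := by
  obtain ⟨g, hg, hgL⟩ := hF.exists_boundedContinuous_eLpNorm_sub_le ENNReal.ofNat_ne_top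
    (ε := ENNReal.ofReal ε) (by simpa using hε)
  have hsep : (Algebra.adjoin ℝ (Set.range (sphereCoord (ι := ι)))).SeparatesPoints := by
    intro u v huv
    obtain ⟨k, hk⟩ : ∃ k, (u : EuclideanSpace ℝ ι) k ≠ (v : EuclideanSpace ℝ ι) k := by
      by_contra h
      push Not at h
      exact huv (Subtype.ext (PiLp.ext h))
    exact ⟨_, ⟨sphereCoord k, Algebra.subset_adjoin ⟨k, rfl⟩, rfl⟩, hk⟩
  obtain ⟨⟨p, hp⟩, hpg⟩ := ContinuousMap.exists_mem_subalgebra_near_continuousMap_of_separatesPoints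
    _ hsep g.toContinuousMap ε hε
  obtain ⟨m, hm⟩ := exists_mem_sphereAffine_pow hp
  refine ⟨m, p, hm, ?_⟩
  have h1 : ∫ u, (F u - g u) ^ 2 ∂(unitSphereMeasure ι) ≤ ε ^ 2 := by
    have := integral_sq_eq_eLpNorm_sq (hF.sub hgL)
    simp only [Pi.sub_apply] at this
    rw [this]
    refine pow_le_pow_left₀ ENNReal.toReal_nonneg ?_ 2
    exact ENNReal.toReal_le_of_le_ofReal hε.le hg
  have h2 : ∀ u, |g u - p u| ≤ ε := fun u => by
    have := (p - g.toContinuousMap).norm_coe_le_norm u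
    rw [ContinuousMap.sub_apply, Real.norm_eq_abs, abs_sub_comm] at this
    exact this.trans hpg.le
  have i1 : Integrable (fun u => 2 * (F u - g u) ^ 2) (unitSphereMeasure ι) :=
    (hF.sub hgL).integrable_sq.const_mul 2
  have i2 : Integrable (fun u => (F u - p u) ^ 2) (unitSphereMeasure ι) :=
    (hF.sub (memLp_continuous p)).integrable_sq
  calc ∫ u, (F u - p u) ^ 2 ∂(unitSphereMeasure ι)
      ≤ ∫ u, (2 * (F u - g u) ^ 2 + 2 * ε ^ 2) ∂(unitSphereMeasure ι) := by
        refine integral_mono i2 (i1.add (integrable_const _)) fun u => ?_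
        have h3 := sq_le_sq' (neg_le_of_abs_le (h2 u)) (le_of_abs_le (h2 u))
        show (F u - p u) ^ 2 ≤ 2 * (F u - g u) ^ 2 + 2 * ε ^ 2
        nlinarith [sq_nonneg (F u - g u - (g u - p u))]
    _ ≤ 4 * ε ^ 2 := by
        rw [integral_add i1 (integrable_const _), integral_const_mul]
        simp only [integral_const, probReal_univ, one_smul]
        linarith

/-- The spectral gap of the Kac walk. -/
lemma kac_gap [DecidableEq ι] [Nontrivial ι] {F : USphere ι → ℝ}
    (hF : MemLp F 2 (unitSphereMeasure ι)) :
    ((Fintype.card ι : ℝ) + 2) / 2 *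
        (∫ u, F u ^ 2 ∂(unitSphereMeasure ι) - (∫ u, F u ∂(unitSphereMeasure ι)) ^ 2) ≤
      ∑ i, ∑ j, energy (unitSphereMeasure ι) (sphereRot i j) (angleMeasure uniformDensity) F := by
  set c := ((Fintype.card ι : ℝ) + 2) / 2 with hc
  set n := (Fintype.card ι : ℝ) with hn
  set V := ∫ u, F u ^ 2 ∂(unitSphereMeasure ι) - (∫ u, F u ∂(unitSphereMeasure ι)) ^ 2
  have hc0 : 0 ≤ c := by positivity
  -- The same `δ` is the accuracy of approximation and the weight of the perturbation: a squared
  -- error of 4δ² against the weight 1/δ leaves errors of order δ.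
  have key : ∀ δ ∈ Set.Ioo (0 : ℝ) 1, (1 - δ) * (c * ((1 - δ) * V - 4 * δ)) - n * n * (8 * δ) ≤
      ∑ i, ∑ j, energy (unitSphereMeasure ι) (sphereRot i j) (angleMeasure uniformDensity) F := by
    rintro δ ⟨h0, h1⟩
    obtain ⟨m, p, hp, hFp⟩ := exists_polynomial_near hF h0
    have hpL := memLp_continuous p
    have e1 := variance_perturb hF hpL h0
    have e2 := kac_gap_polynomial hp
    have e3 : ∀ i j, (1 - δ) * energy (unitSphereMeasure ι) (sphereRot i j)
        (angleMeasure uniformDensity) p - 8 * δ ≤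
        energy (unitSphereMeasure ι) (sphereRot i j) (angleMeasure uniformDensity) F := fun i j => by
      have a1 := energy_perturb (isCircleFlow_sphereRot i j) hF hpL h0
      have a2 : 2 / δ * ∫ u, (F u - p u) ^ 2 ∂(unitSphereMeasure ι) ≤ 2 / δ * (4 * δ ^ 2) :=
        mul_le_mul_of_nonneg_left hFp (by positivity)
      have a3 : 2 / δ * (4 * δ ^ 2) = 8 * δ := by field_simp; norm_num
      linarith
    have e4 := Finset.sum_le_sum fun i (_ : i ∈ Finset.univ) =>
      Finset.sum_le_sum fun j (_ : j ∈ Finset.univ) => e3 i j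
    simp only [Finset.sum_sub_distrib, ← Finset.mul_sum, Finset.sum_const, Finset.card_univ,
      nsmul_eq_mul, ← hn] at e4
    have a2 : 1 / δ * ∫ u, (F u - p u) ^ 2 ∂(unitSphereMeasure ι) ≤ 1 / δ * (4 * δ ^ 2) :=
      mul_le_mul_of_nonneg_left hFp (by positivity)
    have a3 : 1 / δ * (4 * δ ^ 2) = 4 * δ := by field_simp
    have e5 : c * ((1 - δ) * V - 4 * δ) ≤ ∑ i, ∑ j, energy (unitSphereMeasure ι) (sphereRot i j)
        (angleMeasure uniformDensity) p :=
      (mul_le_mul_of_nonneg_left (by linarith) hc0).trans e2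
    have e6 := mul_le_mul_of_nonneg_left e5 (by linarith : (0 : ℝ) ≤ 1 - δ)
    linarith
  have hcont : Filter.Tendsto
      (fun δ : ℝ => (1 - δ) * (c * ((1 - δ) * V - 4 * δ)) - n * n * (8 * δ))
      (nhdsWithin 0 (Set.Ioi 0)) (nhds (c * V)) := by
    have : Continuous fun δ : ℝ => (1 - δ) * (c * ((1 - δ) * V - 4 * δ)) - n * n * (8 * δ) := by
      fun_prop
    have h := this.tendsto 0
    simp only [sub_zero, one_mul, mul_zero] at h
    exact h.mono_left nhdsWithin_le_nhds
  exact le_of_tendsto hcont (Filter.eventually_of_mem (Ioo_mem_nhdsGT one_pos) key)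

end KacGap

/-! ### Increments at a fixed angle -/

section IncrNorm

variable {X : Type*} [MeasurableSpace X] {ν : Measure X}

/-- The `L²` norm of the increment of `F` under the map `A`. -/
def incrNorm (ν : Measure X) (A : X → X) (F : X → ℝ) : ℝ :=
  (eLpNorm (fun x => F (A x) - F x) 2 ν).toReal

lemma incrNorm_nonneg (A : X → X) (F : X → ℝ) : 0 ≤ incrNorm ν A F := ENNReal.toReal_nonneg

lemma incrNorm_sq {A : X → X} (hA : MeasurePreserving A ν ν) {F : X → ℝ} (hF : MemLp F 2 ν) :
    incrNorm ν A F ^ 2 = sqIncr ν A F :=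
  (integral_sq_eq_eLpNorm_sq ((hF.comp_measurePreserving hA).sub hF)).symm

/-- F∘A∘B - F = (F∘A - F)∘B + (F∘B - F), and composition with `B` preserves the L² norm. -/
lemma incrNorm_comp_le {A B : X → X} (hA : MeasurePreserving A ν ν) (hB : MeasurePreserving B ν ν)
    {F : X → ℝ} (hF : MemLp F 2 ν) :
    incrNorm ν (fun x => A (B x)) F ≤ incrNorm ν A F + incrNorm ν B F := by
  have h1 : MemLp (fun x => F (A x) - F x) 2 ν := (hF.comp_measurePreserving hA).sub hF
  have h2 : MemLp (fun x => F (B x) - F x) 2 ν := (hF.comp_measurePreserving hB).sub hF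
  have h3 := eLpNorm_comp_measurePreserving (p := 2) h1.1 hB
  have h4 := h1.comp_measurePreserving hB
  have h5 := eLpNorm_add_le h4.1 h2.1 one_le_two
  have e : (fun x => F (A (B x)) - F x) =
      (fun x => F (A x) - F x) ∘ B + fun x => F (B x) - F x := by
    ext x
    simp
  rw [incrNorm, e, incrNorm, incrNorm, ← ENNReal.toReal_add h1.2.ne h2.2.ne]
  rw [h3] at h5
  exact ENNReal.toReal_mono (ENNReal.add_ne_top.2 ⟨h1.2.ne, h2.2.ne⟩) h5

/-- Factor T_θ = T_{-φ} T_{φ+θ} and average over `φ`: the increment at one angle costs four times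
the mean square increment, which is twice the energy. -/
lemma IsCircleFlow.sqIncr_le_energy [SFinite ν] {T : ℝ → X → X} (hT : IsCircleFlow T ν) {F : X → ℝ}
    (hF : MemLp F 2 ν) (θ : ℝ) :
    sqIncr ν (T θ) F ≤ 8 * energy ν T (angleMeasure uniformDensity) F := by
  have hp : Function.Periodic (fun φ => sqIncr ν (T φ) F) (2 * π) := fun φ => by
    simp only [sqIncr, hT.periodic]
  have h1 := hT.integrable_sqIncr (angleMeasure uniformDensity) hF
  have h2 : Integrable (fun φ => sqIncr ν (T (φ + θ)) F) (angleMeasure uniformDensity) := by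
    rw [integrable_angleMeasure_uniform] at h1 ⊢
    have := hp.intervalIntegrable (t := -π) two_pi_pos.ne' (by convert h1 using 1; ring)
      (-π + θ) (π + θ)
    simpa using this.comp_add_right θ
  have h3 : ∀ φ, sqIncr ν (T θ) F ≤ 2 * sqIncr ν (T (φ + θ)) F + 2 * sqIncr ν (T φ) F := fun φ => by
    have a1 := incrNorm_comp_le (hT.mp (-φ)) (hT.mp (φ + θ)) hF
    simp only [← hT.add, neg_add_cancel_left] at a1
    have a2 := pow_le_pow_left₀ (incrNorm_nonneg _ _) a1 2
    have a3 := incrNorm_sq (hT.mp (-φ)) hF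
    rw [hT.sqIncr_neg hF] at a3
    have a4 := incrNorm_sq (hT.mp (φ + θ)) hF
    have a5 := incrNorm_sq (hT.mp θ) hF
    rw [incrNorm] at a5
    rw [incrNorm] at a2
    rw [a5] at a2
    nlinarith [sq_nonneg (incrNorm ν (T (-φ)) F - incrNorm ν (T (φ + θ)) F)]
  have h4 := integral_mono (integrable_const (sqIncr ν (T θ) F))
    ((h2.const_mul 2).add (h1.const_mul 2)) h3
  simp only [Pi.add_apply] at h4
  rw [integral_add (h2.const_mul 2) (h1.const_mul 2), integral_const_mul, integral_const_mul,
    integral_uniform_add_of_periodic hp θ] at h4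
  simp only [integral_const, probReal_univ, one_smul] at h4
  rw [energy]
  linarith

end IncrNorm

/-! ### Moving a particle along a path by quarter turns -/

section Path

variable {ι : Type} [Fintype ι] [DecidableEq ι]

-- A quarter turn in the plane (x, y) exchanges the two coordinates up to a sign: the value at `x`
-- is carried to `y`, interacts with `z` there, and is carried back.
omit [Fintype ι] in
lemma rot_conj {x y z : ι} (hxy : x ≠ y) (hxz : x ≠ z) (hyz : y ≠ z) (θ : ℝ)
    (η : EuclideanSpace ℝ ι) :
    rot x z θ η = rot x y (π / 2) (rot y z θ (rot x y (-(π / 2)) η)) := by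
  have hyx := hxy.symm
  have hzx := hxz.symm
  have hzy := hyz.symm
  ext k
  by_cases h1 : k = x
  · subst h1
    simp [rot_apply, *]
  by_cases h2 : k = y
  · subst h2
    simp [rot_apply, *]
  by_cases h3 : k = z
  · subst h3
    simp [rot_apply, *]
  simp [rot_apply, *]

lemma sphereRot_conj {x y z : ι} (hxy : x ≠ y) (hxz : x ≠ z) (hyz : y ≠ z) (θ : ℝ)
    (u : USphere ι) :
    sphereRot x z θ u = sphereRot x y (π / 2) (sphereRot y z θ (sphereRot x y (-(π / 2)) u)) :=
  Subtype.ext (rot_conj hxy hxz hyz θ u)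

/-- `PathCost F x y c` says that a particle can be moved from `x` to `y` along a path on which the
increments of `F` add up to at most `c`. -/
def PathCost (F : USphere ι → ℝ) (x y : ι) (c : ℝ) : Prop :=
  ∀ z b, (∀ θ, incrNorm (unitSphereMeasure ι) (sphereRot y z θ) F ≤ b) →
    ∀ θ, incrNorm (unitSphereMeasure ι) (sphereRot x z θ) F ≤ 2 * c + b

variable {F : USphere ι → ℝ}

lemma incrNorm_sphereRot_self (x : ι) (θ : ℝ) :
    incrNorm (unitSphereMeasure ι) (sphereRot x x θ) F = 0 := by
  simp [incrNorm]

lemma PathCost.refl (x : ι) : PathCost F x x 0 := fun z b h θ => by simpa using h θ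

lemma PathCost.trans {x y z : ι} {a b : ℝ} (h1 : PathCost F x y a) (h2 : PathCost F y z b) :
    PathCost F x z (a + b) := fun w c h θ => by
  have := h1 w _ (h2 w c h) θ
  linarith

lemma PathCost.mono {x y : ι} {a b : ℝ} (h : PathCost F x y a) (hab : a ≤ b) :
    PathCost F x y b := fun w c hc θ => (h w c hc θ).trans (by linarith)

/-- Take z = y: once the particle is at `y` the rotation is the identity and costs nothing. -/
lemma PathCost.incrNorm_le {x y : ι} {c : ℝ} (h : PathCost F x y c) (θ : ℝ) :
    incrNorm (unitSphereMeasure ι) (sphereRot x y θ) F ≤ 2 * c := by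
  have := h y 0 (fun θ => (incrNorm_sphereRot_self y θ).le) θ
  linarith

/-- By `sphereRot_conj` the quarter turn is paid on the way out and on the way back, which is the 2
in `PathCost`. When two of the three sites coincide, the bound is direct. -/
lemma pathCost_of_incrNorm_le (hF : MemLp F 2 (unitSphereMeasure ι)) {x y : ι} {s : ℝ}
    (hs : ∀ θ, incrNorm (unitSphereMeasure ι) (sphereRot x y θ) F ≤ s) : PathCost F x y s := by
  intro z b hb θ
  have hs0 : 0 ≤ s := (incrNorm_nonneg _ _).trans (hs 0)
  have hb0 : 0 ≤ b := (incrNorm_nonneg _ _).trans (hb 0)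
  by_cases hxz : x = z
  · subst hxz
    rw [incrNorm_sphereRot_self]
    positivity
  by_cases hyz : y = z
  · subst hyz
    exact (hs θ).trans (by linarith)
  by_cases hxy : x = y
  · subst hxy
    exact (hb θ).trans (by linarith)
  have hR := fun (a b : ι) (t : ℝ) => (isCircleFlow_sphereRot a b).mp t
  have h1 := incrNorm_comp_le (hR x y (π / 2)) ((hR y z θ).comp (hR x y (-(π / 2)))) hF
  have h2 := incrNorm_comp_le (hR y z θ) (hR x y (-(π / 2))) hF
  simp only [Function.comp_def] at h1
  simp only [← sphereRot_conj hxy hxz hyz] at h1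
  have := hs (π / 2)
  have := hs (-(π / 2))
  have := hb θ
  have e : (fun u => sphereRot x z θ u) = sphereRot x z θ := rfl
  rw [e] at h1
  linarith

/-- The energy of the uniform rotations in the plane `(x, y)`. -/
def pairEnergy (F : USphere ι → ℝ) (x y : ι) : ℝ :=
  energy (unitSphereMeasure ι) (sphereRot x y) (angleMeasure uniformDensity) F

lemma pairEnergy_nonneg (x y : ι) : 0 ≤ pairEnergy F x y := energy_nonneg _ _ _

lemma sqrt_pathCost [Nonempty ι] (hF : MemLp F 2 (unitSphereMeasure ι)) (x y : ι) :
    PathCost F x y √(8 * pairEnergy F x y) ∧ PathCost F y x √(8 * pairEnergy F x y) := by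
  have hfl := isCircleFlow_sphereRot x y
  have h : ∀ θ, incrNorm (unitSphereMeasure ι) (sphereRot x y θ) F ≤ √(8 * pairEnergy F x y) :=
    fun θ => by
      refine le_sqrt_of_sq_le ?_
      rw [incrNorm_sq (hfl.mp θ) hF]
      exact hfl.sqIncr_le_energy hF θ
  refine ⟨pathCost_of_incrNorm_le hF h, pathCost_of_incrNorm_le hF fun θ => ?_⟩
  have e : sphereRot y x θ = sphereRot x y (-θ) := funext fun u => sphereRot_swap x y θ u
  rw [e]
  exact h _

lemma PathCost.pairEnergy_le [Nonempty ι] (hF : MemLp F 2 (unitSphereMeasure ι)) {x y : ι} {c : ℝ}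
    (h : PathCost F x y c) : pairEnergy F x y ≤ 2 * c ^ 2 := by
  have hfl := isCircleFlow_sphereRot x y
  have h1 : ∀ θ, sqIncr (unitSphereMeasure ι) (sphereRot x y θ) F ≤ 4 * c ^ 2 := fun θ => by
    have := pow_le_pow_left₀ (incrNorm_nonneg _ _) (h.incrNorm_le θ) 2
    rw [incrNorm_sq (hfl.mp θ) hF] at this
    linarith
  have h2 := integral_mono (hfl.integrable_sqIncr (angleMeasure uniformDensity) hF)
    (integrable_const (4 * c ^ 2)) h1
  simp only [integral_const, probReal_univ, one_smul] at h2
  rw [pairEnergy, energy]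
  linarith

end Path

/-! ### Lattice paths in the cube and their congestion -/

section CubePath

variable {d N : ℕ} [NeZero N]

/-- The neighbour of `z` in the positive direction `i` (if it exists). -/
def cubeNext (i : Fin d) (z : Cube d N) : Cube d N := Function.update z i (Fin.ofNat N (z i + 1))

/-- The energy of the edge that leaves `z` in the positive direction `i`. -/
def edgeEnergy (F : USphere (Cube d N) → ℝ) (i : Fin d) (z : Cube d N) : ℝ :=
  -- The test removes the face where `Fin.ofNat` would wrap around to 0.
  if (z i : ℕ) + 1 < N then pairEnergy F z (cubeNext i z) else 0

variable {F : USphere (Cube d N) → ℝ}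

lemma edgeEnergy_nonneg (i : Fin d) (z : Cube d N) : 0 ≤ edgeEnergy F i z := by
  rw [edgeEnergy]
  split_ifs
  · exact pairEnergy_nonneg _ _
  · exact le_rfl

lemma pathCost_line_of_le (hF : MemLp F 2 (unitSphereMeasure (Cube d N))) (i : Fin d)
    (z : Cube d N) {a b : ℕ} (hab : a ≤ b) (hb : b < N) :
    PathCost F (Function.update z i (Fin.ofNat N a)) (Function.update z i (Fin.ofNat N b))
      (∑ t ∈ Finset.Ico a b, √(8 * edgeEnergy F i (Function.update z i (Fin.ofNat N t)))) ∧
    PathCost F (Function.update z i (Fin.ofNat N b)) (Function.update z i (Fin.ofNat N a))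
      (∑ t ∈ Finset.Ico a b, √(8 * edgeEnergy F i (Function.update z i (Fin.ofNat N t)))) := by
  induction b, hab using Nat.le_induction with
  | base => simpa using PathCost.refl _
  | succ b hab ih =>
    obtain ⟨h1, h2⟩ := ih (by omega)
    rw [Finset.sum_Ico_succ_top hab]
    have e1 : ((Function.update z i (Fin.ofNat N b)) i : ℕ) = b := by
      simp [Nat.mod_eq_of_lt (show b < N by omega)]
    have e2 : cubeNext i (Function.update z i (Fin.ofNat N b)) =
        Function.update z i (Fin.ofNat N (b + 1)) := by
      rw [cubeNext, e1, Function.update_idem]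
    have e3 : edgeEnergy F i (Function.update z i (Fin.ofNat N b)) =
        pairEnergy F (Function.update z i (Fin.ofNat N b))
          (Function.update z i (Fin.ofNat N (b + 1))) := by
      rw [edgeEnergy, e1, if_pos hb, e2]
    obtain ⟨h3, h4⟩ := sqrt_pathCost hF (Function.update z i (Fin.ofNat N b))
      (Function.update z i (Fin.ofNat N (b + 1)))
    rw [e3]
    exact ⟨h1.trans h3, (h4.trans h2).mono (add_comm _ _).le⟩

/-- The whole line is charged, whatever the end points; this wastes little and makes the later count
of edges over all pairs a simple change of variables. -/
lemma pathCost_line (hF : MemLp F 2 (unitSphereMeasure (Cube d N))) (i : Fin d) (z : Cube d N)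
    (a b : Fin N) : PathCost F (Function.update z i a) (Function.update z i b)
      (∑ t : Fin N, √(8 * edgeEnergy F i (Function.update z i t))) := by
  have hsum : ∑ t : Fin N, √(8 * edgeEnergy F i (Function.update z i t)) =
      ∑ t ∈ Finset.range N, √(8 * edgeEnergy F i (Function.update z i (Fin.ofNat N t))) := by
    rw [← Fin.sum_univ_eq_sum_range fun t => √(8 * edgeEnergy F i (Function.update z i (Fin.ofNat N t)))]
    simp
  have hle : ∀ a b : Fin N, ∑ t ∈ Finset.Ico (a : ℕ) b,
      √(8 * edgeEnergy F i (Function.update z i (Fin.ofNat N t))) ≤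
      ∑ t : Fin N, √(8 * edgeEnergy F i (Function.update z i t)) := fun a b => by
    rw [hsum]
    refine Finset.sum_le_sum_of_subset_of_nonneg (fun t ht => ?_) fun _ _ _ => sqrt_nonneg _
    have := Finset.mem_Ico.1 ht
    exact Finset.mem_range.2 (this.2.trans b.2)
  rcases le_total a b with h | h
  · have := (pathCost_line_of_le hF i z (Fin.le_def.1 h) b.2).1.mono (hle a b)
    simpa using this
  · have := (pathCost_line_of_le hF i z (Fin.le_def.1 h) a.2).2.mono (hle b a)
    simpa using this

omit [NeZero N] in
/-- The configuration that agrees with `y` in the first `k` directions, and with `x` in the others. -/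
def cubeMix (k : ℕ) (x y : Cube d N) : Cube d N := fun l => if (l : ℕ) < k then y l else x l

/-- The path changes the coordinates of `x` into those of `y` one direction at a time, moving along
a line each time. -/
lemma pathCost_mix (hF : MemLp F 2 (unitSphereMeasure (Cube d N))) (x y : Cube d N) (k : ℕ)
    (hk : k ≤ d) : PathCost F x (cubeMix k x y) (∑ i ∈ Finset.univ.filter fun i : Fin d => (i : ℕ) < k,
      ∑ t : Fin N, √(8 * edgeEnergy F i (Function.update (cubeMix i x y) i t))) := by
  induction k with
  | zero =>
    have : cubeMix 0 x y = x := by ext l; simp [cubeMix]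
    rw [this]
    simpa using PathCost.refl x
  | succ k ih =>
    have hk' : k < d := hk
    have h1 := ih hk'.le
    have e1 : Function.update (cubeMix k x y) ⟨k, hk'⟩ (x ⟨k, hk'⟩) = cubeMix k x y := by
      rw [Function.update_eq_self_iff]
      simp [cubeMix]
    have e2 : Function.update (cubeMix k x y) ⟨k, hk'⟩ (y ⟨k, hk'⟩) = cubeMix (k + 1) x y := by
      ext1 l
      by_cases hl : l = ⟨k, hk'⟩
      · subst hl; simp [cubeMix]
      · have : (l : ℕ) ≠ k := fun e => hl (Fin.ext e)
        rw [Function.update_of_ne hl, cubeMix, cubeMix]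
        congr 1
        exact propext (by omega)
    have h2 := pathCost_line hF ⟨k, hk'⟩ (cubeMix k x y) (x ⟨k, hk'⟩) (y ⟨k, hk'⟩)
    rw [e1, e2] at h2
    have e3 : (Finset.univ.filter fun i : Fin d => (i : ℕ) < k + 1) =
        insert ⟨k, hk'⟩ (Finset.univ.filter fun i : Fin d => (i : ℕ) < k) := by
      ext i
      simp only [Finset.mem_filter, Finset.mem_univ, true_and, Finset.mem_insert, Fin.ext_iff]
      omega
    rw [e3, Finset.sum_insert (by simp)]
    exact (h1.trans h2).mono (add_comm _ _).le

/-- Cauchy–Schwarz over the d N charged positions; the constant is 2 from `PathCost.pairEnergy_le`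
times 8 from the cost of an edge. -/
lemma pairEnergy_le_sum_edgeEnergy (hF : MemLp F 2 (unitSphereMeasure (Cube d N)))
    (x y : Cube d N) : pairEnergy F x y ≤ 16 * (d * N) *
      ∑ i : Fin d, ∑ t : Fin N, edgeEnergy F i (Function.update (cubeMix i x y) i t) := by
  have h1 := pathCost_mix hF x y d le_rfl
  have e1 : cubeMix d x y = y := by ext l; simp [cubeMix]
  rw [e1, Finset.filter_true_of_mem fun i _ => Fin.is_lt i] at h1
  have h2 := h1.pairEnergy_le hF
  rw [← Fintype.sum_prod_type' (f := fun (i : Fin d) (t : Fin N) =>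
    √(8 * edgeEnergy F i (Function.update (cubeMix i x y) i t)))] at h2
  have h3 := sq_sum_le_card_mul_sum_sq (s := (Finset.univ : Finset (Fin d × Fin N)))
    (f := fun p => √(8 * edgeEnergy F p.1 (Function.update (cubeMix p.1 x y) p.1 p.2)))
  have e2 : ∀ p : Fin d × Fin N,
      √(8 * edgeEnergy F p.1 (Function.update (cubeMix p.1 x y) p.1 p.2)) ^ 2 =
      8 * edgeEnergy F p.1 (Function.update (cubeMix p.1 x y) p.1 p.2) := fun p =>
    sq_sqrt (mul_nonneg (by norm_num) (edgeEnergy_nonneg _ _))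
  simp only [e2, ← Finset.mul_sum] at h3
  rw [Fintype.sum_prod_type (f := fun p : Fin d × Fin N =>
    edgeEnergy F p.1 (Function.update (cubeMix p.1 x y) p.1 p.2))] at h3
  simp only [Finset.card_univ, Fintype.card_prod, Fintype.card_fin, Nat.cast_mul] at h3
  linarith

-- The map (x, y) ↦ (mix of x and y, mix of y and x) is an involution, so every configuration is
-- attained equally often.
omit [NeZero N] in
lemma sum_sum_cubeMix (k : ℕ) (g : Cube d N → ℝ) :
    ∑ x, ∑ y, g (cubeMix k x y) = (N : ℝ) ^ d * ∑ z, g z := by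
  have hinv : Function.Involutive fun p : Cube d N × Cube d N =>
      (cubeMix k p.1 p.2, cubeMix k p.2 p.1) := fun p => by
    ext l <;> simp only [cubeMix] <;> split_ifs <;> rfl
  have h : ∑ p : Cube d N × Cube d N, g (cubeMix k p.1 p.2) = ∑ p : Cube d N × Cube d N, g p.1 :=
    Equiv.sum_comp hinv.toPerm fun p => g p.1
  rw [← Fintype.sum_prod_type' (f := fun x y => g (cubeMix k x y)), h, Fintype.sum_prod_type]
  simp [← Finset.mul_sum]

omit [NeZero N] in
lemma sum_sum_update (i : Fin d) (g : Cube d N → ℝ) :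
    ∑ z : Cube d N, ∑ t : Fin N, g (Function.update z i t) = N * ∑ z, g z := by
  have hinv : Function.Involutive fun p : Cube d N × Fin N =>
      (Function.update p.1 i p.2, p.1 i) := fun p => by
    simp
  have h : ∑ p : Cube d N × Fin N, g (Function.update p.1 i p.2) = ∑ p : Cube d N × Fin N, g p.1 :=
    Equiv.sum_comp hinv.toPerm fun p => g p.1
  rw [← Fintype.sum_prod_type' (f := fun (z : Cube d N) (t : Fin N) => g (Function.update z i t)),
    h, Fintype.sum_prod_type]
  simp [← Finset.mul_sum]

lemma cubeNext_apply_self {i : Fin d} {z : Cube d N} (h : (z i : ℕ) + 1 < N) :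
    (cubeNext i z i : ℕ) = z i + 1 := by
  simp [cubeNext, Nat.mod_eq_of_lt h]

lemma cubeNext_apply_of_ne {i k : Fin d} (z : Cube d N) (h : k ≠ i) : cubeNext i z k = z k :=
  Function.update_of_ne h _ _

lemma cubeDist_cubeNext {i : Fin d} {z : Cube d N} (h : (z i : ℕ) + 1 < N) :
    cubeDist z (cubeNext i z) = 1 := by
  rw [cubeDist, Finset.sum_eq_single i]
  · rw [cubeNext_apply_self h]; simp
  · intro k _ hk
    rw [cubeNext_apply_of_ne z hk]; simp
  · simp

/-- The forward neighbours of `z` in different directions are distinct, so they form a subset of its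
neighbours. -/
lemma sum_edgeEnergy_le (z : Cube d N) :
    ∑ i, edgeEnergy F i z ≤ ∑ y : Cube d N with cubeDist z y = 1, pairEnergy F z y := by
  simp only [edgeEnergy]
  rw [← Finset.sum_filter, ← Finset.sum_image (f := fun y => pairEnergy F z y) (g := fun i => cubeNext i z)]
  · refine Finset.sum_le_sum_of_subset_of_nonneg (fun y hy => ?_) fun _ _ _ => pairEnergy_nonneg _ _
    obtain ⟨i, hi, rfl⟩ := Finset.mem_image.1 hy
    exact Finset.mem_filter.2 ⟨Finset.mem_univ _, cubeDist_cubeNext (Finset.mem_filter.1 hi).2⟩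
  · intro i hi j hj hij
    by_contra hne
    have hi' := (Finset.mem_filter.1 (Finset.mem_coe.1 hi)).2
    have h1 := cubeNext_apply_self hi'
    simp only at hij
    rw [hij, cubeNext_apply_of_ne z hne] at h1
    omega

lemma sum_pairEnergy_le (hF : MemLp F 2 (unitSphereMeasure (Cube d N))) :
    ∑ x, ∑ y, pairEnergy F x y ≤ 16 * d * (N : ℝ) ^ 2 * (N : ℝ) ^ d *
      ∑ x : Cube d N, ∑ y : Cube d N with cubeDist x y = 1, pairEnergy F x y := by
  calc ∑ x, ∑ y, pairEnergy F x y
      ≤ ∑ x : Cube d N, ∑ y : Cube d N, 16 * (d * N) * ∑ i : Fin d, ∑ t : Fin N,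
          edgeEnergy F i (Function.update (cubeMix i x y) i t) :=
        Finset.sum_le_sum fun x _ => Finset.sum_le_sum fun y _ =>
          pairEnergy_le_sum_edgeEnergy hF x y
    _ = 16 * (d * N) * ∑ i : Fin d, ∑ x : Cube d N, ∑ y : Cube d N, ∑ t : Fin N,
          edgeEnergy F i (Function.update (cubeMix i x y) i t) := by
        simp only [← Finset.mul_sum]
        congr 1
        exact (Finset.sum_congr rfl fun x _ => Finset.sum_comm).trans Finset.sum_comm
    _ = 16 * d * (N : ℝ) ^ 2 * (N : ℝ) ^ d * ∑ z : Cube d N, ∑ i : Fin d, edgeEnergy F i z := by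
        have e : ∀ i : Fin d, ∑ x : Cube d N, ∑ y : Cube d N, ∑ t : Fin N,
            edgeEnergy F i (Function.update (cubeMix i x y) i t) =
            (N : ℝ) ^ d * (N * ∑ z, edgeEnergy F i z) := fun i => by
          rw [sum_sum_cubeMix i fun z => ∑ t : Fin N, edgeEnergy F i (Function.update z i t),
            sum_sum_update i (edgeEnergy F i)]
        simp only [e, ← Finset.mul_sum]
        rw [Finset.sum_comm]
        ring
    _ ≤ _ := mul_le_mul_of_nonneg_left (Finset.sum_le_sum fun z _ => sum_edgeEnergy_le z)
        (by positivity)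

end CubePath

/-! ### Gaps of the uniform walks and the final comparison -/

section Assembly

variable {ι : Type} [Fintype ι] [DecidableEq ι]

/-- The spectral gap is an infimum over a nonempty set. -/
lemma exists_memLp_mean_zero [Nonempty ι] {ω : ℝ} (hω : 0 < ω) :
    ∃ f : EuclideanSpace ℝ ι → ℝ, MemLp f 2 (sphereMeasure ι ω) ∧
      ∫ η, f η ∂(sphereMeasure ι ω) = 0 ∧ ∫ η, f η ^ 2 ∂(sphereMeasure ι ω) ≠ 0 := by
  obtain ⟨i⟩ := ‹Nonempty ι›
  have hc : Continuous fun η : EuclideanSpace ℝ ι => η i := by fun_prop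
  -- A coordinate is odd under η ↦ -η, so its mean vanishes, and it is not identically zero on the
  -- sphere, even when there is only one coordinate.
  refine ⟨fun η => η i, ?_, ?_, ?_⟩
  · rw [sphereMeasure_eq_map, memLp_map_measure_iff hc.aestronglyMeasurable
      (continuous_dilation ω).measurable.aemeasurable]
    exact memLp_continuous ⟨fun u : USphere ι => (√ω • (u : EuclideanSpace ℝ ι)) i, by fun_prop⟩
  · have h1 := integral_comp_mp (measurePreserving_sphereMeasure (LinearIsometryEquiv.neg ℝ) ω)
      (f := fun η : EuclideanSpace ℝ ι => η i) hc.aestronglyMeasurable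
    simp only [LinearIsometryEquiv.coe_neg, PiLp.neg_apply, integral_neg] at h1
    linarith
  · show ∫ η : EuclideanSpace ℝ ι, η i ^ 2 ∂(sphereMeasure ι ω) ≠ 0
    rw [integral_sphereMeasure (ω := ω) (f := fun η : EuclideanSpace ℝ ι => η i ^ 2)
      (hc.pow 2).aestronglyMeasurable]
    have h1 : ∀ u : USphere ι, toUnit ω (fun η : EuclideanSpace ℝ ι => η i ^ 2) u =
        ω * (sphereCoord i u * sphereCoord i u) := fun u => by
      simp only [toUnit, sphereCoord, PiLp.smul_apply, smul_eq_mul, mul_pow, sq_sqrt hω.le,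
        ContinuousMap.coe_mk]
      ring
    simp only [h1]
    rw [integral_const_mul, ← sphereForm_apply]
    refine (mul_pos hω (sphereForm_self_pos fun h => ?_)).ne'
    have h2 := congrArg (fun g : C(USphere ι, ℝ) =>
      g ⟨EuclideanSpace.single i 1, by simp⟩) h
    simp [sphereCoord] at h2

lemma kac_gap_sphereMeasure [Nontrivial ι] {ω : ℝ} {f : EuclideanSpace ℝ ι → ℝ}
    (hf : MemLp f 2 (sphereMeasure ι ω)) (h0 : ∫ η, f η ∂(sphereMeasure ι ω) = 0) :
    ((Fintype.card ι : ℝ) + 2) / 2 * ∫ η, f η ^ 2 ∂(sphereMeasure ι ω) ≤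
      ∑ i, ∑ j, energy (sphereMeasure ι ω) (rot i j) (angleMeasure uniformDensity) f := by
  have := kac_gap (memLp_toUnit hf)
  rw [← integral_sphereMeasure hf.1, h0] at this
  rw [integral_sphereMeasure hf.integrable_sq.aestronglyMeasurable]
  simp only [energy_toUnit hf]
  refine le_trans (le_of_eq ?_) this
  simp [toUnit]

variable {ρ : ℝ → ℝ}

lemma le_gap {N : ℕ} [NeZero N] {C : ℝ}
    (h : ∀ ω : ℝ, 0 < ω → ∀ f : EuclideanSpace ℝ (Fin N) → ℝ, MemLp f 2 (sphereMeasure (Fin N) ω) →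
      ∫ η, f η ∂(sphereMeasure (Fin N) ω) = 0 → C * ∫ η, f η ^ 2 ∂(sphereMeasure (Fin N) ω) ≤
        ∫ η, f η * (-gen ρ N f η) ∂(sphereMeasure (Fin N) ω)) : C ≤ gap ρ N := by
  have : Nonempty (Set.Ioi (0 : ℝ)) := ⟨⟨1, Set.mem_Ioi.2 one_pos⟩⟩
  exact le_ciInf fun ω => le_spectralGap (exists_memLp_mean_zero ω.2) (h ω ω.2)

lemma le_gapLoc {d N : ℕ} [NeZero N] {C : ℝ}
    (h : ∀ ω : ℝ, 0 < ω → ∀ f : EuclideanSpace ℝ (Cube d N) → ℝ,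
      MemLp f 2 (sphereMeasure (Cube d N) ω) → ∫ η, f η ∂(sphereMeasure (Cube d N) ω) = 0 →
      C * ∫ η, f η ^ 2 ∂(sphereMeasure (Cube d N) ω) ≤
        ∫ η, f η * (-genLoc ρ d N f η) ∂(sphereMeasure (Cube d N) ω)) : C ≤ gapLoc ρ d N := by
  have : Nonempty (Set.Ioi (0 : ℝ)) := ⟨⟨1, Set.mem_Ioi.2 one_pos⟩⟩
  exact le_ciInf fun ω => le_spectralGap (exists_memLp_mean_zero ω.2) (h ω ω.2)

/-- The spectral gap of the Kac walk is at least `(N + 2) / (4 N)`. -/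
lemma le_gapStar {N : ℕ} (hN : 2 ≤ N) : ((N : ℝ) + 2) / (4 * N) ≤ gapStar N := by
  have : NeZero N := ⟨by omega⟩
  have : Nontrivial (Fin N) := Fin.nontrivial_iff_two_le.2 hN
  have hN0 : (0 : ℝ) < N := by positivity
  rw [gapStar_eq]
  refine le_gap fun ω hω f hf h0 => ?_
  rw [integral_mul_neg_gen isCircleDensity_uniform hf]
  have h1 := kac_gap_sphereMeasure hf h0
  rw [Fintype.card_fin] at h1
  have h2 := mul_le_mul_of_nonneg_left h1 (by positivity : (0 : ℝ) ≤ 1 / (2 * N))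
  refine le_trans (le_of_eq ?_) h2
  field_simp
  norm_num

/-- The spectral gap of the local Kac walk is at least of order `1 / (d N²)`. -/
lemma le_gapStarLoc {d N : ℕ} (hd : 1 ≤ d) (hN : 2 ≤ N) :
    1 / (64 * (d : ℝ) * (N : ℝ) ^ 2) ≤ gapStarLoc d N := by
  have : NeZero N := ⟨by omega⟩
  have : Nontrivial (Fin N) := Fin.nontrivial_iff_two_le.2 hN
  have : Nonempty (Fin d) := ⟨⟨0, hd⟩⟩
  have hN0 : (0 : ℝ) < N := by positivity
  have hd0 : (0 : ℝ) < d := by exact_mod_cast hd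
  rw [gapStarLoc_eq]
  refine le_gapLoc fun ω hω f hf h0 => ?_
  rw [integral_mul_neg_genLoc isCircleDensity_uniform hf]
  have h1 := kac_gap_sphereMeasure hf h0
  have h2 := sum_pairEnergy_le (memLp_toUnit hf)
  simp only [pairEnergy, ← energy_toUnit hf] at h2
  have h3 := h1.trans h2
  set V := ∫ η, f η ^ 2 ∂(sphereMeasure (Cube d N) ω)
  set S := ∑ x : Cube d N, ∑ y : Cube d N with cubeDist x y = 1,
    energy (sphereMeasure (Cube d N) ω) (rot x y) (angleMeasure uniformDensity) f
  have hV : 0 ≤ V := integral_nonneg fun _ => sq_nonneg _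
  have hcard : (Fintype.card (Cube d N) : ℝ) = (N : ℝ) ^ d := by simp
  rw [hcard] at h3
  have hp : (0 : ℝ) < (N : ℝ) ^ d := by positivity
  -- The factor (N^d + 2)/2 from the gap on the complete graph is bounded below by N^d/2; this
  -- cancels the number N^d of paths.
  have h4 : (N : ℝ) ^ d * V ≤ (N : ℝ) ^ d * (32 * d * (N : ℝ) ^ 2 * S) := by nlinarith
  have h5 := le_of_mul_le_mul_left h4 hp
  rw [div_mul_eq_mul_div, one_mul, div_le_iff₀ (by positivity)]
  linarith

variable (hρ : IsCircleDensity ρ)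

include hρ

lemma gen_form_comparison {N : ℕ} [NeZero N] {ω : ℝ} {f : EuclideanSpace ℝ (Fin N) → ℝ}
    (hf : MemLp f 2 (sphereMeasure (Fin N) ω)) :
    2 * gap ρ 2 * ∫ η, f η * (-gen uniformDensity N f η) ∂(sphereMeasure (Fin N) ω) ≤
      ∫ η, f η * (-gen ρ N f η) ∂(sphereMeasure (Fin N) ω) := by
  rw [integral_mul_neg_gen isCircleDensity_uniform hf, integral_mul_neg_gen hρ hf, mul_left_comm,
    Finset.mul_sum]
  refine mul_le_mul_of_nonneg_left (Finset.sum_le_sum fun i _ => ?_) (by positivity)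
  rw [Finset.mul_sum]
  exact Finset.sum_le_sum fun j _ => (isCircleFlow_rot i j ω).energy_comparison hρ hf

lemma genLoc_form_comparison {d N : ℕ} [NeZero N] {ω : ℝ} {f : EuclideanSpace ℝ (Cube d N) → ℝ}
    (hf : MemLp f 2 (sphereMeasure (Cube d N) ω)) :
    2 * gap ρ 2 * ∫ η, f η * (-genLoc uniformDensity d N f η) ∂(sphereMeasure (Cube d N) ω) ≤
      ∫ η, f η * (-genLoc ρ d N f η) ∂(sphereMeasure (Cube d N) ω) := by
  rw [integral_mul_neg_genLoc isCircleDensity_uniform hf, integral_mul_neg_genLoc hρ hf,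
    mul_left_comm, Finset.mul_sum]
  refine mul_le_mul_of_nonneg_left (Finset.sum_le_sum fun i _ => ?_) (by positivity)
  rw [Finset.mul_sum]
  exact Finset.sum_le_sum fun j _ => (isCircleFlow_rot i j ω).energy_comparison hρ hf

/-- The nonnegativity of λ(2) allows the gap inequality of the uniform walk to be multiplied by
2λ(2) before the comparison of forms. -/
lemma two_mul_gap_mul_gapStar_le (N : ℕ) [NeZero N] : 2 * gap ρ 2 * gapStar N ≤ gap ρ N := by
  refine le_gap fun ω hω f hf h0 => ?_
  rw [mul_assoc, gapStar_eq]
  exact (mul_le_mul_of_nonneg_left (gap_mul_le isCircleDensity_uniform hω hf h0)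
    (mul_nonneg two_pos.le (gap_nonneg hρ 2))).trans (gen_form_comparison hρ hf)

lemma two_mul_gap_mul_gapStarLoc_le (d N : ℕ) [NeZero N] :
    2 * gap ρ 2 * gapStarLoc d N ≤ gapLoc ρ d N := by
  refine le_gapLoc fun ω hω f hf h0 => ?_
  rw [mul_assoc, gapStarLoc_eq]
  exact (mul_le_mul_of_nonneg_left (gapLoc_mul_le isCircleDensity_uniform hω hf h0)
    (mul_nonneg two_pos.le (gap_nonneg hρ 2))).trans (genLoc_form_comparison hρ hf)

end Assembly

end KacWalk

end

theorem mainTheorem2 (ρ : ℝ → ℝ) (hρ : KacWalk.IsCircleDensity ρ) :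
    (∀ N : ℕ, 1 ≤ N →
      KacWalk.gap ρ N ≥ 2 * KacWalk.gap ρ 2 * KacWalk.gapStar N) ∧
    (∀ d N : ℕ, 1 ≤ d → 1 ≤ N →
      KacWalk.gapLoc ρ d N ≥ 2 * KacWalk.gap ρ 2 * KacWalk.gapStarLoc d N) ∧
    (∀ N : ℕ, 2 ≤ N →
      KacWalk.gap ρ N ≥ KacWalk.gap ρ 2 * (((N : ℝ) + 2) / (2 * (N : ℝ)))) ∧
    (∀ d N : ℕ, 1 ≤ d → 2 ≤ N →
      KacWalk.gapLoc ρ d N ≥ KacWalk.gap ρ 2 * (1 / (192 * (d : ℝ) * (N : ℝ) ^ 2))) := by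
  have h2 : 0 ≤ KacWalk.gap ρ 2 := KacWalk.gap_nonneg hρ 2
  refine ⟨fun N hN => ?_, fun d N _ hN => ?_, fun N hN => ?_, fun d N hd hN => ?_⟩
  · have : NeZero N := ⟨by omega⟩
    exact KacWalk.two_mul_gap_mul_gapStar_le hρ N
  · have : NeZero N := ⟨by omega⟩
    exact KacWalk.two_mul_gap_mul_gapStarLoc_le hρ d N
  · have : NeZero N := ⟨by omega⟩
    refine le_trans ?_ (KacWalk.two_mul_gap_mul_gapStar_le hρ N)
    have h3 := mul_le_mul_of_nonneg_left (KacWalk.le_gapStar hN) h2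
    have e : KacWalk.gap ρ 2 * (((N : ℝ) + 2) / (2 * N)) =
        2 * (KacWalk.gap ρ 2 * (((N : ℝ) + 2) / (4 * N))) := by
      field_simp
      norm_num
    rw [e]
    linarith
  · have : NeZero N := ⟨by omega⟩
    refine le_trans ?_ (KacWalk.two_mul_gap_mul_gapStarLoc_le hρ d N)
    have hN0 : (0 : ℝ) < N := by positivity
    have hd0 : (0 : ℝ) < d := by exact_mod_cast hd
    -- The estimates give 2/(64 d N²) = 1/(32 d N²), six times what is required.
    have h3 : 1 / (192 * (d : ℝ) * (N : ℝ) ^ 2) ≤ 2 * KacWalk.gapStarLoc d N := by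
      have h4 := KacWalk.le_gapStarLoc hd hN
      have h5 : 1 / (192 * (d : ℝ) * (N : ℝ) ^ 2) ≤ 1 / (64 * (d : ℝ) * (N : ℝ) ^ 2) := by
        gcongr
        norm_num
      have h6 : 0 ≤ 1 / (64 * (d : ℝ) * (N : ℝ) ^ 2) := by positivity
      linarith
    have := mul_le_mul_of_nonneg_left h3 h2
    linarith
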